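/- Let $\Sigma$ be a set of letters (for instance a finite alphabet), and let $\mathbb{B}=\{0,1\mid 1+1=1\}$ be the Boolean semiring. A nondeterministic finite automaton $(Q)=(Q,\delta,Q_{\mathrm{in}},Q_{\mathrm t})$ over $\Sigma$ consists of a finite set $Q$ of states, a transition function $\delta:Q\times\Sigma\to\mathcal P(Q)$, and subsets $Q_{\mathrm{in}},Q_{\mathrm t}\subseteq Q$ of initial and accepting states; an isomorphism of automata over $\Sigma$ is a bijection of the sets of states that carries transition function, initial states and accepting states of one automaton to those of the other. Let $\mathrm{Cob}_{\Sigma,\mathsf I}$ be the symmetric monoidal category whose objects are finite sequences of signs $+,-$ (oriented $0$-manifolds) and whose morphisms are compact oriented $1$-dimensional cobordisms, up to isomorphism relative to the boundary, which may have endpoints in the interior of the cobordism (inner endpoints) and finitely many interior points labelled by elements of $\Sigma$ (defects); composition is gluing and the tensor product is disjoint union. Let $\mathbb{B}\text{-}\mathrm{fmod}$ be the symmetric monoidal category of free $\mathbb{B}$-modules with $\otimes_{\mathbb B}$. For an automaton $(Q)$ let $\mathbb{B}Q$ be the free $\mathbb{B}$-module with basis $Q$ and $(\mathbb{B}Q)^*$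 its dual, with elements $q^*$, $q^*(q')=\delta_{q,q'}$; for $a\in\Sigma$ let $m_a:\mathbb{B}Q\to\mathbb{B}Q$ be the linear map $m_a(q)=\sum_{q'\in\delta(q,a)}q'$; write $Q_{\mathrm{in}}=\sum_{q\in Q_{\mathrm{in}}}q\in\mathbb{B}Q$, and let $Q_{\mathrm t}^*\in(\mathbb{B}Q)^*$ be the functional with $Q_{\mathrm t}^*(q)=1$ if $q\in Q_{\mathrm t}$ and $0$ otherwise. 1. Every nondeterministic finite automaton $(Q)$ over $\Sigma$ gives rise to a symmetric (strong) monoidal functor $\mathcal F_{(Q)}:\mathrm{Cob}_{\Sigma,\mathsf I}\to\mathbb{B}\text{-}\mathrm{fmod}$ such that, under identifications $\mathcal F_{(Q)}(+)\cong\mathbb{B}Q$ and $\mathcal F_{(Q)}(-)\cong(\mathbb{B}Q)^*$: an upward oriented interval with one defect $a$ goes to $m_a$, and a downward oriented one to the dual map $m_a^*$; the cup $\emptyset\to(+,-)$ goes to $1\mapsto\sum_{q}q\otimes q^*$ and the cap $(-,+)\to\emptyset$ to the evaluation $f\otimes x\mapsto f(x)$; the half-interval with boundary point $+$ at the top goes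 to $1\mapsto Q_{\mathrm{in}}$, with $+$ at the bottom to $Q_{\mathrm t}^*$, with $-$ at the top to $1\mapsto Q_{\mathrm t}^*$, and with $-$ at the bottom to $f\mapsto f(Q_{\mathrm{in}})$. 2. The assignment $(Q)\mapsto\mathcal F_{(Q)}$ induces a bijection between isomorphism classes of nondeterministic finite automata over $\Sigma$ and isomorphism classes (with respect to monoidal natural isomorphism) of symmetric monoidal functors $\mathrm{Cob}_{\Sigma,\mathsf I}\to\mathbb{B}\text{-}\mathrm{fmod}$. Moreover, a symmetric monoidal functor lies in the class corresponding to $(Q)$ if and only if it has the values listed in 1 for suitable identifications. -/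

import Mathlib

open CategoryTheory MonoidalCategory
open scoped TensorProduct

namespace OneCob

universe u

/-- A compact oriented `0`-manifold: finitely many positive and finitely many negative points.
The parameter `A` is the alphabet of the defects on the cobordisms between such manifolds. -/
structure Pts (A : Type u) : Type 1 where
  pos : Type
  neg : Type
  [finite_pos : Finite pos]
  [finite_neg : Finite neg]

attribute [instance] Pts.finite_pos Pts.finite_neg

/-- The points of a decorated oriented `1`-cobordism at which an oriented edge may begin:
bottom boundary points of sign `+`, top boundary points of sign `-`, inner initial endpoints and
two-valent vertices. -/
inductive Src (P N S V : Type) : Type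
  | bot (p : P) : Src P N S V
  | top (n : N) : Src P N S V
  | start (s : S) : Src P N S V
  | vert (v : V) : Src P N S V

/-- The points of a decorated oriented `1`-cobordism at which an oriented edge may end:
top boundary points of sign `+`, bottom boundary points of sign `-`, inner terminal endpoints and
two-valent vertices. -/
inductive Tgt (P N T V : Type) : Type
  | top (p : P) : Tgt P N T V
  | bot (n : N) : Tgt P N T V
  | finish (t : T) : Tgt P N T V
  | vert (v : V) : Tgt P N T V

def Src.map {P N S V P' N' S' V' : Type} (p : P → P') (n : N → N') (s : S → S') (v : V → V') :
    Src P N S V → Src P' N' S' V'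
  | .bot x => .bot (p x)
  | .top x => .top (n x)
  | .start x => .start (s x)
  | .vert x => .vert (v x)

def Tgt.map {P N S V P' N' S' V' : Type} (p : P → P') (n : N → N') (s : S → S') (v : V → V') :
    Tgt P N S V → Tgt P' N' S' V'
  | .top x => .top (p x)
  | .bot x => .bot (n x)
  | .finish x => .finish (s x)
  | .vert x => .vert (v x)

/-- A (finite, combinatorial) compact oriented `1`-manifold with bottom boundary `X` and top
boundary `Y`, with inner endpoints and with defects labelled by `A`, given by a cell decomposition.
`S` and `T` are the sets of inner endpoints at which the orientation points into, respectively out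
of, the `1`-manifold. `V` is the set of two-valent vertices in the interior: `label v = some a`
says that `v` is a defect labelled `a`, and `label v = none` that `v` is an ordinary point.
There is exactly one oriented edge out of every element of `Src`, and it ends at `next`. -/
structure PreCob {A : Type u} (X Y : Pts A) : Type (max 1 u) where
  V : Type
  S : Type
  T : Type
  [finite_V : Finite V]
  [finite_S : Finite S]
  [finite_T : Finite T]
  label : V → Option A
  next : Src X.pos Y.neg S V ≃ Tgt Y.pos X.neg T V

attribute [instance] PreCob.finite_V PreCob.finite_S PreCob.finite_T

variable {A : Type u}

namespace PreCob

variable {X Y Z W : Pts A}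

/-- `Leads F v t z z'`: when one starts at `z` and moves along the edges of `F` through two-valent
vertices that are not in the range of `v`, one arrives at `z'`. -/
inductive Leads (F : PreCob X Y) {V T : Type} (v : V → F.V) (t : T → F.T) :
    Tgt Y.pos X.neg F.T F.V → Tgt Y.pos X.neg T V → Prop
  | here (z : Tgt Y.pos X.neg T V) : Leads F v t (z.map id id t v) z
  | step (w : F.V) (hw : w ∉ Set.range v) (z : Tgt Y.pos X.neg T V)
      (h : Leads F v t (F.next (.vert w)) z) : Leads F v t (.vert w) z

/-- `F` is (up to isomorphism relative to the boundary) a subdivision of `G`: `G` is obtained from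
`F` by erasing ordinary two-valent vertices, each of which lies in the interior of an edge of `G`. -/
structure Subdivision (F G : PreCob X Y) where
  v : G.V → F.V
  s : G.S ≃ F.S
  t : G.T ≃ F.T
  v_injective : Function.Injective v
  label_v : ∀ x, F.label (v x) = G.label x
  label_new : ∀ w, w ∉ Set.range v → F.label w = none
  next_leads : ∀ a : Src X.pos Y.neg G.S G.V,
    F.Leads v t (F.next (a.map id id s v)) (G.next a)
  new_leads : ∀ w, w ∉ Set.range v → ∃ z, F.Leads v t (.vert w) z

def Rel (F G : PreCob X Y) : Prop := Nonempty (Subdivision F G)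

/-- An isomorphism of decorated cobordisms relative to the boundary. -/
theorem rel_of_iso {F G : PreCob X Y} (v : G.V ≃ F.V) (s : G.S ≃ F.S) (t : G.T ≃ F.T)
    (hl : ∀ x, F.label (v x) = G.label x)
    (hn : ∀ a, F.next (a.map id id s v) = (G.next a).map id id t v) : Rel F G :=
  ⟨{ v := v, s := s, t := t
     v_injective := v.injective
     label_v := hl
     label_new := fun w hw => (hw (v.surjective w)).elim
     next_leads := fun a => by rw [hn]; exact .here _
     new_leads := fun w hw => (hw (v.surjective w)).elim }⟩

theorem Leads.of_eq {F : PreCob X Y} {V T : Type} {v : V → F.V} {t : T → F.T}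
    {z : Tgt Y.pos X.neg F.T F.V} {z' : Tgt Y.pos X.neg T V} (h : z = z'.map id id t v) :
    Leads F v t z z' := h ▸ .here _

/-! ### Gluing -/

/-- The edge origins of a glued cobordism. The points along which one glues become ordinary
two-valent vertices. -/
def glueSrc (P P' N N' S S' V V' : Type) :
    Src P N' (S ⊕ S') ((V ⊕ V') ⊕ (P' ⊕ N)) ≃ Src P N S V ⊕ Src P' N' S' V' where
  toFun
    | .bot x => .inl (.bot x)
    | .top x => .inr (.top x)
    | .start (.inl x) => .inl (.start x)
    | .start (.inr x) => .inr (.start x)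
    | .vert (.inl (.inl x)) => .inl (.vert x)
    | .vert (.inl (.inr x)) => .inr (.vert x)
    | .vert (.inr (.inl x)) => .inr (.bot x)
    | .vert (.inr (.inr x)) => .inl (.top x)
  invFun
    | .inl (.bot x) => .bot x
    | .inr (.top x) => .top x
    | .inl (.start x) => .start (.inl x)
    | .inr (.start x) => .start (.inr x)
    | .inl (.vert x) => .vert (.inl (.inl x))
    | .inr (.vert x) => .vert (.inl (.inr x))
    | .inr (.bot x) => .vert (.inr (.inl x))
    | .inl (.top x) => .vert (.inr (.inr x))
  left_inv := by rintro (_ | _ | (_ | _) | ((_ | _) | (_ | _))) <;> rfl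
  right_inv := by rintro ((_ | _ | _ | _) | (_ | _ | _ | _)) <;> rfl

/-- The edge ends of a glued cobordism. -/
def glueTgt (P P' N N' T T' V V' : Type) :
    Tgt P' N (T ⊕ T') ((V ⊕ V') ⊕ (P ⊕ N')) ≃ Tgt P N T V ⊕ Tgt P' N' T' V' where
  toFun
    | .bot x => .inl (.bot x)
    | .top x => .inr (.top x)
    | .finish (.inl x) => .inl (.finish x)
    | .finish (.inr x) => .inr (.finish x)
    | .vert (.inl (.inl x)) => .inl (.vert x)
    | .vert (.inl (.inr x)) => .inr (.vert x)
    | .vert (.inr (.inl x)) => .inl (.top x)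
    | .vert (.inr (.inr x)) => .inr (.bot x)
  invFun
    | .inl (.bot x) => .bot x
    | .inr (.top x) => .top x
    | .inl (.finish x) => .finish (.inl x)
    | .inr (.finish x) => .finish (.inr x)
    | .inl (.vert x) => .vert (.inl (.inl x))
    | .inr (.vert x) => .vert (.inl (.inr x))
    | .inl (.top x) => .vert (.inr (.inl x))
    | .inr (.bot x) => .vert (.inr (.inr x))
  left_inv := by rintro (_ | _ | (_ | _) | ((_ | _) | (_ | _))) <;> rfl
  right_inv := by rintro ((_ | _ | _ | _) | (_ | _ | _ | _)) <;> rfl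

/-- Gluing `F : X → Y` (below) and `G : Y → Z` (above) along `Y`. -/
def comp (F : PreCob X Y) (G : PreCob Y Z) : PreCob X Z where
  V := (F.V ⊕ G.V) ⊕ (Y.pos ⊕ Y.neg)
  S := F.S ⊕ G.S
  T := F.T ⊕ G.T
  label := Sum.elim (Sum.elim F.label G.label) (fun _ => none)
  next := (glueSrc X.pos Y.pos Y.neg Z.neg F.S G.S F.V G.V).trans
    ((Equiv.sumCongr F.next G.next).trans
      (glueTgt Y.pos Z.pos X.neg Y.neg F.T G.T F.V G.V).symm)

/-- The cobordism without vertices and inner endpoints whose edges are given by a bijection of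
positive and a bijection of negative points. -/
def ofEquiv (p : X.pos ≃ Y.pos) (n : X.neg ≃ Y.neg) : PreCob X Y where
  V := Empty
  S := Empty
  T := Empty
  label := Empty.elim
  next :=
    { toFun := fun
        | .bot x => .top (p x)
        | .top x => .bot (n.symm x)
      invFun := fun
        | .top x => .bot (p.symm x)
        | .bot x => .top (n x)
      left_inv := by rintro (_ | _ | x | x) <;> first | exact x.elim | simp
      right_inv := by rintro (_ | _ | x | x) <;> first | exact x.elim | simp }

/-- Disjoint union of sets of edge origins. -/
def sumSrc (P P' N N' S S' V V' : Type) :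
    Src (P ⊕ P') (N ⊕ N') (S ⊕ S') (V ⊕ V') ≃ Src P N S V ⊕ Src P' N' S' V' where
  toFun
    | .bot (.inl x) => .inl (.bot x)
    | .bot (.inr x) => .inr (.bot x)
    | .top (.inl x) => .inl (.top x)
    | .top (.inr x) => .inr (.top x)
    | .start (.inl x) => .inl (.start x)
    | .start (.inr x) => .inr (.start x)
    | .vert (.inl x) => .inl (.vert x)
    | .vert (.inr x) => .inr (.vert x)
  invFun := Sum.elim (Src.map .inl .inl .inl .inl) (Src.map .inr .inr .inr .inr)
  left_inv := by rintro ((_ | _) | (_ | _) | (_ | _) | (_ | _)) <;> rfl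
  right_inv := by rintro ((_ | _ | _ | _) | (_ | _ | _ | _)) <;> rfl

/-- Disjoint union of sets of edge ends. -/
def sumTgt (P P' N N' T T' V V' : Type) :
    Tgt (P ⊕ P') (N ⊕ N') (T ⊕ T') (V ⊕ V') ≃ Tgt P N T V ⊕ Tgt P' N' T' V' where
  toFun
    | .bot (.inl x) => .inl (.bot x)
    | .bot (.inr x) => .inr (.bot x)
    | .top (.inl x) => .inl (.top x)
    | .top (.inr x) => .inr (.top x)
    | .finish (.inl x) => .inl (.finish x)
    | .finish (.inr x) => .inr (.finish x)
    | .vert (.inl x) => .inl (.vert x)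
    | .vert (.inr x) => .inr (.vert x)
  invFun := Sum.elim (Tgt.map .inl .inl .inl .inl) (Tgt.map .inr .inr .inr .inr)
  left_inv := by rintro ((_ | _) | (_ | _) | (_ | _) | (_ | _)) <;> rfl
  right_inv := by rintro ((_ | _ | _ | _) | (_ | _ | _ | _)) <;> rfl

end PreCob

/-- Disjoint union of `0`-manifolds. -/
abbrev Pts.sum (X Y : Pts A) : Pts A := ⟨X.pos ⊕ Y.pos, X.neg ⊕ Y.neg⟩

/-- The empty `0`-manifold. -/
abbrev Pts.empty : Pts A := ⟨Empty, Empty⟩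

namespace PreCob

variable {X Y Z W X' Y' Z' : Pts A}

/-- Disjoint union of cobordisms. -/
def sum (F : PreCob X Y) (G : PreCob X' Y') : PreCob (X.sum X') (Y.sum Y') where
  V := F.V ⊕ G.V
  S := F.S ⊕ G.S
  T := F.T ⊕ G.T
  label := Sum.elim F.label G.label
  next := (sumSrc X.pos X'.pos Y.neg Y'.neg F.S G.S F.V G.V).trans
    ((Equiv.sumCongr F.next G.next).trans
      (sumTgt Y.pos Y'.pos X.neg X'.neg F.T G.T F.V G.V).symm)

theorem rel_refl (F : PreCob X Y) : Rel F F :=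
  rel_of_iso (Equiv.refl _) (Equiv.refl _) (Equiv.refl _) (fun _ => rfl)
    (fun a => by
      have h : a.map id id (Equiv.refl F.S) (Equiv.refl F.V) = a := by
        rcases a with _ | _ | _ | _ <;> rfl
      rw [h]
      rcases F.next a with _ | _ | _ | _ <;> rfl)

theorem rel_comp {F F' : PreCob X Y} {G G' : PreCob Y Z} (hF : Rel F F') (hG : Rel G G') :
    Rel (F.comp G) (F'.comp G') := by
  obtain ⟨h⟩ := hF
  obtain ⟨k⟩ := hG
  let v : (F'.comp G').V → (F.comp G).V := Sum.map (Sum.map h.v k.v) id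
  let t : (F'.comp G').T ≃ (F.comp G).T := Equiv.sumCongr h.t k.t
  have rangeL : ∀ w, w ∈ Set.range h.v ↔ (.inl (.inl w) : (F.V ⊕ G.V) ⊕ _) ∈ Set.range v := by
    refine fun w => ⟨fun ⟨y, hy⟩ => ⟨.inl (.inl y), congrArg (fun z => Sum.inl (Sum.inl z)) hy⟩, ?_⟩
    rintro ⟨((x | x) | x), hx⟩
    · exact ⟨x, Sum.inl_injective (Sum.inl_injective hx)⟩
    · exact nomatch Sum.inl_injective hx
    · exact nomatch hx
  have rangeR : ∀ w, w ∈ Set.range k.v ↔ (.inl (.inr w) : (F.V ⊕ G.V) ⊕ _) ∈ Set.range v := by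
    refine fun w => ⟨fun ⟨y, hy⟩ => ⟨.inl (.inr y), congrArg (fun z => Sum.inl (Sum.inr z)) hy⟩, ?_⟩
    rintro ⟨((x | x) | x), hx⟩
    · exact nomatch Sum.inl_injective hx
    · exact ⟨x, Sum.inr_injective (Sum.inl_injective hx)⟩
    · exact nomatch hx
  have keyL : ∀ z z', F.Leads h.v h.t z z' →
      (F.comp G).Leads v t
        ((glueTgt Y.pos Z.pos X.neg Y.neg F.T G.T F.V G.V).symm (.inl z))
        ((glueTgt Y.pos Z.pos X.neg Y.neg F'.T G'.T F'.V G'.V).symm (.inl z')) := by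
    intro z z' H
    induction H with
    | here z => exact .of_eq (by rcases z with _ | _ | _ | _ <;> rfl)
    | step w hw z _ ih => exact Leads.step (F := F.comp G) (v := v) (t := t) (Sum.inl (Sum.inl w)) (fun hx => hw ((rangeL w).2 hx)) _ ih
  have keyR : ∀ z z', G.Leads k.v k.t z z' →
      (F.comp G).Leads v t
        ((glueTgt Y.pos Z.pos X.neg Y.neg F.T G.T F.V G.V).symm (.inr z))
        ((glueTgt Y.pos Z.pos X.neg Y.neg F'.T G'.T F'.V G'.V).symm (.inr z')) := by
    intro z z' H
    induction H with
    | here z => exact .of_eq (by rcases z with _ | _ | _ | _ <;> rfl)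
    | step w hw z _ ih => exact Leads.step (F := F.comp G) (v := v) (t := t) (Sum.inl (Sum.inr w)) (fun hx => hw ((rangeR w).2 hx)) _ ih
  exact ⟨{
    v := v
    s := Equiv.sumCongr h.s k.s
    t := t
    v_injective := (h.v_injective.sumMap k.v_injective).sumMap Function.injective_id
    label_v := by
      rintro ((x | x) | x)
      exacts [h.label_v x, k.label_v x, rfl]
    label_new := by
      rintro ((x | x) | x) hx
      exacts [h.label_new x (fun hy => hx ((rangeL x).1 hy)),
        k.label_new x (fun hy => hx ((rangeR x).1 hy)), rfl]
    next_leads := by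
      rintro (x | x | (x | x) | ((x | x) | (x | x)))
      exacts [keyL _ _ (h.next_leads (.bot x)), keyR _ _ (k.next_leads (.top x)),
        keyL _ _ (h.next_leads (.start x)), keyR _ _ (k.next_leads (.start x)),
        keyL _ _ (h.next_leads (.vert x)), keyR _ _ (k.next_leads (.vert x)),
        keyR _ _ (k.next_leads (.bot x)), keyL _ _ (h.next_leads (.top x))]
    new_leads := by
      rintro ((x | x) | x) hx
      · obtain ⟨z, hz⟩ := h.new_leads x (fun hy => hx ((rangeL x).1 hy))
        exact ⟨_, keyL _ _ hz⟩
      · obtain ⟨z, hz⟩ := k.new_leads x (fun hy => hx ((rangeR x).1 hy))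
        exact ⟨_, keyR _ _ hz⟩
      · exact (hx ⟨.inr x, rfl⟩).elim }⟩

theorem rel_sum {F F' : PreCob X Y} {G G' : PreCob X' Y'} (hF : Rel F F') (hG : Rel G G') :
    Rel (F.sum G) (F'.sum G') := by
  obtain ⟨h⟩ := hF
  obtain ⟨k⟩ := hG
  let v : (F'.sum G').V → (F.sum G).V := Sum.map h.v k.v
  let t : (F'.sum G').T ≃ (F.sum G).T := Equiv.sumCongr h.t k.t
  have rangeL : ∀ w, w ∈ Set.range h.v ↔ (.inl w : F.V ⊕ G.V) ∈ Set.range v := by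
    refine fun w => ⟨fun ⟨y, hy⟩ => ⟨.inl y, congrArg Sum.inl hy⟩, ?_⟩
    rintro ⟨(x | x), hx⟩
    · exact ⟨x, Sum.inl_injective hx⟩
    · exact nomatch hx
  have rangeR : ∀ w, w ∈ Set.range k.v ↔ (.inr w : F.V ⊕ G.V) ∈ Set.range v := by
    refine fun w => ⟨fun ⟨y, hy⟩ => ⟨.inr y, congrArg Sum.inr hy⟩, ?_⟩
    rintro ⟨(x | x), hx⟩
    · exact nomatch hx
    · exact ⟨x, Sum.inr_injective hx⟩
  have keyL : ∀ z z', F.Leads h.v h.t z z' →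
      (F.sum G).Leads v t
        ((sumTgt Y.pos Y'.pos X.neg X'.neg F.T G.T F.V G.V).symm (.inl z))
        ((sumTgt Y.pos Y'.pos X.neg X'.neg F'.T G'.T F'.V G'.V).symm (.inl z')) := by
    intro z z' H
    induction H with
    | here z => exact .of_eq (by rcases z with _ | _ | _ | _ <;> rfl)
    | step w hw z _ ih => exact Leads.step (F := F.sum G) (v := v) (t := t) (Sum.inl w) (fun hx => hw ((rangeL w).2 hx)) _ ih
  have keyR : ∀ z z', G.Leads k.v k.t z z' →
      (F.sum G).Leads v t
        ((sumTgt Y.pos Y'.pos X.neg X'.neg F.T G.T F.V G.V).symm (.inr z))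
        ((sumTgt Y.pos Y'.pos X.neg X'.neg F'.T G'.T F'.V G'.V).symm (.inr z')) := by
    intro z z' H
    induction H with
    | here z => exact .of_eq (by rcases z with _ | _ | _ | _ <;> rfl)
    | step w hw z _ ih => exact Leads.step (F := F.sum G) (v := v) (t := t) (Sum.inr w) (fun hx => hw ((rangeR w).2 hx)) _ ih
  exact ⟨{
    v := v
    s := Equiv.sumCongr h.s k.s
    t := t
    v_injective := h.v_injective.sumMap k.v_injective
    label_v := by
      rintro (x | x)
      exacts [h.label_v x, k.label_v x]
    label_new := by
      rintro (x | x) hx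
      exacts [h.label_new x (fun hy => hx ((rangeL x).1 hy)),
        k.label_new x (fun hy => hx ((rangeR x).1 hy))]
    next_leads := by
      rintro ((x | x) | (x | x) | (x | x) | (x | x))
      exacts [keyL _ _ (h.next_leads (.bot x)), keyR _ _ (k.next_leads (.bot x)),
        keyL _ _ (h.next_leads (.top x)), keyR _ _ (k.next_leads (.top x)),
        keyL _ _ (h.next_leads (.start x)), keyR _ _ (k.next_leads (.start x)),
        keyL _ _ (h.next_leads (.vert x)), keyR _ _ (k.next_leads (.vert x))]
    new_leads := by
      rintro (x | x) hx
      · obtain ⟨z, hz⟩ := h.new_leads x (fun hy => hx ((rangeL x).1 hy))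
        exact ⟨_, keyL _ _ hz⟩
      · obtain ⟨z, hz⟩ := k.new_leads x (fun hy => hx ((rangeR x).1 hy))
        exact ⟨_, keyR _ _ hz⟩ }⟩

/-- Relabelling the boundary points. -/
def relabel (F : PreCob X Y) (p : X'.pos ≃ X.pos) (n : X'.neg ≃ X.neg)
    (p' : Y.pos ≃ Y'.pos) (n' : Y.neg ≃ Y'.neg) : PreCob X' Y' where
  V := F.V
  S := F.S
  T := F.T
  label := F.label
  next :=
    { toFun := fun a => (F.next (a.map p n'.symm id id)).map p' n.symm id id
      invFun := fun a => (F.next.symm (a.map p'.symm n id id)).map p.symm n' id id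
      left_inv := by
        intro a
        have h : ∀ b : Tgt Y.pos X.neg F.T F.V, (b.map p' n.symm id id).map p'.symm n id id = b := by
          rintro (_ | _ | _ | _) <;> simp [Tgt.map]
        have h' : ∀ b : Src X'.pos Y'.neg F.S F.V,
            (b.map p n'.symm id id).map p.symm n' id id = b := by
          rintro (_ | _ | _ | _) <;> simp [Src.map]
        simp only [h, Equiv.symm_apply_apply, h']
      right_inv := by
        intro a
        have h : ∀ b : Tgt Y'.pos X'.neg F.T F.V,
            (b.map p'.symm n id id).map p' n.symm id id = b := by
          rintro (_ | _ | _ | _) <;> simp [Tgt.map]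
        have h' : ∀ b : Src X.pos Y.neg F.S F.V,
            (b.map p.symm n' id id).map p n'.symm id id = b := by
          rintro (_ | _ | _ | _) <;> simp [Src.map]
        simp only [h, Equiv.apply_symm_apply, h'] }

theorem rel_comp_ofEquiv (F : PreCob X Y) (p : Y.pos ≃ Y'.pos) (n : Y.neg ≃ Y'.neg) :
    Rel (F.comp (ofEquiv p n)) (F.relabel (Equiv.refl _) (Equiv.refl _) p n) := by
  let R := F.relabel (Equiv.refl _) (Equiv.refl _) p n
  let v : R.V → (F.comp (ofEquiv p n)).V := fun x => .inl (.inl x)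
  let s : R.S ≃ (F.comp (ofEquiv p n)).S := (Equiv.sumEmpty F.S Empty).symm
  let t : R.T ≃ (F.comp (ofEquiv p n)).T := (Equiv.sumEmpty F.T Empty).symm
  have key : ∀ z : Tgt Y.pos X.neg F.T F.V, (F.comp (ofEquiv p n)).Leads v t
      ((glueTgt Y.pos Y'.pos X.neg Y.neg F.T Empty F.V Empty).symm (.inl z))
      (z.map p id id id) := by
    rintro (x | x | x | x)
    · exact Leads.step (F := F.comp (ofEquiv p n)) (v := v) (t := t) (Sum.inr (Sum.inl x)) (fun ⟨_, hy⟩ => Sum.inl_ne_inr hy) _ (.here (.top (p x)))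
    · exact .here (.bot x)
    · exact .here (.finish x)
    · exact .here (.vert x)
  have mid : ∀ x : Y.neg, (F.comp (ofEquiv p n)).Leads v t (.vert (.inr (.inr x)))
      ((F.next (.top x)).map p id id id) := fun x =>
    Leads.step (F := F.comp (ofEquiv p n)) (v := v) (t := t) (Sum.inr (Sum.inr x)) (fun ⟨_, hy⟩ => Sum.inl_ne_inr hy) _ (key (F.next (.top x)))
  exact ⟨{
    v := v, s := s, t := t
    v_injective := fun x y h => Sum.inl_injective (Sum.inl_injective h)
    label_v := fun _ => rfl
    label_new := by
      rintro ((x | x) | x) hx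
      exacts [(hx ⟨x, rfl⟩).elim, x.elim, rfl]
    next_leads := by
      rintro (x | x | x | x)
      exacts [key _, mid (n.symm x), key _, key _]
    new_leads := by
      rintro ((x | x) | (x | x)) hx
      exacts [(hx ⟨x, rfl⟩).elim, x.elim, ⟨_, key (.top x)⟩, ⟨_, mid x⟩] }⟩

theorem rel_ofEquiv_comp (F : PreCob X Y) (p : X'.pos ≃ X.pos) (n : X'.neg ≃ X.neg) :
    Rel ((ofEquiv p n).comp F) (F.relabel p n (Equiv.refl _) (Equiv.refl _)) := by
  let R := F.relabel p n (Equiv.refl _) (Equiv.refl _)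
  let v : R.V → ((ofEquiv p n).comp F).V := fun x => .inl (.inr x)
  let s : R.S ≃ ((ofEquiv p n).comp F).S := (Equiv.emptySum Empty F.S).symm
  let t : R.T ≃ ((ofEquiv p n).comp F).T := (Equiv.emptySum Empty F.T).symm
  have key : ∀ z : Tgt Y.pos X.neg F.T F.V, ((ofEquiv p n).comp F).Leads v t
      ((glueTgt X.pos Y.pos X'.neg X.neg Empty F.T Empty F.V).symm (.inr z))
      (z.map id n.symm id id) := by
    rintro (x | x | x | x)
    · exact .here (.top x)
    · exact Leads.step (F := (ofEquiv p n).comp F) (v := v) (t := t) (Sum.inr (Sum.inr x)) (fun ⟨_, hy⟩ => Sum.inl_ne_inr hy) _ (.here (.bot (n.symm x)))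
    · exact .here (.finish x)
    · exact .here (.vert x)
  have mid : ∀ x : X.pos, ((ofEquiv p n).comp F).Leads v t (.vert (.inr (.inl x)))
      ((F.next (.bot x)).map id n.symm id id) := fun x =>
    Leads.step (F := (ofEquiv p n).comp F) (v := v) (t := t) (Sum.inr (Sum.inl x)) (fun ⟨_, hy⟩ => Sum.inl_ne_inr hy) _ (key (F.next (.bot x)))
  exact ⟨{
    v := v, s := s, t := t
    v_injective := fun x y h => Sum.inr_injective (Sum.inl_injective h)
    label_v := fun _ => rfl
    label_new := by
      rintro ((x | x) | x) hx
      exacts [x.elim, (hx ⟨x, rfl⟩).elim, rfl]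
    next_leads := by
      rintro (x | x | x | x)
      exacts [mid (p x), key _, key _, key _]
    new_leads := by
      rintro ((x | x) | (x | x)) hx
      exacts [x.elim, (hx ⟨x, rfl⟩).elim, ⟨_, mid x⟩, ⟨_, key (.bot x)⟩] }⟩

theorem rel_comp_assoc (F : PreCob X Y) (G : PreCob Y Z) (H : PreCob Z W) :
    Rel ((F.comp G).comp H) (F.comp (G.comp H)) := by
  let v : (F.comp (G.comp H)).V ≃ ((F.comp G).comp H).V :=
    { toFun := fun
        | .inl (.inl x) => .inl (.inl (.inl (.inl x)))
        | .inl (.inr (.inl (.inl x))) => .inl (.inl (.inl (.inr x)))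
        | .inl (.inr (.inl (.inr x))) => .inl (.inr x)
        | .inl (.inr (.inr x)) => .inr x
        | .inr x => .inl (.inl (.inr x))
      invFun := fun
        | .inl (.inl (.inl (.inl x))) => .inl (.inl x)
        | .inl (.inl (.inl (.inr x))) => .inl (.inr (.inl (.inl x)))
        | .inl (.inr x) => .inl (.inr (.inl (.inr x)))
        | .inr x => .inl (.inr (.inr x))
        | .inl (.inl (.inr x)) => .inr x
      left_inv := by rintro ((_ | ((_ | _) | _)) | _) <;> rfl
      right_inv := by rintro ((((_ | _) | _) | _) | _) <;> rfl }
  refine rel_of_iso v (Equiv.sumAssoc F.S G.S H.S).symm (Equiv.sumAssoc F.T G.T H.T).symm ?_ ?_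
  · rintro ((_ | ((_ | _) | _)) | _) <;> rfl
  · have hF : ∀ z : Tgt Y.pos X.neg F.T F.V,
        (glueTgt Z.pos W.pos X.neg Z.neg (F.T ⊕ G.T) H.T ((F.V ⊕ G.V) ⊕ (Y.pos ⊕ Y.neg)) H.V).symm
          (.inl ((glueTgt Y.pos Z.pos X.neg Y.neg F.T G.T F.V G.V).symm (.inl z))) =
        ((glueTgt Y.pos W.pos X.neg Y.neg F.T (G.T ⊕ H.T) F.V
          ((G.V ⊕ H.V) ⊕ (Z.pos ⊕ Z.neg))).symm (.inl z)).map id id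
            (Equiv.sumAssoc F.T G.T H.T).symm v := by
      rintro (_ | _ | _ | _) <;> rfl
    have hG : ∀ z : Tgt Z.pos Y.neg G.T G.V,
        (glueTgt Z.pos W.pos X.neg Z.neg (F.T ⊕ G.T) H.T ((F.V ⊕ G.V) ⊕ (Y.pos ⊕ Y.neg)) H.V).symm
          (.inl ((glueTgt Y.pos Z.pos X.neg Y.neg F.T G.T F.V G.V).symm (.inr z))) =
        ((glueTgt Y.pos W.pos X.neg Y.neg F.T (G.T ⊕ H.T) F.V
          ((G.V ⊕ H.V) ⊕ (Z.pos ⊕ Z.neg))).symm (.inr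
            ((glueTgt Z.pos W.pos Y.neg Z.neg G.T H.T G.V H.V).symm (.inl z)))).map id id
            (Equiv.sumAssoc F.T G.T H.T).symm v := by
      rintro (_ | _ | _ | _) <;> rfl
    have hH : ∀ z : Tgt W.pos Z.neg H.T H.V,
        (glueTgt Z.pos W.pos X.neg Z.neg (F.T ⊕ G.T) H.T ((F.V ⊕ G.V) ⊕ (Y.pos ⊕ Y.neg)) H.V).symm
          (.inr z) =
        ((glueTgt Y.pos W.pos X.neg Y.neg F.T (G.T ⊕ H.T) F.V
          ((G.V ⊕ H.V) ⊕ (Z.pos ⊕ Z.neg))).symm (.inr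
            ((glueTgt Z.pos W.pos Y.neg Z.neg G.T H.T G.V H.V).symm (.inr z)))).map id id
            (Equiv.sumAssoc F.T G.T H.T).symm v := by
      rintro (_ | _ | _ | _) <;> rfl
    rintro (x | x | (x | (x | x)) | ((x | (((x | x) | (x | x)))) | (x | x)))
    exacts [hF _, hH _, hF _, hG _, hH _, hF _, hG _, hH _, hH _, hG _, hG _, hF _]

theorem rel_sum_comp_sum (F : PreCob X Y) (G : PreCob Y Z) (F' : PreCob X' Y') (G' : PreCob Y' Z') :
    Rel ((F.sum F').comp (G.sum G')) ((F.comp G).sum (F'.comp G')) := by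
  let v : ((F.comp G).sum (F'.comp G')).V ≃ ((F.sum F').comp (G.sum G')).V :=
    { toFun := fun
        | .inl (.inl (.inl x)) => .inl (.inl (.inl x))
        | .inl (.inl (.inr x)) => .inl (.inr (.inl x))
        | .inl (.inr (.inl x)) => .inr (.inl (.inl x))
        | .inl (.inr (.inr x)) => .inr (.inr (.inl x))
        | .inr (.inl (.inl x)) => .inl (.inl (.inr x))
        | .inr (.inl (.inr x)) => .inl (.inr (.inr x))
        | .inr (.inr (.inl x)) => .inr (.inl (.inr x))
        | .inr (.inr (.inr x)) => .inr (.inr (.inr x))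
      invFun := fun
        | .inl (.inl (.inl x)) => .inl (.inl (.inl x))
        | .inl (.inr (.inl x)) => .inl (.inl (.inr x))
        | .inr (.inl (.inl x)) => .inl (.inr (.inl x))
        | .inr (.inr (.inl x)) => .inl (.inr (.inr x))
        | .inl (.inl (.inr x)) => .inr (.inl (.inl x))
        | .inl (.inr (.inr x)) => .inr (.inl (.inr x))
        | .inr (.inl (.inr x)) => .inr (.inr (.inl x))
        | .inr (.inr (.inr x)) => .inr (.inr (.inr x))
      left_inv := by rintro (((_ | _) | (_ | _)) | ((_ | _) | (_ | _))) <;> rfl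
      right_inv := by rintro (((_ | _) | (_ | _)) | ((_ | _) | (_ | _))) <;> rfl }
  refine rel_of_iso v (Equiv.sumSumSumComm F.S G.S F'.S G'.S)
    (Equiv.sumSumSumComm F.T G.T F'.T G'.T) ?_ ?_
  · rintro (((_ | _) | (_ | _)) | ((_ | _) | (_ | _))) <;> rfl
  · have hF : ∀ z, (glueTgt (Y.sum Y').pos (Z.sum Z').pos (X.sum X').neg (Y.sum Y').neg
          (F.T ⊕ F'.T) (G.T ⊕ G'.T) (F.V ⊕ F'.V) (G.V ⊕ G'.V)).symm
          (.inl ((sumTgt Y.pos Y'.pos X.neg X'.neg F.T F'.T F.V F'.V).symm (.inl z))) =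
        ((sumTgt Z.pos Z'.pos X.neg X'.neg (F.T ⊕ G.T) (F'.T ⊕ G'.T) (F.comp G).V
          (F'.comp G').V).symm (.inl
            ((glueTgt Y.pos Z.pos X.neg Y.neg F.T G.T F.V G.V).symm (.inl z)))).map id id
            (Equiv.sumSumSumComm F.T G.T F'.T G'.T) v := by
      rintro (_ | _ | _ | _) <;> rfl
    have hG : ∀ z, (glueTgt (Y.sum Y').pos (Z.sum Z').pos (X.sum X').neg (Y.sum Y').neg
          (F.T ⊕ F'.T) (G.T ⊕ G'.T) (F.V ⊕ F'.V) (G.V ⊕ G'.V)).symm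
          (.inr ((sumTgt Z.pos Z'.pos Y.neg Y'.neg G.T G'.T G.V G'.V).symm (.inl z))) =
        ((sumTgt Z.pos Z'.pos X.neg X'.neg (F.T ⊕ G.T) (F'.T ⊕ G'.T) (F.comp G).V
          (F'.comp G').V).symm (.inl
            ((glueTgt Y.pos Z.pos X.neg Y.neg F.T G.T F.V G.V).symm (.inr z)))).map id id
            (Equiv.sumSumSumComm F.T G.T F'.T G'.T) v := by
      rintro (_ | _ | _ | _) <;> rfl
    have hF' : ∀ z, (glueTgt (Y.sum Y').pos (Z.sum Z').pos (X.sum X').neg (Y.sum Y').neg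
          (F.T ⊕ F'.T) (G.T ⊕ G'.T) (F.V ⊕ F'.V) (G.V ⊕ G'.V)).symm
          (.inl ((sumTgt Y.pos Y'.pos X.neg X'.neg F.T F'.T F.V F'.V).symm (.inr z))) =
        ((sumTgt Z.pos Z'.pos X.neg X'.neg (F.T ⊕ G.T) (F'.T ⊕ G'.T) (F.comp G).V
          (F'.comp G').V).symm (.inr
            ((glueTgt Y'.pos Z'.pos X'.neg Y'.neg F'.T G'.T F'.V G'.V).symm (.inl z)))).map id id
            (Equiv.sumSumSumComm F.T G.T F'.T G'.T) v := by
      rintro (_ | _ | _ | _) <;> rfl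
    have hG' : ∀ z, (glueTgt (Y.sum Y').pos (Z.sum Z').pos (X.sum X').neg (Y.sum Y').neg
          (F.T ⊕ F'.T) (G.T ⊕ G'.T) (F.V ⊕ F'.V) (G.V ⊕ G'.V)).symm
          (.inr ((sumTgt Z.pos Z'.pos Y.neg Y'.neg G.T G'.T G.V G'.V).symm (.inr z))) =
        ((sumTgt Z.pos Z'.pos X.neg X'.neg (F.T ⊕ G.T) (F'.T ⊕ G'.T) (F.comp G).V
          (F'.comp G').V).symm (.inr
            ((glueTgt Y'.pos Z'.pos X'.neg Y'.neg F'.T G'.T F'.V G'.V).symm (.inr z)))).map id id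
            (Equiv.sumSumSumComm F.T G.T F'.T G'.T) v := by
      rintro (_ | _ | _ | _) <;> rfl
    rintro ((x | x) | (x | x) | ((x | x) | (x | x)) |
      (((x | x) | (x | x)) | ((x | x) | (x | x))))
    exacts [hF _, hF' _, hG _, hG' _, hF _, hG _, hF' _, hG' _, hF _, hG _, hG _, hF _,
      hF' _, hG' _, hG' _, hF' _]

theorem rel_relabel_ofEquiv (p : X.pos ≃ Y.pos) (n : X.neg ≃ Y.neg)
    (p' : Y.pos ≃ Z.pos) (n' : Y.neg ≃ Z.neg) :
    Rel ((ofEquiv p n).relabel (Equiv.refl _) (Equiv.refl _) p' n')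
      (ofEquiv (p.trans p') (n.trans n')) :=
  rel_of_iso (Equiv.refl Empty) (Equiv.refl Empty) (Equiv.refl Empty) (fun x => x.elim)
    (by rintro (_ | _ | x | x) <;> first | exact x.elim | rfl)

theorem rel_sum_ofEquiv (p : X.pos ≃ Y.pos) (n : X.neg ≃ Y.neg)
    (p' : X'.pos ≃ Y'.pos) (n' : X'.neg ≃ Y'.neg) :
    Rel ((ofEquiv p n).sum (ofEquiv p' n'))
      (ofEquiv (X := X.sum X') (Y := Y.sum Y') (p.sumCongr p') (n.sumCongr n')) :=
  rel_of_iso (Equiv.emptySum Empty Empty).symm (Equiv.emptySum Empty Empty).symm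
    (Equiv.emptySum Empty Empty).symm (fun x => x.elim)
    (by rintro ((_ | _) | (_ | _) | x | x) <;> first | exact x.elim | rfl)

theorem rel_sum_assoc (F : PreCob X X') (G : PreCob Y Y') (H : PreCob Z Z') :
    Rel (((F.sum G).sum H).relabel (X' := (X.sum Y).sum Z) (Y' := X'.sum (Y'.sum Z'))
        (Equiv.refl _) (Equiv.refl _) (Equiv.sumAssoc _ _ _) (Equiv.sumAssoc _ _ _))
      ((F.sum (G.sum H)).relabel (X' := (X.sum Y).sum Z) (Y' := X'.sum (Y'.sum Z'))
        (Equiv.sumAssoc _ _ _) (Equiv.sumAssoc _ _ _) (Equiv.refl _) (Equiv.refl _)) := by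
  refine rel_of_iso (Equiv.sumAssoc F.V G.V H.V).symm (Equiv.sumAssoc F.S G.S H.S).symm
    (Equiv.sumAssoc F.T G.T H.T).symm ?_ ?_
  · rintro (_ | _ | _) <;> rfl
  · let L : Tgt ((X'.pos ⊕ Y'.pos) ⊕ Z'.pos) ((X.neg ⊕ Y.neg) ⊕ Z.neg) ((F.T ⊕ G.T) ⊕ H.T)
        ((F.V ⊕ G.V) ⊕ H.V) → Tgt (X'.pos ⊕ Y'.pos ⊕ Z'.pos) ((X.neg ⊕ Y.neg) ⊕ Z.neg)
        ((F.T ⊕ G.T) ⊕ H.T) ((F.V ⊕ G.V) ⊕ H.V) := Tgt.map (Equiv.sumAssoc _ _ _) id id id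
    let R : Tgt (X'.pos ⊕ Y'.pos ⊕ Z'.pos) (X.neg ⊕ Y.neg ⊕ Z.neg) (F.T ⊕ G.T ⊕ H.T)
        (F.V ⊕ G.V ⊕ H.V) → Tgt (X'.pos ⊕ Y'.pos ⊕ Z'.pos) ((X.neg ⊕ Y.neg) ⊕ Z.neg)
        ((F.T ⊕ G.T) ⊕ H.T) ((F.V ⊕ G.V) ⊕ H.V) :=
      Tgt.map id (Equiv.sumAssoc _ _ _).symm (Equiv.sumAssoc _ _ _).symm (Equiv.sumAssoc _ _ _).symm
    have hF : ∀ z : Tgt X'.pos X.neg F.T F.V, L ((sumTgt _ _ _ _ _ _ _ _).symm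
        (.inl ((sumTgt _ _ _ _ _ _ _ _).symm (.inl z)))) =
        R ((sumTgt _ _ _ _ _ _ _ _).symm (.inl z)) := by
      rintro (_ | _ | _ | _) <;> rfl
    have hG : ∀ z : Tgt Y'.pos Y.neg G.T G.V, L ((sumTgt _ _ _ _ _ _ _ _).symm
        (.inl ((sumTgt _ _ _ _ _ _ _ _).symm (.inr z)))) =
        R ((sumTgt _ _ _ _ _ _ _ _).symm (.inr ((sumTgt _ _ _ _ _ _ _ _).symm (.inl z)))) := by
      rintro (_ | _ | _ | _) <;> rfl
    have hH : ∀ z : Tgt Z'.pos Z.neg H.T H.V, L ((sumTgt _ _ _ _ _ _ _ _).symm (.inr z)) =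
        R ((sumTgt _ _ _ _ _ _ _ _).symm (.inr ((sumTgt _ _ _ _ _ _ _ _).symm (.inr z)))) := by
      rintro (_ | _ | _ | _) <;> rfl
    have hR : ∀ z : Tgt (X'.pos ⊕ Y'.pos ⊕ Z'.pos) (X.neg ⊕ Y.neg ⊕ Z.neg) (F.T ⊕ G.T ⊕ H.T)
        (F.V ⊕ G.V ⊕ H.V), R z = ((z.map (Equiv.refl _) (Equiv.sumAssoc _ _ _).symm id id).map id id
          (Equiv.sumAssoc F.T G.T H.T).symm (Equiv.sumAssoc F.V G.V H.V).symm) := by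
      rintro (_ | _ | _ | _) <;> rfl
    rintro (((x | x) | x) | (x | x | x) | (x | x | x) | (x | x | x))
    exacts [(hF _).trans (hR _), (hG _).trans (hR _), (hH _).trans (hR _),
      (hF _).trans (hR _), (hG _).trans (hR _), (hH _).trans (hR _),
      (hF _).trans (hR _), (hG _).trans (hR _), (hH _).trans (hR _),
      (hF _).trans (hR _), (hG _).trans (hR _), (hH _).trans (hR _)]

theorem rel_empty_sum (F : PreCob X Y) :
    Rel (((ofEquiv (X := Pts.empty) (Y := Pts.empty) (Equiv.refl _) (Equiv.refl _)).sum F).relabel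
        (X' := Pts.empty.sum X) (Y' := Y)
        (Equiv.refl _) (Equiv.refl _) (Equiv.emptySum Empty _) (Equiv.emptySum Empty _))
      (F.relabel (X' := Pts.empty.sum X) (Equiv.emptySum Empty _) (Equiv.emptySum Empty _)
        (Equiv.refl _) (Equiv.refl _)) := by
  refine rel_of_iso (Equiv.emptySum Empty F.V).symm (Equiv.emptySum Empty F.S).symm
    (Equiv.emptySum Empty F.T).symm (fun _ => rfl) ?_
  have h : ∀ z : Tgt Y.pos X.neg F.T F.V,
      ((sumTgt Empty Y.pos Empty X.neg Empty F.T Empty F.V).symm (.inr z)).map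
        (Equiv.emptySum Empty _) id id id =
      (z.map id (Equiv.emptySum Empty _).symm id id).map id id
        (Equiv.emptySum Empty F.T).symm (Equiv.emptySum Empty F.V).symm := by
    rintro (_ | _ | _ | _) <;> rfl
  have h' : ∀ z : Tgt Y.pos X.neg F.T F.V,
      (z.map id (Equiv.emptySum Empty _).symm id id).map id id
        (Equiv.emptySum Empty F.T).symm (Equiv.emptySum Empty F.V).symm =
      (z.map (Equiv.refl _) (Equiv.emptySum Empty _).symm id id).map id id
        (Equiv.emptySum Empty F.T).symm (Equiv.emptySum Empty F.V).symm := by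
    rintro (_ | _ | _ | _) <;> rfl
  rintro ((x | x) | x | x | x)
  exacts [x.elim, (h _).trans (h' _), (h _).trans (h' _), (h _).trans (h' _), (h _).trans (h' _)]

theorem rel_sum_empty (F : PreCob X Y) :
    Rel ((F.sum (ofEquiv (X := Pts.empty) (Y := Pts.empty) (Equiv.refl _) (Equiv.refl _))).relabel
        (X' := X.sum Pts.empty) (Y' := Y)
        (Equiv.refl _) (Equiv.refl _) (Equiv.sumEmpty _ Empty) (Equiv.sumEmpty _ Empty))
      (F.relabel (X' := X.sum Pts.empty) (Equiv.sumEmpty _ Empty) (Equiv.sumEmpty _ Empty)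
        (Equiv.refl _) (Equiv.refl _)) := by
  refine rel_of_iso (Equiv.sumEmpty F.V Empty).symm (Equiv.sumEmpty F.S Empty).symm
    (Equiv.sumEmpty F.T Empty).symm (fun _ => rfl) ?_
  have h : ∀ z : Tgt Y.pos X.neg F.T F.V,
      ((sumTgt Y.pos Empty X.neg Empty F.T Empty F.V Empty).symm (.inl z)).map
        (Equiv.sumEmpty _ Empty) id id id =
      (z.map (Equiv.refl _) (Equiv.sumEmpty _ Empty).symm id id).map id id
        (Equiv.sumEmpty F.T Empty).symm (Equiv.sumEmpty F.V Empty).symm := by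
    rintro (_ | _ | _ | _) <;> rfl
  rintro ((x | x) | x | x | x)
  exacts [h _, x.elim, h _, h _, h _]

theorem rel_sum_swap (F : PreCob X Y) (G : PreCob X' Y') :
    Rel ((F.sum G).relabel (X' := X.sum X') (Y' := Y'.sum Y)
        (Equiv.refl _) (Equiv.refl _) (Equiv.sumComm _ _) (Equiv.sumComm _ _))
      ((G.sum F).relabel (X' := X.sum X') (Y' := Y'.sum Y)
        (Equiv.sumComm _ _) (Equiv.sumComm _ _) (Equiv.refl _) (Equiv.refl _)) := by
  refine rel_of_iso (Equiv.sumComm G.V F.V) (Equiv.sumComm G.S F.S) (Equiv.sumComm G.T F.T) ?_ ?_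
  · rintro (_ | _) <;> rfl
  · have hF : ∀ z : Tgt Y.pos X.neg F.T F.V,
        ((sumTgt Y.pos Y'.pos X.neg X'.neg F.T G.T F.V G.V).symm (.inl z)).map
          (Equiv.sumComm _ _) id id id =
        (((sumTgt Y'.pos Y.pos X'.neg X.neg G.T F.T G.V F.V).symm (.inr z)).map
          (Equiv.refl _) (Equiv.sumComm _ _).symm id id).map id id
          (Equiv.sumComm G.T F.T) (Equiv.sumComm G.V F.V) := by
      rintro (_ | _ | _ | _) <;> rfl
    have hG : ∀ z : Tgt Y'.pos X'.neg G.T G.V,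
        ((sumTgt Y.pos Y'.pos X.neg X'.neg F.T G.T F.V G.V).symm (.inr z)).map
          (Equiv.sumComm _ _) id id id =
        (((sumTgt Y'.pos Y.pos X'.neg X.neg G.T F.T G.V F.V).symm (.inl z)).map
          (Equiv.refl _) (Equiv.sumComm _ _).symm id id).map id id
          (Equiv.sumComm G.T F.T) (Equiv.sumComm G.V F.V) := by
      rintro (_ | _ | _ | _) <;> rfl
    rintro ((x | x) | (x | x) | (x | x) | (x | x))
    exacts [hF _, hG _, hG _, hF _, hG _, hF _, hG _, hF _]

theorem rel_relabel_refl (F : PreCob X Y) :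
    Rel (F.relabel (Equiv.refl _) (Equiv.refl _) (Equiv.refl _) (Equiv.refl _)) F :=
  rel_of_iso (Equiv.refl _) (Equiv.refl _) (Equiv.refl _) (fun _ => rfl)
    (by
      have h : ∀ z : Tgt Y.pos X.neg F.T F.V, z.map (Equiv.refl _) (Equiv.refl _) id id =
          z.map id id (Equiv.refl F.T) (Equiv.refl F.V) := by
        rintro (_ | _ | _ | _) <;> rfl
      rintro (x | x | x | x) <;> exact h _)

end PreCob

/-! ### The symmetric monoidal category of decorated `1`-cobordisms -/

/-- Decorated `1`-cobordisms up to isomorphism (relative to the boundary) and subdivision. -/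
def Hom (X Y : Pts A) : Type (max 1 u) := Quot (PreCob.Rel (X := X) (Y := Y))

instance : Category (Pts A) where
  Hom X Y := Hom X Y
  id X := Quot.mk _ (PreCob.ofEquiv (Equiv.refl _) (Equiv.refl _))
  comp f g := Quot.map₂ PreCob.comp (fun F _ _ h => PreCob.rel_comp (PreCob.rel_refl F) h)
    (fun _ _ G h => PreCob.rel_comp h (PreCob.rel_refl G)) f g
  id_comp := by
    rintro X Y ⟨F⟩
    exact (Quot.sound (PreCob.rel_ofEquiv_comp F _ _)).trans
      (Quot.sound (PreCob.rel_relabel_refl F))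
  comp_id := by
    rintro X Y ⟨F⟩
    exact (Quot.sound (PreCob.rel_comp_ofEquiv F _ _)).trans
      (Quot.sound (PreCob.rel_relabel_refl F))
  assoc := by
    rintro X Y Z W ⟨F⟩ ⟨G⟩ ⟨H⟩
    exact Quot.sound (PreCob.rel_comp_assoc F G H)

/-- The morphism represented by a combinatorial cobordism. -/
def PreCob.toHom {X Y : Pts A} (F : PreCob X Y) : X ⟶ Y := Quot.mk _ F

namespace Pts

/-- Permutation cobordisms: the isomorphism given by bijections of positive and of negative
points. -/
def isoOfEquiv {X Y : Pts A} (p : X.pos ≃ Y.pos) (n : X.neg ≃ Y.neg) : X ≅ Y where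
  hom := (PreCob.ofEquiv p n).toHom
  inv := (PreCob.ofEquiv p.symm n.symm).toHom
  hom_inv_id := (Quot.sound (PreCob.rel_comp_ofEquiv _ _ _)).trans
    ((Quot.sound (PreCob.rel_relabel_ofEquiv _ _ _ _)).trans
      (by rw [Equiv.self_trans_symm, Equiv.self_trans_symm]; rfl))
  inv_hom_id := (Quot.sound (PreCob.rel_comp_ofEquiv _ _ _)).trans
    ((Quot.sound (PreCob.rel_relabel_ofEquiv _ _ _ _)).trans
      (by rw [Equiv.symm_trans_self, Equiv.symm_trans_self]; rfl))

theorem isoOfEquiv_comp {X Y Z : Pts A} (p : X.pos ≃ Y.pos) (n : X.neg ≃ Y.neg)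
    (p' : Y.pos ≃ Z.pos) (n' : Y.neg ≃ Z.neg) :
    (isoOfEquiv p n).hom ≫ (isoOfEquiv p' n').hom = (isoOfEquiv (p.trans p') (n.trans n')).hom :=
  (Quot.sound (PreCob.rel_comp_ofEquiv _ _ _)).trans
    (Quot.sound (PreCob.rel_relabel_ofEquiv _ _ _ _))

/-- Disjoint union of cobordisms. -/
def tensorHom {X Y X' Y' : Pts A} (f : X ⟶ Y) (g : X' ⟶ Y') : X.sum X' ⟶ Y.sum Y' :=
  Quot.map₂ PreCob.sum (fun F _ _ h => PreCob.rel_sum (PreCob.rel_refl F) h)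
    (fun _ _ G h => PreCob.rel_sum h (PreCob.rel_refl G)) f g

instance : MonoidalCategoryStruct (Pts A) where
  tensorObj := Pts.sum
  tensorUnit := Pts.empty
  tensorHom := tensorHom
  whiskerLeft X _ _ f := tensorHom (𝟙 X) f
  whiskerRight f Y := tensorHom f (𝟙 Y)
  associator X Y Z := isoOfEquiv (X := (X.sum Y).sum Z) (Y := X.sum (Y.sum Z))
    (Equiv.sumAssoc _ _ _) (Equiv.sumAssoc _ _ _)
  leftUnitor X := isoOfEquiv (X := Pts.empty.sum X) (Equiv.emptySum Empty _) (Equiv.emptySum Empty _)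
  rightUnitor X := isoOfEquiv (X := X.sum Pts.empty) (Equiv.sumEmpty _ Empty) (Equiv.sumEmpty _ Empty)

theorem isoOfEquiv_tensor {X Y X' Y' : Pts A} (p : X.pos ≃ Y.pos) (n : X.neg ≃ Y.neg)
    (p' : X'.pos ≃ Y'.pos) (n' : X'.neg ≃ Y'.neg) :
    tensorHom (isoOfEquiv p n).hom (isoOfEquiv p' n').hom =
      (isoOfEquiv (X := X.sum X') (Y := Y.sum Y') (p.sumCongr p') (n.sumCongr n')).hom :=
  Quot.sound (PreCob.rel_sum_ofEquiv _ _ _ _)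

/-- `f` is the permutation cobordism given by `p` and `n`. -/
def IsPerm {X Y : Pts A} (f : X ⟶ Y) (p : X.pos ≃ Y.pos) (n : X.neg ≃ Y.neg) : Prop :=
  f = (isoOfEquiv p n).hom

theorem IsPerm.iso {X Y : Pts A} (p : X.pos ≃ Y.pos) (n : X.neg ≃ Y.neg) :
    IsPerm (isoOfEquiv p n).hom p n := rfl

theorem IsPerm.id (X : Pts A) : IsPerm (𝟙 X) (Equiv.refl _) (Equiv.refl _) := rfl

theorem IsPerm.comp {X Y Z : Pts A} {f : X ⟶ Y} {g : Y ⟶ Z} {p n p' n'}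
    (hf : IsPerm f p n) (hg : IsPerm g p' n') : IsPerm (f ≫ g) (p.trans p') (n.trans n') := by
  rw [IsPerm] at hf hg ⊢
  rw [hf, hg, isoOfEquiv_comp]

theorem IsPerm.tensor {X Y X' Y' : Pts A} {f : X ⟶ Y} {g : X' ⟶ Y'} {p n p' n'}
    (hf : IsPerm f p n) (hg : IsPerm g p' n') :
    IsPerm (tensorHom f g) (p.sumCongr p') (n.sumCongr n') := by
  rw [IsPerm] at hf hg ⊢
  rw [hf, hg, isoOfEquiv_tensor]

theorem IsPerm.eq {X Y : Pts A} {f g : X ⟶ Y} {p n p' n'} (hf : IsPerm f p n)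
    (hg : IsPerm g p' n') (hp : ∀ x, p x = p' x) (hn : ∀ x, n x = n' x) : f = g := by
  rw [IsPerm] at hf hg
  rw [hf, hg, Equiv.ext hp, Equiv.ext hn]

theorem tensorHom_comp {X Y Z X' Y' Z' : Pts A} (f : X ⟶ Y) (g : Y ⟶ Z) (f' : X' ⟶ Y')
    (g' : Y' ⟶ Z') : tensorHom f f' ≫ tensorHom g g' = tensorHom (f ≫ g) (f' ≫ g') := by
  obtain ⟨F⟩ := f
  obtain ⟨G⟩ := g
  obtain ⟨F'⟩ := f'
  obtain ⟨G'⟩ := g'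
  exact Quot.sound (PreCob.rel_sum_comp_sum F G F' G')

instance : MonoidalCategory (Pts A) := MonoidalCategory.ofTensorHom
  (id_tensorHom_id := fun X Y => ((IsPerm.id X).tensor (IsPerm.id Y)).eq (IsPerm.id _)
    (by rintro (_ | _) <;> rfl) (by rintro (_ | _) <;> rfl))
  (id_tensorHom := fun _ _ _ _ => rfl)
  (tensorHom_id := fun _ _ => rfl)
  (tensorHom_comp_tensorHom := fun f f' g g' => tensorHom_comp f g f' g')
  (associator_naturality := by
    rintro X Y Z X' Y' Z' ⟨F⟩ ⟨G⟩ ⟨H⟩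
    exact (Quot.sound (PreCob.rel_comp_ofEquiv _ _ _)).trans
      ((Quot.sound (PreCob.rel_sum_assoc F G H)).trans
        (Quot.sound (PreCob.rel_ofEquiv_comp _ _ _)).symm))
  (leftUnitor_naturality := by
    rintro X Y ⟨F⟩
    exact (Quot.sound (PreCob.rel_comp_ofEquiv _ _ _)).trans
      ((Quot.sound (PreCob.rel_empty_sum F)).trans
        (Quot.sound (PreCob.rel_ofEquiv_comp _ _ _)).symm))
  (rightUnitor_naturality := by
    rintro X Y ⟨F⟩
    exact (Quot.sound (PreCob.rel_comp_ofEquiv _ _ _)).trans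
      ((Quot.sound (PreCob.rel_sum_empty F)).trans
        (Quot.sound (PreCob.rel_ofEquiv_comp _ _ _)).symm))
  (pentagon := fun W X Y Z =>
    (((IsPerm.iso _ _).tensor (IsPerm.id Z)).comp
      ((IsPerm.iso _ _).comp ((IsPerm.id W).tensor (IsPerm.iso _ _)))).eq
      ((IsPerm.iso _ _).comp (IsPerm.iso _ _))
      (by rintro (((_ | _) | _) | _) <;> rfl) (by rintro (((_ | _) | _) | _) <;> rfl))
  (triangle := fun X Y =>
    ((IsPerm.iso _ _).comp ((IsPerm.id X).tensor (IsPerm.iso _ _))).eq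
      ((IsPerm.iso _ _).tensor (IsPerm.id Y))
      (by rintro ((_ | x) | _) <;> first | exact x.elim | rfl)
      (by rintro ((_ | x) | _) <;> first | exact x.elim | rfl))

instance : SymmetricCategory (Pts A) where
  braiding X Y := isoOfEquiv (X := X.sum Y) (Y := Y.sum X) (Equiv.sumComm _ _) (Equiv.sumComm _ _)
  braiding_naturality_right := by
    rintro X Y Z ⟨F⟩
    exact (Quot.sound (PreCob.rel_comp_ofEquiv _ _ _)).trans
      ((Quot.sound (PreCob.rel_sum_swap _ F)).trans
        (Quot.sound (PreCob.rel_ofEquiv_comp _ _ _)).symm)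
  braiding_naturality_left := by
    rintro X Y ⟨F⟩ Z
    exact (Quot.sound (PreCob.rel_comp_ofEquiv _ _ _)).trans
      ((Quot.sound (PreCob.rel_sum_swap F _)).trans
        (Quot.sound (PreCob.rel_ofEquiv_comp _ _ _)).symm)
  hexagon_forward X Y Z :=
    ((IsPerm.iso _ _).comp ((IsPerm.iso _ _).comp (IsPerm.iso _ _))).eq
      (((IsPerm.iso _ _).tensor (IsPerm.id Z)).comp
        ((IsPerm.iso _ _).comp ((IsPerm.id Y).tensor (IsPerm.iso _ _))))
      (by rintro ((_ | _) | _) <;> rfl) (by rintro ((_ | _) | _) <;> rfl)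
  hexagon_reverse X Y Z :=
    ((IsPerm.iso _ _).comp ((IsPerm.iso _ _).comp (IsPerm.iso _ _))).eq
      (((IsPerm.id X).tensor (IsPerm.iso _ _)).comp
        ((IsPerm.iso _ _).comp ((IsPerm.iso _ _).tensor (IsPerm.id Y))))
      (by rintro (_ | _ | _) <;> rfl) (by rintro (_ | _ | _) <;> rfl)
  symmetry X Y := ((IsPerm.iso _ _).comp (IsPerm.iso _ _)).eq (IsPerm.id _)
    (by rintro (_ | _) <;> rfl) (by rintro (_ | _) <;> rfl)

end Pts

/-! ### Sign sequences -/

inductive Sgn : Type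
  | plus
  | minus

/-- `Pos s l` is the set of positions of the sign sequence `l` at which the sign is `s`. -/
inductive Pos (s : Sgn) : List Sgn → Type
  | head (l : List Sgn) : Pos s (s :: l)
  | tail (t : Sgn) {l : List Sgn} (i : Pos s l) : Pos s (t :: l)

namespace Pos

variable {s : Sgn}

instance : IsEmpty (Pos s []) := ⟨fun i => nomatch i⟩

instance finite : (l : List Sgn) → Finite (Pos s l)
  | [] => inferInstance
  | t :: l =>
    have := finite l
    Finite.of_injective (β := Option (Pos s l))
      (fun i => match i with
        | .head _ => none
        | .tail _ i => some i)
      (by rintro (_ | ⟨_, i⟩) (_ | ⟨_, j⟩) h <;> simp_all)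

def inl : {l : List Sgn} → (m : List Sgn) → Pos s l → Pos s (l ++ m)
  | _ :: l, m, .head _ => .head (l ++ m)
  | t :: _, m, .tail _ i => .tail t (inl m i)

def inr : (l : List Sgn) → {m : List Sgn} → Pos s m → Pos s (l ++ m)
  | [], _, i => i
  | t :: l, _, i => .tail t (inr l i)

def split : (l m : List Sgn) → Pos s (l ++ m) → Pos s l ⊕ Pos s m
  | [], _, i => .inr i
  | _ :: l, _, .head _ => .inl (.head l)
  | t :: l, m, .tail _ i => (split l m i).map (.tail t) id

/-- The positions of a concatenation of sign sequences. -/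
def append (l m : List Sgn) : Pos s l ⊕ Pos s m ≃ Pos s (l ++ m) where
  toFun := Sum.elim (inl m) (inr l)
  invFun := split l m
  left_inv := by
    rintro (i | i)
    · change split l m (inl m i) = .inl i
      induction i with
      | head l => rfl
      | tail t i ih => simp [inl, split, ih]
    · change split l m (inr l i) = .inr i
      induction l with
      | nil => rfl
      | cons t l ih => simp [inr, split, ih]
  right_inv := by
    intro i
    induction l with
    | nil => rfl
    | cons t l ih =>
      cases i with
      | head => rfl
      | tail _ i =>
        have h := ih i
        simp only [List.append_eq, split]
        generalize split l m i = x at h ⊢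
        subst h
        rcases x with x | x <;> rfl

end Pos

/-- Objects of the category of oriented `1`-cobordisms with inner endpoints and with defects
labelled by `A`: finite sign sequences. -/
structure Cob (A : Type u) : Type where
  signs : List Sgn

namespace Cob

/-- The oriented `0`-manifold of a sign sequence. -/
abbrev toPts (x : Cob A) : Pts A := ⟨Pos .plus x.signs, Pos .minus x.signs⟩

instance : Category (Cob A) := inferInstanceAs (Category (InducedCategory (Pts A) toPts))

/-- The functor from sign sequences to oriented `0`-manifolds. -/
def incl : Cob A ⥤ Pts A := inducedFunctor toPts

instance : (incl (A := A)).Full := inferInstanceAs (inducedFunctor toPts).Full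
instance : (incl (A := A)).Faithful := inferInstanceAs (inducedFunctor toPts).Faithful

/-- Concatenation of sign sequences is disjoint union. -/
def sumIso (x y : Cob A) : x.toPts ⊗ y.toPts ≅ toPts (A := A) ⟨x.signs ++ y.signs⟩ :=
  Pts.isoOfEquiv (X := x.toPts.sum y.toPts) (Pos.append _ _) (Pos.append _ _)

def emptyIso : 𝟙_ (Pts A) ≅ toPts (A := A) ⟨[]⟩ :=
  Pts.isoOfEquiv (X := Pts.empty) (Equiv.equivOfIsEmpty _ _) (Equiv.equivOfIsEmpty _ _)

instance : MonoidalCategoryStruct (Cob A) where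
  tensorObj x y := ⟨x.signs ++ y.signs⟩
  tensorUnit := ⟨[]⟩
  tensorHom {x y x' y'} f g :=
    ⟨(sumIso x x').inv ≫ (f.hom ⊗ₘ g.hom) ≫ (sumIso y y').hom⟩
  whiskerLeft x {y z} f := ⟨(sumIso x y).inv ≫ (x.toPts ◁ f.hom) ≫ (sumIso x z).hom⟩
  whiskerRight {x y} f z := ⟨(sumIso x z).inv ≫ (f.hom ▷ z.toPts) ≫ (sumIso y z).hom⟩
  associator x y z := InducedCategory.isoMk
    (((sumIso ⟨x.signs ++ y.signs⟩ z).symm ≪≫ ((sumIso x y).symm ⊗ᵢ .refl _)) ≪≫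
      α_ x.toPts y.toPts z.toPts ≪≫
      ((.refl _ ⊗ᵢ sumIso y z) ≪≫ sumIso x ⟨y.signs ++ z.signs⟩))
  leftUnitor x := InducedCategory.isoMk
    (((sumIso ⟨[]⟩ x).symm ≪≫ (emptyIso.symm ⊗ᵢ .refl _)) ≪≫ λ_ x.toPts)
  rightUnitor x := InducedCategory.isoMk
    (((sumIso x ⟨[]⟩).symm ≪≫ (.refl _ ⊗ᵢ emptyIso.symm)) ≪≫ ρ_ x.toPts)

/-- The tensor structure on sign sequences is the one of `Pts`, transported along `sumIso`. -/
def inducingData : Monoidal.InducingFunctorData (incl (A := A)) where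
  μIso := sumIso
  εIso := emptyIso
  whiskerLeft_eq _ _ _ _ := rfl
  whiskerRight_eq _ _ := rfl
  tensorHom_eq _ _ := rfl
  associator_eq _ _ _ := rfl
  leftUnitor_eq _ := rfl
  rightUnitor_eq _ := rfl

instance : MonoidalCategory (Cob A) := Monoidal.induced incl inducingData

instance : (incl (A := A)).Monoidal := Monoidal.fromInducedMonoidal incl inducingData

instance : BraidedCategory (Cob A) := .ofFaithful incl
  (fun x y => InducedCategory.isoMk
    ((sumIso x y).symm ≪≫ β_ x.toPts y.toPts ≪≫ sumIso y x))
  (fun x y => by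
    change (sumIso x y).hom ≫ (sumIso x y).inv ≫ (β_ x.toPts y.toPts).hom ≫ (sumIso y x).hom =
      (β_ x.toPts y.toPts).hom ≫ (sumIso y x).hom
    exact Iso.hom_inv_id_assoc _ _)

instance : (incl (A := A)).Braided where
  braided x y := by
    change (sumIso x y).hom ≫ (sumIso x y).inv ≫ (β_ x.toPts y.toPts).hom ≫ (sumIso y x).hom =
      (β_ x.toPts y.toPts).hom ≫ (sumIso y x).hom
    exact Iso.hom_inv_id_assoc _ _

instance : SymmetricCategory (Cob A) := .ofFaithful incl

/-! ### The basic cobordisms -/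

/-- The morphism of sign sequences represented by a combinatorial cobordism. -/
def ofPreCob {x y : Cob A} (F : PreCob x.toPts y.toPts) : x ⟶ y := ⟨F.toHom⟩

/-- A positively oriented point. -/
abbrev plus : Cob A := ⟨[.plus]⟩

/-- A negatively oriented point. -/
abbrev minus : Cob A := ⟨[.minus]⟩

/-- An upward oriented interval with one defect labelled `a`. -/
def dotPlus (a : A) : (plus : Cob A) ⟶ plus := ofPreCob
  { V := Unit, S := Empty, T := Empty
    label := fun _ => some a
    next :=
      { toFun := fun
          | .bot (.head _) => .vert ()
          | .vert _ => .top (.head _)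
        invFun := fun
          | .top (.head _) => .vert ()
          | .vert _ => .bot (.head _)
        left_inv := by rintro ((_ | ⟨_, ⟨⟩⟩) | (_ | ⟨_, ⟨⟩⟩) | ⟨⟨⟩⟩ | _) <;> rfl
        right_inv := by rintro ((_ | ⟨_, ⟨⟩⟩) | (_ | ⟨_, ⟨⟩⟩) | ⟨⟨⟩⟩ | _) <;> rfl } }

/-- A downward oriented interval with one defect labelled `a`. -/
def dotMinus (a : A) : (minus : Cob A) ⟶ minus := ofPreCob
  { V := Unit, S := Empty, T := Empty
    label := fun _ => some a
    next :=
      { toFun := fun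
          | .top (.head _) => .vert ()
          | .vert _ => .bot (.head _)
        invFun := fun
          | .bot (.head _) => .vert ()
          | .vert _ => .top (.head _)
        left_inv := by rintro ((_ | ⟨_, ⟨⟩⟩) | (_ | ⟨_, ⟨⟩⟩) | ⟨⟨⟩⟩ | _) <;> rfl
        right_inv := by rintro ((_ | ⟨_, ⟨⟩⟩) | (_ | ⟨_, ⟨⟩⟩) | ⟨⟨⟩⟩ | _) <;> rfl } }

/-- The cup: an interval from `-` to `+`, both at the top. -/
def cup : 𝟙_ (Cob A) ⟶ plus ⊗ minus := ofPreCob (x := ⟨[]⟩) (y := ⟨[.plus, .minus]⟩)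
  { V := Empty, S := Empty, T := Empty
    label := Empty.elim
    next :=
      { toFun := fun
          | .top (.tail _ (.head _)) => .top (.head _)
        invFun := fun
          | .top (.head _) => .top (.tail _ (.head _))
        left_inv := by rintro (⟨⟨⟩⟩ | ⟨_ | ⟨_, (_ | ⟨_, ⟨⟩⟩)⟩⟩ | ⟨⟨⟩⟩ | ⟨⟨⟩⟩); rfl
        right_inv := by
          rintro (⟨_ | ⟨_, (_ | ⟨_, ⟨⟩⟩)⟩⟩ | ⟨⟨⟩⟩ | ⟨⟨⟩⟩ | ⟨⟨⟩⟩); rfl } }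

/-- The cap: an interval from `+` to `-`, both at the bottom. -/
def cap : minus ⊗ plus ⟶ 𝟙_ (Cob A) := ofPreCob (x := ⟨[.minus, .plus]⟩) (y := ⟨[]⟩)
  { V := Empty, S := Empty, T := Empty
    label := Empty.elim
    next :=
      { toFun := fun
          | .bot (.tail _ (.head _)) => .bot (.head _)
        invFun := fun
          | .bot (.head _) => .bot (.tail _ (.head _))
        left_inv := by
          rintro (⟨_ | ⟨_, (_ | ⟨_, ⟨⟩⟩)⟩⟩ | ⟨⟨⟩⟩ | ⟨⟨⟩⟩ | ⟨⟨⟩⟩); rfl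
        right_inv := by rintro (⟨⟨⟩⟩ | ⟨_ | ⟨_, (_ | ⟨_, ⟨⟩⟩)⟩⟩ | ⟨⟨⟩⟩ | ⟨⟨⟩⟩); rfl } }

/-- The half-interval from an inner endpoint to `+` at the top. -/
def halfTopPlus : 𝟙_ (Cob A) ⟶ plus := ofPreCob (x := ⟨[]⟩)
  { V := Empty, S := Unit, T := Empty
    label := Empty.elim
    next :=
      { toFun := fun
          | .start _ => .top (.head _)
        invFun := fun
          | .top (.head _) => .start ()
        left_inv := by rintro (⟨⟨⟩⟩ | ⟨_ | ⟨_, ⟨⟩⟩⟩ | _ | ⟨⟨⟩⟩); rfl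
        right_inv := by rintro (⟨_ | ⟨_, ⟨⟩⟩⟩ | ⟨⟨⟩⟩ | ⟨⟨⟩⟩ | ⟨⟨⟩⟩); rfl } }

/-- The half-interval from `+` at the bottom to an inner endpoint. -/
def halfBotPlus : plus ⟶ 𝟙_ (Cob A) := ofPreCob (y := ⟨[]⟩)
  { V := Empty, S := Empty, T := Unit
    label := Empty.elim
    next :=
      { toFun := fun
          | .bot (.head _) => .finish ()
        invFun := fun
          | .finish _ => .bot (.head _)
        left_inv := by rintro (⟨_ | ⟨_, ⟨⟩⟩⟩ | ⟨⟨⟩⟩ | ⟨⟨⟩⟩ | ⟨⟨⟩⟩); rfl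
        right_inv := by rintro (⟨⟨⟩⟩ | ⟨_ | ⟨_, ⟨⟩⟩⟩ | _ | ⟨⟨⟩⟩); rfl } }

/-- The half-interval from `-` at the top to an inner endpoint. -/
def halfTopMinus : 𝟙_ (Cob A) ⟶ minus := ofPreCob (x := ⟨[]⟩)
  { V := Empty, S := Empty, T := Unit
    label := Empty.elim
    next :=
      { toFun := fun
          | .top (.head _) => .finish ()
        invFun := fun
          | .finish _ => .top (.head _)
        left_inv := by rintro (⟨⟨⟩⟩ | ⟨_ | ⟨_, ⟨⟩⟩⟩ | ⟨⟨⟩⟩ | ⟨⟨⟩⟩); rfl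
        right_inv := by rintro (⟨_ | ⟨_, ⟨⟩⟩⟩ | ⟨⟨⟩⟩ | _ | ⟨⟨⟩⟩); rfl } }

/-- The half-interval from an inner endpoint to `-` at the bottom. -/
def halfBotMinus : minus ⟶ 𝟙_ (Cob A) := ofPreCob (y := ⟨[]⟩)
  { V := Empty, S := Unit, T := Empty
    label := Empty.elim
    next :=
      { toFun := fun
          | .start _ => .bot (.head _)
        invFun := fun
          | .bot (.head _) => .start ()
        left_inv := by rintro (⟨_ | ⟨_, ⟨⟩⟩⟩ | ⟨⟨⟩⟩ | _ | ⟨⟨⟩⟩); rfl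
        right_inv := by rintro (⟨⟨⟩⟩ | ⟨_ | ⟨_, ⟨⟩⟩⟩ | ⟨⟨⟩⟩ | ⟨⟨⟩⟩); rfl } }

end Cob

/-! ### Free modules over the Boolean semiring -/

/-- The Boolean semiring `{0, 1 | 1 + 1 = 1}`: addition is disjunction, multiplication is
conjunction. -/
def 𝔹 : Type := Bool

instance : Zero 𝔹 := ⟨false⟩
instance : One 𝔹 := ⟨true⟩
instance : Add 𝔹 := ⟨or⟩
instance : Mul 𝔹 := ⟨and⟩

instance : CommSemiring 𝔹 where
  nsmul := nsmulRec
  add_assoc := Bool.or_assoc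
  zero_add := Bool.false_or
  add_zero := Bool.or_false
  add_comm := Bool.or_comm
  mul_assoc := Bool.and_assoc
  one_mul := Bool.true_and
  mul_one := Bool.and_true
  mul_comm := Bool.and_comm
  zero_mul := Bool.false_and
  mul_zero := Bool.and_false
  left_distrib := Bool.and_or_distrib_left
  right_distrib := Bool.and_or_distrib_right

/-- Being a free `𝔹`-module, as a property of objects of the category of `𝔹`-modules. -/
def isFree : ObjectProperty (SemimoduleCat.{0} 𝔹) := fun M => Module.Free 𝔹 M

instance : isFree.IsMonoidal where
  prop_unit := inferInstanceAs (Module.Free 𝔹 𝔹)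
  prop_tensor M N hM hN := by
    have : Module.Free 𝔹 M := hM
    have : Module.Free 𝔹 N := hN
    exact inferInstanceAs (Module.Free 𝔹 (M ⊗[𝔹] N))

/-- The symmetric monoidal category of free `𝔹`-modules, with the tensor product over `𝔹`. -/
abbrev FreeMod := isFree.FullSubcategory

/-- The linear map underlying a morphism of free `𝔹`-modules. -/
def lin {M N : FreeMod} (f : M ⟶ N) : M.obj →ₗ[𝔹] N.obj := f.hom.hom

/-! ### Automata and topological quantum field theories -/

/-- A nondeterministic finite automaton over the alphabet `A`, with its finite set of states. -/
structure Automaton (A : Type u) : Type (max 1 u) where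
  State : Type
  [finite : Finite State]
  nfa : NFA A State

attribute [instance] Automaton.finite

namespace Automaton

/-- Isomorphisms of automata. -/
structure Iso (Q R : Automaton A) where
  toEquiv : Q.State ≃ R.State
  step_iff : ∀ q a q', toEquiv q' ∈ R.nfa.step (toEquiv q) a ↔ q' ∈ Q.nfa.step q a
  start_iff : ∀ q, toEquiv q ∈ R.nfa.start ↔ q ∈ Q.nfa.start
  accept_iff : ∀ q, toEquiv q ∈ R.nfa.accept ↔ q ∈ Q.nfa.accept

/-- Two automata are equivalent if they are isomorphic. -/
def isoSetoid (A : Type u) : Setoid (Automaton A) where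
  r Q R := Nonempty (Iso Q R)
  iseqv :=
    { refl := fun _ => ⟨⟨Equiv.refl _, fun _ _ _ => Iff.rfl, fun _ => Iff.rfl, fun _ => Iff.rfl⟩⟩
      symm := fun ⟨e⟩ => ⟨⟨e.toEquiv.symm,
        fun q a q' => by rw [← e.step_iff]; simp,
        fun q => by rw [← e.start_iff]; simp, fun q => by rw [← e.accept_iff]; simp⟩⟩
      trans := fun ⟨e⟩ ⟨f⟩ => ⟨⟨e.toEquiv.trans f.toEquiv,
        fun q a q' => (f.step_iff _ _ _).trans (e.step_iff _ _ _),
        fun q => (f.start_iff _).trans (e.start_iff _),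
        fun q => (f.accept_iff _).trans (e.accept_iff _)⟩⟩ }

variable (Q : Automaton A)

/-- The free `𝔹`-module on the set of states. -/
abbrev Vec : Type := Q.State →₀ 𝔹

/-- The basis vector of a state. -/
noncomputable abbrev basis (q : Q.State) : Q.Vec := Finsupp.single q 1

/-- The sum of the states in a set of states. -/
noncomputable def sumVec (s : Set Q.State) : Q.Vec := ∑ q ∈ s.toFinite.toFinset, Q.basis q

/-- The action `q ↦ ∑ q' ∈ δ(q, a), q'` of a letter. -/
noncomputable def act (a : A) : Q.Vec →ₗ[𝔹] Q.Vec :=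
  Finsupp.linearCombination 𝔹 (fun q => Q.sumVec (Q.nfa.step q a))

/-- The initial vector. -/
noncomputable def initVec : Q.Vec := Q.sumVec Q.nfa.start

/-- The functional which is `1` on accepting states and `0` on the other states. -/
noncomputable def acceptFun : Module.Dual 𝔹 Q.Vec :=
  Finsupp.linearCombination 𝔹 (Q.nfa.accept.indicator 1)

end Automaton

/-- Symmetric (strong) monoidal functors from the category of oriented `1`-cobordisms with inner
endpoints and `A`-labelled defects to the category of free `𝔹`-modules. -/
structure TQFT (A : Type u) where
  toFunctor : Cob A ⥤ FreeMod
  [braided : toFunctor.Braided]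

attribute [instance] TQFT.braided

namespace TQFT

/-- Two symmetric monoidal functors are equivalent if there is a monoidal natural isomorphism
between them. -/
def isoSetoid (A : Type u) : Setoid (TQFT A) where
  r F G := ∃ e : F.toFunctor ≅ G.toFunctor, NatTrans.IsMonoidal e.hom
  iseqv :=
    { refl := fun _ => ⟨CategoryTheory.Iso.refl _, inferInstanceAs (NatTrans.IsMonoidal (𝟙 _))⟩
      symm := fun ⟨e, _⟩ => ⟨e.symm, inferInstanceAs (NatTrans.IsMonoidal e.inv)⟩
      trans := fun ⟨e, _⟩ ⟨f, _⟩ =>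
        ⟨e ≪≫ f, inferInstanceAs (NatTrans.IsMonoidal (e.hom ≫ f.hom))⟩ }

open Functor.LaxMonoidal Functor.OplaxMonoidal

/-- Identifications of the values of `F` on the points `+` and `-` with the free module on the
states of `Q` and its dual under which the values of `F` on the basic cobordisms are the ones
prescribed by the automaton `Q`. -/
structure Realization (Q : Automaton A) (F : TQFT A) : Type where
  pos : (F.toFunctor.obj Cob.plus).obj ≃ₗ[𝔹] Q.Vec
  neg : (F.toFunctor.obj Cob.minus).obj ≃ₗ[𝔹] Module.Dual 𝔹 Q.Vec
  map_dotPlus : ∀ a x, pos (lin (F.toFunctor.map (Cob.dotPlus a)) x) = Q.act a (pos x)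
  map_dotMinus : ∀ a y,
    neg (lin (F.toFunctor.map (Cob.dotMinus a)) y) = (Q.act a).dualMap (neg y)
  map_cup : lin (ε F.toFunctor ≫ F.toFunctor.map Cob.cup ≫ δ F.toFunctor Cob.plus Cob.minus)
      (1 : 𝔹) = ∑ᶠ q, pos.symm (Q.basis q) ⊗ₜ[𝔹] neg.symm (Finsupp.lapply q)
  map_cap : ∀ y x,
    lin (μ F.toFunctor Cob.minus Cob.plus ≫ F.toFunctor.map Cob.cap ≫ η F.toFunctor)
      (y ⊗ₜ[𝔹] x) = neg y (pos x)
  map_halfTopPlus : pos (lin (ε F.toFunctor ≫ F.toFunctor.map Cob.halfTopPlus) (1 : 𝔹)) = Q.initVec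
  map_halfBotPlus : ∀ x,
    lin (F.toFunctor.map Cob.halfBotPlus ≫ η F.toFunctor) x = Q.acceptFun (pos x)
  map_halfTopMinus :
    neg (lin (ε F.toFunctor ≫ F.toFunctor.map Cob.halfTopMinus) (1 : 𝔹)) = Q.acceptFun
  map_halfBotMinus : ∀ y,
    lin (F.toFunctor.map Cob.halfBotMinus ≫ η F.toFunctor) y = neg y Q.initVec

end TQFT

end OneCob

/-! Existence is a state sum. The matrix entry of a decorated cobordism between two colourings of
its boundary by states is `1` exactly when the colouring extends to the edges: the colour is
unchanged at ordinary points, follows a transition at each defect, and is initial or accepting at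
the inner endpoints. Over the Boolean semiring, composing relations is multiplying matrices, so
cutting along the gluing points (`PreCob.colorable_comp`) gives functoriality. Colourings of a
disjoint union are pairs of colourings, which gives the symmetric monoidal structure. Subdivision
does not change colourability (`PreCob.Subdivision.colorable_iff`).

Conversely, a symmetric monoidal functor sends the cup and the cap to the unit and the pairing of a
duality (`TQFT.exists_cup`). The value at `+` is therefore free and finitely generated, and a basis
of it is the set of states. Coordinates are `0` or `1`, so the images of the dotted interval and of
the half-intervals are a transition function and sets of initial and accepting states
(`TQFT.exists_automaton`). The values on the downward generators and on the cup need not be checked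
separately: the zigzag relations and the bending relations force them (`TQFT.exists_realization`).

The automaton is unique because a free module over the Boolean semiring has only one basis: basis
vectors are the atoms of the order `x + y = y`, so linear equivalences permute them
(`exists_equiv_of_linearEquiv`).

The functor is unique because the generators generate. `PreCob.rel_lower_comp_upper` factors any
cobordism into cups and half-intervals, a permutation, then labelled caps and half-intervals.
Permutations of sign sequences are made of braidings (`Cob.perm_mem`). Hence isomorphisms at `+` and
`-` that respect the generators extend to a monoidal natural isomorphism (`PointIso.exists_iso`). -/

namespace OneCob

universe u

variable {A : Type u}

/-! ### Computing with representatives; families of elementary cobordisms. -/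

namespace PreCob

variable {X Y Z X' Y' : Pts A}

theorem toHom_comp (F : PreCob X Y) (G : PreCob Y Z) : F.toHom ≫ G.toHom = (F.comp G).toHom := rfl

theorem toHom_comp_isoOfEquiv (F : PreCob X Y) (p : Y.pos ≃ Y'.pos) (n : Y.neg ≃ Y'.neg) :
    F.toHom ≫ (Pts.isoOfEquiv p n).hom = (F.relabel (Equiv.refl _) (Equiv.refl _) p n).toHom :=
  Quot.sound (rel_comp_ofEquiv F p n)

theorem isoOfEquiv_comp_toHom (F : PreCob X Y) (p : X'.pos ≃ X.pos) (n : X'.neg ≃ X.neg) :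
    (Pts.isoOfEquiv p n).hom ≫ F.toHom = (F.relabel p n (Equiv.refl _) (Equiv.refl _)).toHom :=
  Quot.sound (rel_ofEquiv_comp F p n)

/-- Permutation cobordisms are absorbed by renaming boundary points. This serves twice: classes of
morphisms that contain permutations are closed under `relabel`, and the tensor product of sign
sequences gets an explicit representative. -/
theorem isoOfEquiv_comp_toHom_comp_isoOfEquiv (F : PreCob X Y) (p : X'.pos ≃ X.pos)
    (n : X'.neg ≃ X.neg) (p' : Y.pos ≃ Y'.pos) (n' : Y.neg ≃ Y'.neg) :
    (Pts.isoOfEquiv p n).hom ≫ F.toHom ≫ (Pts.isoOfEquiv p' n').hom =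
      (F.relabel p n p' n').toHom := by
  rw [toHom_comp_isoOfEquiv, isoOfEquiv_comp_toHom]
  refine Quot.sound (rel_of_iso (Equiv.refl _) (Equiv.refl _) (Equiv.refl _) (fun _ => rfl) ?_)
  have h : ∀ z : Tgt Y.pos X.neg F.T F.V,
      (z.map p' id id id).map id n.symm id id =
        (z.map p' n.symm id id).map id id (Equiv.refl _) (Equiv.refl _) := by
    rintro (_ | _ | _ | _) <;> rfl
  rintro (_ | _ | _ | _) <;> exact h _

theorem toHom_eq_of_rel {F G : PreCob X Y} (h : Rel F G) : F.toHom = G.toHom := Quot.sound h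

/-- One step of a walk, with the present position given only up to an equation. In concrete
cobordisms that equation holds by computation, so a strand can be followed by repeated use with
`rfl`. -/
theorem Leads.cons {F : PreCob X Y} {V T : Type} {v : V → F.V} {t : T → F.T}
    {z : Tgt Y.pos X.neg F.T F.V} {z' : Tgt Y.pos X.neg T V} (w : F.V) (hz : z = .vert w)
    (hw : w ∉ Set.range v) (h : Leads F v t (F.next (.vert w)) z') : Leads F v t z z' :=
  hz ▸ .step w hw z' h

/-! ### Families of elementary cobordisms -/

/-- A disjoint union of cups, one for each element of `K`. -/
def cups (K : Type) [Finite K] : PreCob (A := A) Pts.empty ⟨K, K⟩ where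
  V := Empty
  S := Empty
  T := Empty
  label := Empty.elim
  next :=
    { toFun := fun
        | .top x => .top x
      invFun := fun
        | .top x => .top x
      left_inv := by rintro (⟨⟨⟩⟩ | _ | ⟨⟨⟩⟩ | ⟨⟨⟩⟩); rfl
      right_inv := by rintro (_ | ⟨⟨⟩⟩ | ⟨⟨⟩⟩ | ⟨⟨⟩⟩); rfl }

/-- A disjoint union of caps, each of which carries one labelled vertex. -/
def caps {K : Type} [Finite K] (l : K → Option A) : PreCob (A := A) ⟨K, K⟩ Pts.empty where
  V := K
  S := Empty
  T := Empty
  label := l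
  next :=
    { toFun := fun
        | .bot x => .vert x
        | .vert x => .bot x
      invFun := fun
        | .vert x => .bot x
        | .bot x => .vert x
      left_inv := by rintro (_ | ⟨⟨⟩⟩ | ⟨⟨⟩⟩ | _) <;> rfl
      right_inv := by rintro (⟨⟨⟩⟩ | _ | ⟨⟨⟩⟩ | _) <;> rfl }

/-- A disjoint union of half-intervals from inner endpoints to the top. -/
def starts (K : Type) [Finite K] : PreCob (A := A) Pts.empty ⟨K, Empty⟩ where
  V := Empty
  S := K
  T := Empty
  label := Empty.elim
  next :=
    { toFun := fun
        | .start x => .top x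
      invFun := fun
        | .top x => .start x
      left_inv := by rintro (⟨⟨⟩⟩ | ⟨⟨⟩⟩ | _ | ⟨⟨⟩⟩); rfl
      right_inv := by rintro (_ | ⟨⟨⟩⟩ | ⟨⟨⟩⟩ | ⟨⟨⟩⟩); rfl }

/-- A disjoint union of half-intervals from the bottom to inner endpoints. -/
def finishes (K : Type) [Finite K] : PreCob (A := A) ⟨K, Empty⟩ Pts.empty where
  V := Empty
  S := Empty
  T := K
  label := Empty.elim
  next :=
    { toFun := fun
        | .bot x => .finish x
      invFun := fun
        | .finish x => .bot x
      left_inv := by rintro (_ | ⟨⟨⟩⟩ | ⟨⟨⟩⟩ | ⟨⟨⟩⟩); rfl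
      right_inv := by rintro (⟨⟨⟩⟩ | ⟨⟨⟩⟩ | _ | ⟨⟨⟩⟩); rfl }

end PreCob

/-! ### Generation of the cobordisms between `0`-manifolds. -/

open PreCob

/-- A property of morphisms which is closed under composition and disjoint union, and holds for
permutation cobordisms and for the generating cobordisms. -/
structure IsGenerated (W : MorphismProperty (Pts A)) : Prop where
  comp {X Y Z : Pts A} (f : X ⟶ Y) (g : Y ⟶ Z) : W f → W g → W (f ≫ g)
  tensor {X Y X' Y' : Pts A} (f : X ⟶ Y) (g : X' ⟶ Y') : W f → W g → W (Pts.tensorHom f g)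
  perm {X Y : Pts A} (p : X.pos ≃ Y.pos) (n : X.neg ≃ Y.neg) : W (Pts.isoOfEquiv p n).hom
  dotPlus (a : A) : W (Cob.dotPlus a).hom
  cup : W (X := Cob.toPts _) (Y := Cob.toPts _) (Cob.cup).hom
  cap : W (X := Cob.toPts _) (Y := Cob.toPts _) (Cob.cap).hom
  halfTopPlus : W (X := Cob.toPts _) (Y := Cob.toPts _) (Cob.halfTopPlus).hom
  halfBotPlus : W (X := Cob.toPts _) (Y := Cob.toPts _) (Cob.halfBotPlus).hom

/-- The unique position of a one-term sequence. -/
def Pos.equivUnit (s : Sgn) : Pos s [s] ≃ Unit where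
  toFun _ := ()
  invFun _ := .head _
  left_inv := by rintro (_ | ⟨_, ⟨⟩⟩); rfl
  right_inv _ := rfl

instance : IsEmpty (Pos .minus [.plus]) := ⟨by rintro (_ | ⟨_, ⟨⟩⟩)⟩

/-- The unique positive position of `+-`. -/
def Pos.plusEquivUnit : Pos .plus [.plus, .minus] ≃ Unit where
  toFun _ := ()
  invFun _ := .head _
  left_inv := by rintro (_ | ⟨_, (_ | ⟨_, ⟨⟩⟩)⟩); rfl
  right_inv _ := rfl

/-- The unique negative position of `+-`. -/
def Pos.minusEquivUnit : Pos .minus [.plus, .minus] ≃ Unit where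
  toFun _ := ()
  invFun _ := .tail _ (.head _)
  left_inv := by rintro (_ | ⟨_, (_ | ⟨_, ⟨⟩⟩)⟩); rfl
  right_inv _ := rfl

/-- The unique positive position of `-+`. -/
def Pos.plusEquivUnit' : Pos .plus [.minus, .plus] ≃ Unit where
  toFun _ := ()
  invFun _ := .tail _ (.head _)
  left_inv := by rintro (_ | ⟨_, (_ | ⟨_, ⟨⟩⟩)⟩); rfl
  right_inv _ := rfl

/-- The unique negative position of `-+`. -/
def Pos.minusEquivUnit' : Pos .minus [.minus, .plus] ≃ Unit where
  toFun _ := ()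
  invFun _ := .head _
  left_inv := by rintro (_ | ⟨_, (_ | ⟨_, ⟨⟩⟩)⟩); rfl
  right_inv _ := rfl

/-- The shape `K ⊕ Unit` of the inductive step fits families of cobordisms: one component is added
by disjoint union. -/
theorem finite_induction {P : Type → Prop} (equiv : ∀ {K L : Type} [Finite K] [Finite L],
      K ≃ L → P K → P L) (empty : P Empty)
    (sum_unit : ∀ {K : Type} [Finite K], P K → P (K ⊕ Unit)) (K : Type) [Finite K] : P K := by
  -- The transport case of the underlying induction provides no finiteness, so finiteness is carried
  -- along with `P`.
  suffices h : Finite K ∧ P K from h.2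
  induction K using Finite.induction_empty_option with
  | of_equiv e ih =>
    obtain ⟨h, ih⟩ := ih
    have := Finite.of_equiv _ e
    exact ⟨this, equiv e ih⟩
  | h_empty => exact ⟨inferInstance, equiv (Equiv.equivPEmpty Empty) empty⟩
  | h_option ih =>
    obtain ⟨h, ih⟩ := ih
    exact ⟨inferInstance, equiv (Equiv.optionEquivSumPUnit _).symm (sum_unit ih)⟩

namespace IsGenerated

variable {W : MorphismProperty (Pts A)}

theorem relabel (hW : IsGenerated W) {X Y X' Y' : Pts A} {F : PreCob X Y} (h : W F.toHom)
    (p : X'.pos ≃ X.pos) (n : X'.neg ≃ X.neg) (p' : Y.pos ≃ Y'.pos) (n' : Y.neg ≃ Y'.neg) :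
    W (F.relabel p n p' n').toHom := by
  rw [← isoOfEquiv_comp_toHom_comp_isoOfEquiv]
  exact hW.comp _ _ (hW.perm _ _) (hW.comp _ _ h (hW.perm _ _))

theorem sum (hW : IsGenerated W) {X Y X' Y' : Pts A} {F : PreCob X Y} {G : PreCob X' Y'}
    (h : W F.toHom) (h' : W G.toHom) : W (F.sum G).toHom := hW.tensor _ _ h h'

theorem ofEquiv (hW : IsGenerated W) {X Y : Pts A} (p : X.pos ≃ Y.pos) (n : X.neg ≃ Y.neg) :
    W (PreCob.ofEquiv p n).toHom := hW.perm p n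

theorem of_rel (hW : IsGenerated W) {X Y X' Y' : Pts A} {G : PreCob X' Y'} {F : PreCob X Y}
    (h : W F.toHom) (p : X'.pos ≃ X.pos) (n : X'.neg ≃ X.neg) (p' : Y.pos ≃ Y'.pos)
    (n' : Y.neg ≃ Y'.neg) (r : Rel G (F.relabel p n p' n')) : W G.toHom :=
  toHom_eq_of_rel r ▸ hW.relabel h p n p' n'

/-- Induction on `K`: the empty family is the permutation of no points, and passing to `K ⊕ Unit`
adds one copy of the generator. The families `finishes`, `cups` and `caps` are treated in the same
way. -/
theorem starts (hW : IsGenerated W) (K : Type) [h : Finite K] : W (starts K).toHom := by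
  refine finite_induction (P := fun K => ∀ _ : Finite K, W (PreCob.starts K).toHom) ?_ ?_ ?_ K h
  · intro K L _ _ e ih _
    refine hW.of_rel (Y' := ⟨L, Empty⟩) (ih inferInstance) (Equiv.refl _) (Equiv.refl _) e
      (Equiv.refl _) (rel_of_iso (Equiv.refl Empty) e (Equiv.refl Empty) (fun x => x.elim) ?_)
    rintro (⟨⟨⟩⟩ | ⟨⟨⟩⟩ | _ | ⟨⟨⟩⟩)
    rfl
  · intro _
    rw [toHom_eq_of_rel (rel_of_iso (F := PreCob.starts Empty) (G := PreCob.ofEquiv (Equiv.refl _)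
      (Equiv.refl _)) (Equiv.refl Empty) (Equiv.refl Empty) (Equiv.refl Empty)
      (fun x => x.elim) (by rintro (⟨⟨⟩⟩ | ⟨⟨⟩⟩ | ⟨⟨⟩⟩ | ⟨⟨⟩⟩)))]
    exact hW.ofEquiv _ _
  · intro K _ ih _
    have h : W (PreCob.toHom _) := hW.halfTopPlus
    refine hW.of_rel (Y' := ⟨K ⊕ Unit, Empty⟩) (hW.sum (ih inferInstance) h)
      (Equiv.equivOfIsEmpty Empty (Empty ⊕ Pos .plus []))
        (Equiv.equivOfIsEmpty Empty (Empty ⊕ Pos .minus []))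
      ((Equiv.refl _).sumCongr (Pos.equivUnit _))
        (Equiv.equivOfIsEmpty (Empty ⊕ Pos .minus [.plus]) Empty)
      (rel_of_iso (Equiv.emptySum Empty Empty) (Equiv.refl (K ⊕ Unit)) (Equiv.emptySum Empty Empty)
        ?_ ?_)
    · rintro (⟨⟨⟩⟩ | ⟨⟨⟩⟩)
    · rintro (⟨⟨⟩⟩ | ⟨⟨⟩⟩ | (_ | _) | (⟨⟨⟩⟩ | ⟨⟨⟩⟩)) <;> rfl

theorem finishes (hW : IsGenerated W) (K : Type) [h : Finite K] : W (finishes K).toHom := by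
  refine finite_induction (P := fun K => ∀ _ : Finite K, W (PreCob.finishes K).toHom) ?_ ?_ ?_ K h
  · intro K L _ _ e ih _
    refine hW.of_rel (X' := ⟨L, Empty⟩) (ih inferInstance) e.symm (Equiv.refl _) (Equiv.refl _)
      (Equiv.refl _) (rel_of_iso (Equiv.refl Empty) (Equiv.refl Empty) e (fun x => x.elim) ?_)
    rintro (x | ⟨⟨⟩⟩ | ⟨⟨⟩⟩ | ⟨⟨⟩⟩)
    exact congrArg Tgt.finish (e.apply_symm_apply x).symm
  · intro _
    rw [toHom_eq_of_rel (rel_of_iso (F := PreCob.finishes Empty) (G := PreCob.ofEquiv (Equiv.refl _)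
      (Equiv.refl _)) (Equiv.refl Empty) (Equiv.refl Empty) (Equiv.refl Empty)
      (fun x => x.elim) (by rintro (⟨⟨⟩⟩ | ⟨⟨⟩⟩ | ⟨⟨⟩⟩ | ⟨⟨⟩⟩)))]
    exact hW.ofEquiv _ _
  · intro K _ ih _
    have h : W (PreCob.toHom _) := hW.halfBotPlus
    refine hW.of_rel (X' := ⟨K ⊕ Unit, Empty⟩) (hW.sum (ih inferInstance) h)
      ((Equiv.refl _).sumCongr (Pos.equivUnit _).symm)
        (Equiv.equivOfIsEmpty Empty (Empty ⊕ Pos .minus [.plus]))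
      (Equiv.equivOfIsEmpty (Empty ⊕ Pos .plus []) Empty)
      (Equiv.equivOfIsEmpty (Empty ⊕ Pos .minus []) Empty)
      (rel_of_iso (Equiv.emptySum Empty Empty) (Equiv.emptySum Empty Empty) (Equiv.refl (K ⊕ Unit))
        ?_ ?_)
    · rintro (⟨⟨⟩⟩ | ⟨⟨⟩⟩)
    · rintro ((_ | _) | ⟨⟨⟩⟩ | (⟨⟨⟩⟩ | ⟨⟨⟩⟩) | (⟨⟨⟩⟩ | ⟨⟨⟩⟩)) <;> rfl

theorem cups (hW : IsGenerated W) (K : Type) [h : Finite K] : W (cups K).toHom := by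
  refine finite_induction (P := fun K => ∀ _ : Finite K, W (PreCob.cups K).toHom) ?_ ?_ ?_ K h
  · intro K L _ _ e ih _
    refine hW.of_rel (Y' := ⟨L, L⟩) (ih inferInstance) (Equiv.refl _) (Equiv.refl _) e e
      (rel_of_iso (Equiv.refl Empty) (Equiv.refl Empty) (Equiv.refl Empty) (fun x => x.elim) ?_)
    rintro (⟨⟨⟩⟩ | x | ⟨⟨⟩⟩ | ⟨⟨⟩⟩)
    exact congrArg Tgt.top (e.apply_symm_apply x).symm
  · intro _
    rw [toHom_eq_of_rel (rel_of_iso (F := PreCob.cups Empty) (G := PreCob.ofEquiv (Equiv.refl _)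
      (Equiv.refl _)) (Equiv.refl Empty) (Equiv.refl Empty) (Equiv.refl Empty)
      (fun x => x.elim) (by rintro (⟨⟨⟩⟩ | ⟨⟨⟩⟩ | ⟨⟨⟩⟩ | ⟨⟨⟩⟩)))]
    exact hW.ofEquiv _ _
  · intro K _ ih _
    have h : W (PreCob.toHom _) := hW.cup
    refine hW.of_rel (Y' := ⟨K ⊕ Unit, K ⊕ Unit⟩) (hW.sum (ih inferInstance) h)
      (Equiv.equivOfIsEmpty Empty (Empty ⊕ Pos .plus []))
      (Equiv.equivOfIsEmpty Empty (Empty ⊕ Pos .minus []))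
      ((Equiv.refl _).sumCongr Pos.plusEquivUnit) ((Equiv.refl _).sumCongr Pos.minusEquivUnit)
      (rel_of_iso (Equiv.emptySum Empty Empty) (Equiv.emptySum Empty Empty)
        (Equiv.emptySum Empty Empty) ?_ ?_)
    · rintro (⟨⟨⟩⟩ | ⟨⟨⟩⟩)
    · rintro (⟨⟨⟩⟩ | (_ | _) | (⟨⟨⟩⟩ | ⟨⟨⟩⟩) | (⟨⟨⟩⟩ | ⟨⟨⟩⟩)) <;> rfl

/-- Without a label the vertex is an ordinary point, and erasing it leaves the plain cap. With a
label the cap is obtained by gluing a dotted interval below the positive leg of the plain cap. -/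
theorem caps_unit (hW : IsGenerated W) (l : Unit → Option A) : W (caps l).toHom := by
  have h : W (PreCob.toHom _) := hW.cap
  rcases hl : l () with _ | a
  · refine hW.of_rel h (X' := ⟨Unit, Unit⟩)
      Pos.plusEquivUnit'.symm Pos.minusEquivUnit'.symm
      (Equiv.equivOfIsEmpty (Pos .plus []) Empty) (Equiv.equivOfIsEmpty (Pos .minus []) Empty) ⟨{
      v := Empty.elim
      s := Equiv.refl Empty
      t := Equiv.refl Empty
      v_injective := fun x => x.elim
      label_v := fun x => x.elim
      label_new := fun _ _ => hl
      next_leads := ?_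
      new_leads := ?_ }⟩
    · rintro (_ | ⟨⟨⟩⟩ | ⟨⟨⟩⟩ | ⟨⟨⟩⟩)
      exact Leads.step (F := PreCob.caps l) (v := Empty.elim) (t := Equiv.refl Empty) ()
        (by rintro ⟨⟨⟩, _⟩) (.bot ()) (.of_eq rfl)
    · rintro ⟨⟩ hw
      exact ⟨_, Leads.step (F := PreCob.caps l) (v := Empty.elim) (t := Equiv.refl Empty) () hw
        (.bot ()) (.of_eq rfl)⟩
  · have h' : W (PreCob.toHom _) := hW.dotPlus a
    -- The dotted interval next to an undecorated negative strand.
    have hs := hW.relabel (hW.sum h' (hW.ofEquiv (X := ⟨Empty, Unit⟩) (Y := ⟨Empty, Unit⟩)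
      (Equiv.refl _) (Equiv.refl _))) (X' := ⟨Unit, Unit⟩) (Y' := ⟨Unit, Unit⟩)
      ((Equiv.sumEmpty (Pos .plus [.plus]) Empty).trans (Pos.equivUnit _)).symm
      (Equiv.emptySum (Pos .minus [.plus]) Unit).symm
      ((Equiv.sumEmpty (Pos .plus [.plus]) Empty).trans (Pos.equivUnit _))
      (Equiv.emptySum (Pos .minus [.plus]) Unit)
    have hc := hW.relabel h (X' := ⟨Unit, Unit⟩) (Y' := Pts.empty)
      Pos.plusEquivUnit'.symm Pos.minusEquivUnit'.symm
      (Equiv.equivOfIsEmpty (Pos .plus []) Empty) (Equiv.equivOfIsEmpty (Pos .minus []) Empty)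
    have hsc := hW.comp _ _ hs hc
    rw [toHom_comp] at hsc
    convert! hsc using 1
    symm
    -- The dot survives; the two points along which the cap is glued are the ones to be erased.
    let v : Unit → ((Unit ⊕ Empty) ⊕ Empty) ⊕ (Unit ⊕ Unit) := fun _ => .inl (.inl (.inl ()))
    let t : Empty ≃ (Empty ⊕ Empty) ⊕ Empty := Equiv.equivOfIsEmpty _ _
    have hN : ∀ w, Sum.inr w ∉ Set.range v := by rintro w ⟨_, ⟨⟩⟩
    refine toHom_eq_of_rel ⟨{
      v := v
      s := (Equiv.equivOfIsEmpty Empty ((Empty ⊕ Empty) ⊕ Empty))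
      t := t
      v_injective := fun _ _ _ => rfl
      label_v := fun _ => hl.symm
      label_new := ?_
      next_leads := ?_
      new_leads := ?_ }⟩
    · rintro (((_ | ⟨⟨⟩⟩) | ⟨⟨⟩⟩) | (_ | _)) hw
      exacts [(hw ⟨(), rfl⟩).elim, rfl, rfl]
    · rintro (_ | ⟨⟨⟩⟩ | ⟨⟨⟩⟩ | _)
      · exact .of_eq rfl
      · refine Leads.cons (.inr (.inl ())) rfl (hN _) ?_
        refine Leads.cons (.inr (.inr ())) rfl (hN _) ?_
        exact .of_eq rfl
    · rintro (((_ | ⟨⟨⟩⟩) | ⟨⟨⟩⟩) | (_ | _)) hw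
      · exact (hw ⟨(), rfl⟩).elim
      · refine ⟨.bot (), ?_⟩
        refine Leads.cons (.inr (.inl ())) rfl (hN _) ?_
        refine Leads.cons (.inr (.inr ())) rfl (hN _) ?_
        exact .of_eq rfl
      · refine ⟨.bot (), ?_⟩
        refine Leads.cons (.inr (.inr ())) rfl (hN _) ?_
        exact .of_eq rfl

theorem caps (hW : IsGenerated W) {K : Type} [h : Finite K] (l : K → Option A) :
    W (caps l).toHom := by
  refine finite_induction (P := fun K => ∀ (_ : Finite K) (l : K → Option A),
    W (PreCob.caps l).toHom) ?_ ?_ ?_ K h l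
  · intro K L _ _ e ih _ l
    refine hW.of_rel (X' := ⟨L, L⟩) (ih inferInstance (l ∘ e)) e.symm e.symm (Equiv.refl _)
      (Equiv.refl _) (rel_of_iso e (Equiv.refl Empty) (Equiv.refl Empty) (fun x => rfl) ?_)
    rintro (x | ⟨⟨⟩⟩ | ⟨⟨⟩⟩ | _)
    exacts [congrArg Tgt.vert (e.apply_symm_apply x).symm, rfl]
  · intro _ l
    rw [toHom_eq_of_rel (rel_of_iso (F := PreCob.caps l) (G := PreCob.ofEquiv (Equiv.refl _)
      (Equiv.refl _)) (Equiv.refl Empty) (Equiv.refl Empty) (Equiv.refl Empty)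
      (fun x => x.elim) (by rintro (⟨⟨⟩⟩ | ⟨⟨⟩⟩ | ⟨⟨⟩⟩ | ⟨⟨⟩⟩)))]
    exact hW.ofEquiv _ _
  · intro K _ ih _ l
    refine hW.of_rel (hW.sum (ih inferInstance (l ∘ Sum.inl)) (hW.caps_unit (l ∘ Sum.inr)))
      (X' := ⟨K ⊕ Unit, K ⊕ Unit⟩) (Equiv.refl _) (Equiv.refl _)
      (Equiv.emptySum Empty Empty) (Equiv.emptySum Empty Empty)
      (rel_of_iso (Equiv.refl (K ⊕ Unit)) (Equiv.emptySum Empty Empty) (Equiv.emptySum Empty Empty)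
        ?_ ?_)
    · rintro (_ | _) <;> rfl
    · rintro ((_ | _) | ⟨⟨⟩⟩ | (⟨⟨⟩⟩ | ⟨⟨⟩⟩) | (_ | _)) <;> rfl

end IsGenerated

/-! ### Normal form: cups and a permutation below, labelled caps above. -/

namespace PreCob

variable {X Y : Pts A}

/-- The source of the caps in the factorization of `F`. -/
abbrev cutPts (F : PreCob X Y) : Pts A :=
  Y.sum (Pts.sum ⟨X.neg ⊕ F.V, X.neg ⊕ F.V⟩ ⟨F.T, Empty⟩)

/-- The target of the cups in the factorization of `F`. -/
abbrev cutPts' (F : PreCob X Y) : Pts A :=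
  X.sum (Pts.sum ⟨Y.neg ⊕ F.V, Y.neg ⊕ F.V⟩ ⟨F.S, Empty⟩)

/-- The positive part of the permutation in the factorization of `F`. -/
def cutPos (F : PreCob X Y) : F.cutPts'.pos ≃ F.cutPts.pos where
  toFun a :=
    (match F.next (match a with
      | .inl x => .bot x
      | .inr (.inl (.inl x)) => .top x
      | .inr (.inl (.inr x)) => .vert x
      | .inr (.inr x) => .start x) with
    | .top x => .inl x
    | .bot x => .inr (.inl (.inl x))
    | .vert x => .inr (.inl (.inr x))
    | .finish x => .inr (.inr x))
  invFun a :=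
    (match F.next.symm (match a with
      | .inl x => .top x
      | .inr (.inl (.inl x)) => .bot x
      | .inr (.inl (.inr x)) => .vert x
      | .inr (.inr x) => .finish x) with
    | .bot x => .inl x
    | .top x => .inr (.inl (.inl x))
    | .vert x => .inr (.inl (.inr x))
    | .start x => .inr (.inr x))
  left_inv := by
    rintro (a | ((a | a) | a))
    · have h := F.next.symm_apply_apply (.bot a)
      rcases hz : F.next (.bot a) with _ | _ | _ | _ <;> simp [hz] at h ⊢ <;> simp [h]
    · have h := F.next.symm_apply_apply (.top a)
      rcases hz : F.next (.top a) with _ | _ | _ | _ <;> simp [hz] at h ⊢ <;> simp [h]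
    · have h := F.next.symm_apply_apply (.vert a)
      rcases hz : F.next (.vert a) with _ | _ | _ | _ <;> simp [hz] at h ⊢ <;> simp [h]
    · have h := F.next.symm_apply_apply (.start a)
      rcases hz : F.next (.start a) with _ | _ | _ | _ <;> simp [hz] at h ⊢ <;> simp [h]
  right_inv := by
    rintro (a | ((a | a) | a))
    · have h := F.next.apply_symm_apply (.top a)
      rcases hz : F.next.symm (.top a) with _ | _ | _ | _ <;> simp [hz] at h ⊢ <;> simp [h]
    · have h := F.next.apply_symm_apply (.bot a)
      rcases hz : F.next.symm (.bot a) with _ | _ | _ | _ <;> simp [hz] at h ⊢ <;> simp [h]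
    · have h := F.next.apply_symm_apply (.vert a)
      rcases hz : F.next.symm (.vert a) with _ | _ | _ | _ <;> simp [hz] at h ⊢ <;> simp [h]
    · have h := F.next.apply_symm_apply (.finish a)
      rcases hz : F.next.symm (.finish a) with _ | _ | _ | _ <;> simp [hz] at h ⊢ <;> simp [h]

/-- The negative part of the permutation in the factorization of `F`. -/
def cutNeg (F : PreCob X Y) : F.cutPts'.neg ≃ F.cutPts.neg where
  toFun
    | .inl x => .inr (.inl (.inl x))
    | .inr (.inl (.inl x)) => .inl x
    | .inr (.inl (.inr x)) => .inr (.inl (.inr x))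
  invFun
    | .inl x => .inr (.inl (.inl x))
    | .inr (.inl (.inl x)) => .inl x
    | .inr (.inl (.inr x)) => .inr (.inl (.inr x))
  left_inv := by rintro (_ | ((_ | _) | ⟨⟨⟩⟩)) <;> rfl
  right_inv := by rintro (_ | ((_ | _) | ⟨⟨⟩⟩)) <;> rfl

/-- The lower part of the factorization of `F`: cups and half-intervals. -/
def lower (F : PreCob X Y) : PreCob X F.cutPts :=
  ((ofEquiv (Equiv.refl X.pos) (Equiv.refl X.neg)).sum ((cups _).sum (starts F.S))).relabel
    (X' := X) (Y' := F.cutPts)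
    (((Equiv.refl X.pos).sumCongr (Equiv.emptySum Empty Empty)).trans (Equiv.sumEmpty _ _)).symm
    (((Equiv.refl X.neg).sumCongr (Equiv.emptySum Empty Empty)).trans (Equiv.sumEmpty _ _)).symm
    F.cutPos F.cutNeg

/-- The upper part of the factorization of `F`: labelled caps and half-intervals. -/
def upper (F : PreCob X Y) : PreCob F.cutPts Y :=
  ((ofEquiv (Equiv.refl Y.pos) (Equiv.refl Y.neg)).sum
    ((caps (K := X.neg ⊕ F.V) (Sum.elim (fun _ => none) F.label)).sum (finishes F.T))).relabel
    (X' := F.cutPts) (Y' := Y) (Equiv.refl _) (Equiv.refl _)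
    (((Equiv.refl Y.pos).sumCongr (Equiv.emptySum Empty Empty)).trans (Equiv.sumEmpty _ _))
    (((Equiv.refl Y.neg).sumCongr (Equiv.emptySum Empty Empty)).trans (Equiv.sumEmpty _ _))

/-- Every edge is made to cross one middle level upwards, as a positive strand; there `next` is
simply a permutation of points. An edge that starts at the top or at a vertex first comes down a
negative strand and turns at a cup. An edge that ends at the bottom or at a vertex turns at a cap,
and the vertices sit on the caps. Erasing the gluing points and the unlabelled vertices of the caps
over `X.neg` recovers `F`. -/
theorem rel_lower_comp_upper (F : PreCob X Y) : Rel (F.lower.comp F.upper) F := by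
  let v : F.V → (F.lower.comp F.upper).V := fun x => .inl (.inr (.inr (.inl (.inr x))))
  let s : F.S ≃ (F.lower.comp F.upper).S :=
    { toFun := fun x => .inl (.inr (.inr x))
      invFun := fun
        | .inl (.inr (.inr x)) => x
      left_inv := fun _ => rfl
      right_inv := by rintro ((⟨⟨⟩⟩ | (⟨⟨⟩⟩ | _)) | (⟨⟨⟩⟩ | (⟨⟨⟩⟩ | ⟨⟨⟩⟩))); rfl }
  let t : F.T ≃ (F.lower.comp F.upper).T :=
    { toFun := fun x => .inr (.inr (.inr x))
      invFun := fun
        | .inr (.inr (.inr x)) => x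
      left_inv := fun _ => rfl
      right_inv := by rintro ((⟨⟨⟩⟩ | (⟨⟨⟩⟩ | ⟨⟨⟩⟩)) | (⟨⟨⟩⟩ | (⟨⟨⟩⟩ | _))); rfl }
  have hg : ∀ w, Sum.inr w ∉ Set.range v := by rintro w ⟨_, ⟨⟩⟩
  have hc : ∀ w, Sum.inl (.inr (.inr (.inl (.inl w)))) ∉ Set.range v := by rintro w ⟨_, ⟨⟩⟩
  have hbot : ∀ x, (F.lower.comp F.upper).Leads v t (.vert (.inr (.inr (.inr (.inl (.inl x))))))
      (.bot x) := by
    intro x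
    refine Leads.cons _ rfl (hg _) ?_
    exact .of_eq rfl
  have hcap : ∀ x, (F.lower.comp F.upper).Leads v t (.vert (.inl (.inr (.inr (.inl (.inl x))))))
      (.bot x) := by
    intro x
    refine Leads.cons _ rfl (hc _) ?_
    exact hbot x
  -- the edges out of the points along which one glues
  have key : ∀ z : Tgt Y.pos X.neg F.T F.V, (F.lower.comp F.upper).Leads v t
      (.vert (.inr (.inl (match z with
        | .top x => .inl x
        | .bot x => .inr (.inl (.inl x))
        | .vert x => .inr (.inl (.inr x))
        | .finish x => .inr (.inr x))))) z := by
    rintro (x | x | x | x)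
    · refine Leads.cons _ rfl (hg _) ?_
      exact .of_eq rfl
    · refine Leads.cons _ rfl (hg _) ?_
      exact hcap x
    · refine Leads.cons _ rfl (hg _) ?_
      exact .of_eq rfl
    · refine Leads.cons _ rfl (hg _) ?_
      exact .of_eq rfl
  have htop : ∀ x, (F.lower.comp F.upper).Leads v t (.vert (.inr (.inr (.inl x))))
      (F.next (.top x)) := by
    intro x
    refine Leads.cons _ rfl (hg _) ?_
    exact key _
  have hvert : ∀ x, (F.lower.comp F.upper).Leads v t
      (.vert (.inr (.inr (.inr (.inl (.inr x)))))) (F.next (.vert x)) := by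
    intro x
    refine Leads.cons _ rfl (hg _) ?_
    exact key _
  refine ⟨{
    v := v
    s := s
    t := t
    v_injective := fun x y h => Sum.inr_injective (Sum.inl_injective (Sum.inr_injective
      (Sum.inr_injective (Sum.inl_injective h))))
    label_v := fun _ => rfl
    label_new := ?_
    next_leads := ?_
    new_leads := ?_ }⟩
  · rintro (((⟨⟨⟩⟩ | (⟨⟨⟩⟩ | ⟨⟨⟩⟩)) | (⟨⟨⟩⟩ | ((x | x) | ⟨⟨⟩⟩))) | x) hw
    exacts [rfl, (hw ⟨x, rfl⟩).elim, rfl]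
  -- Edges from the bottom and from inner endpoints reach the positive gluing level directly; those
  -- from the top and from vertices arrive at it through a negative strand.
  · rintro (x | x | x | x)
    · exact key (F.next (.bot x))
    · exact htop x
    · exact key (F.next (.start x))
    · exact hvert x
  · rintro (((⟨⟨⟩⟩ | (⟨⟨⟩⟩ | ⟨⟨⟩⟩)) | (⟨⟨⟩⟩ | ((x | x) | ⟨⟨⟩⟩))) | (x | x)) hw
    · exact ⟨_, hcap x⟩
    · exact (hw ⟨x, rfl⟩).elim
    · rcases x with (x | ((x | x) | x))
      exacts [⟨_, key (.top x)⟩, ⟨_, key (.bot x)⟩, ⟨_, key (.vert x)⟩, ⟨_, key (.finish x)⟩]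
    · rcases x with (x | ((x | x) | ⟨⟨⟩⟩))
      exacts [⟨_, htop x⟩, ⟨_, hbot x⟩, ⟨_, hvert x⟩]

end PreCob

/-- Every cobordism is composed from permutations and disjoint unions of the generators. -/
theorem IsGenerated.all {W : MorphismProperty (Pts A)} (hW : IsGenerated W) {X Y : Pts A}
    (f : X ⟶ Y) : W f := by
  obtain ⟨F⟩ := f
  change W F.toHom
  rw [← PreCob.toHom_eq_of_rel F.rel_lower_comp_upper, ← PreCob.toHom_comp]
  exact hW.comp _ _
    (hW.relabel (hW.sum (hW.ofEquiv _ _) (hW.sum (hW.cups _) (hW.starts _))) _ _ _ _)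
    (hW.relabel (hW.sum (hW.ofEquiv _ _) (hW.sum (hW.caps _) (hW.finishes _))) _ _ _ _)

/-! ### Positions in concatenated sign sequences. -/

namespace Pos

theorem append_inl (l m : List Sgn) {s : Sgn} (i : Pos s l) : append l m (.inl i) = inl m i := rfl

theorem append_inr (l m : List Sgn) {s : Sgn} (i : Pos s m) : append l m (.inr i) = inr l i := rfl

theorem append_symm_inl (l m : List Sgn) {s : Sgn} (i : Pos s l) :
    (append l m).symm (inl m i) = .inl i := (append l m).symm_apply_apply (.inl i)

theorem append_symm_inr (l m : List Sgn) {s : Sgn} (i : Pos s m) :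
    (append l m).symm (inr l i) = .inr i := (append l m).symm_apply_apply (.inr i)

/-- A position of a concatenation belongs to one of the two parts. -/
theorem append_cases {l m : List Sgn} {s : Sgn} {P : Pos s (l ++ m) → Prop}
    (hl : ∀ i, P (inl m i)) (hr : ∀ i, P (inr l i)) (i : Pos s (l ++ m)) : P i := by
  obtain ⟨i | i, rfl⟩ := (append l m).surjective i
  exacts [hl i, hr i]

/-- A sign sequence can be split at each of its positions. -/
theorem exists_eq_append {s : Sgn} {l : List Sgn} (i : Pos s l) :
    ∃ a b, ∃ h : l = a ++ s :: b, i = h ▸ inr a (.head b) := by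
  induction i with
  | head l => exact ⟨[], l, rfl, rfl⟩
  | tail t i ih =>
    obtain ⟨a, b, rfl, rfl⟩ := ih
    exact ⟨t :: a, b, rfl, rfl⟩

theorem tail_injective {s t : Sgn} {l : List Sgn} :
    Function.Injective (tail (s := s) (l := l) t) := by
  rintro i j h
  cases h
  rfl

/-- Sign preserving bijections which preserve the first position come from sign preserving
bijections of the remaining positions. -/
theorem exists_tail_equiv {s : Sgn} {l m : List Sgn} (e : ∀ t, Pos t (s :: l) ≃ Pos t (s :: m))
    (he : e s (.head l) = .head m) :
    ∃ e' : ∀ t, Pos t l ≃ Pos t m, ∀ t i, e t (.tail s i) = .tail s (e' t i) := by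
  have he' : (e s).symm (.head m) = .head l := by rw [← he, Equiv.symm_apply_apply]
  have h : ∀ t (i : Pos t l), ∃ j, e t (.tail s i) = .tail s j := by
    intro t i
    generalize hj : e t (.tail s i) = j
    cases j with
    | head => rw [← he] at hj; exact nomatch (e _).injective hj
    | tail _ j => exact ⟨j, rfl⟩
  have h' : ∀ t (i : Pos t m), ∃ j, (e t).symm (.tail s i) = .tail s j := by
    intro t i
    generalize hj : (e t).symm (.tail s i) = j
    cases j with
    | head => rw [← he'] at hj; exact nomatch (e _).symm.injective hj
    | tail _ j => exact ⟨j, rfl⟩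
  choose f hf using h
  choose g hg using h'
  refine ⟨fun t => ⟨f t, g t, fun i => ?_, fun i => ?_⟩, hf⟩
  · have := hg t (f t i)
    rw [← hf, Equiv.symm_apply_apply] at this
    exact (tail_injective this).symm
  · have := hf t (g t i)
    rw [← hg, Equiv.apply_symm_apply] at this
    exact (tail_injective this).symm

/-- The bijection of positions which underlies the associator. -/
def assoc (s : Sgn) (l m n : List Sgn) : Pos s ((l ++ m) ++ n) ≃ Pos s (l ++ (m ++ n)) :=
  ((append (l ++ m) n).symm.trans ((append l m).symm.sumCongr (Equiv.refl _))).trans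
    ((Equiv.sumAssoc _ _ _).trans (((Equiv.refl _).sumCongr (append m n)).trans
      (append l (m ++ n))))

theorem assoc_inl_inl {s : Sgn} {l m n : List Sgn} (i : Pos s l) :
    assoc s l m n (inl n (inl m i)) = inl (m ++ n) i := by
  simp [assoc, append_symm_inl, append_inl]

theorem assoc_inl_inr {s : Sgn} {l m n : List Sgn} (i : Pos s m) :
    assoc s l m n (inl n (inr l i)) = inr l (inl n i) := by
  simp [assoc, append_symm_inl, append_symm_inr, append_inl, append_inr]

theorem assoc_inr {s : Sgn} {l m n : List Sgn} (i : Pos s n) :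
    assoc s l m n (inr (l ++ m) i) = inr l (inr m i) := by
  simp [assoc, append_symm_inr, append_inr]

end Pos

/-! ### Permutations of sign sequences, and generation of `Cob A`. -/

namespace Cob

open Pts

theorem hom_comp {x y z : Cob A} (f : x ⟶ y) (g : y ⟶ z) : (f ≫ g).hom = f.hom ≫ g.hom := rfl

theorem hom_tensorHom {x y x' y' : Cob A} (f : x ⟶ y) (g : x' ⟶ y') :
    (f ⊗ₘ g).hom = (sumIso x x').inv ≫ Pts.tensorHom f.hom g.hom ≫ (sumIso y y').hom := rfl

/-- The morphism of sign sequences given by sign preserving bijections of positions. -/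
def perm {x y : Cob A} (e : ∀ s, Pos s x.signs ≃ Pos s y.signs) : x ⟶ y :=
  ⟨(isoOfEquiv (X := x.toPts) (Y := y.toPts) (e .plus) (e .minus)).hom⟩

theorem perm_comp {x y z : Cob A} (e : ∀ s, Pos s x.signs ≃ Pos s y.signs)
    (f : ∀ s, Pos s y.signs ≃ Pos s z.signs) :
    perm e ≫ perm f = perm fun s => (e s).trans (f s) :=
  InducedCategory.hom_ext (isoOfEquiv_comp _ _ _ _)

/-- Being the permutation given by `e`. -/
def IsPerm {x y : Cob A} (f : x ⟶ y) (e : ∀ s, Pos s x.signs ≃ Pos s y.signs) : Prop :=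
  Pts.IsPerm (X := x.toPts) (Y := y.toPts) f.hom (e .plus) (e .minus)

theorem IsPerm.eq_perm {x y : Cob A} {f : x ⟶ y} {e e' : ∀ s, Pos s x.signs ≃ Pos s y.signs}
    (h : IsPerm f e) (he : ∀ s i, e s i = e' s i) : f = perm e' :=
  InducedCategory.hom_ext (Pts.IsPerm.eq h (Pts.IsPerm.iso _ _) (he _) (he _))

/-- The structure morphisms of sign sequences are composites of permutation cobordisms, so the
underlying bijection can be read off factor by factor. Equalities between them then become pointwise
statements about positions. -/
theorem isPerm_whiskerLeft (x : Cob A) {y z : Cob A} (e : ∀ s, Pos s y.signs ≃ Pos s z.signs) :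
    IsPerm (x ◁ perm e) fun s => (Pos.append x.signs y.signs).symm.trans
      (((Equiv.refl _).sumCongr (e s)).trans (Pos.append x.signs z.signs)) :=
  (Pts.IsPerm.iso _ _).comp ((Pts.IsPerm.tensor (Pts.IsPerm.id _) (Pts.IsPerm.iso _ _)).comp
    (Pts.IsPerm.iso _ _))

theorem isPerm_whiskerRight {y z : Cob A} (e : ∀ s, Pos s y.signs ≃ Pos s z.signs) (x : Cob A) :
    IsPerm (perm e ▷ x) fun s => (Pos.append y.signs x.signs).symm.trans
      (((e s).sumCongr (Equiv.refl _)).trans (Pos.append z.signs x.signs)) :=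
  (Pts.IsPerm.iso _ _).comp ((Pts.IsPerm.tensor (Pts.IsPerm.iso _ _) (Pts.IsPerm.id _)).comp
    (Pts.IsPerm.iso _ _))

theorem isPerm_braiding (x y : Cob A) : IsPerm (β_ x y).hom fun _ =>
    (Pos.append x.signs y.signs).symm.trans
      ((Equiv.sumComm _ _).trans (Pos.append y.signs x.signs)) :=
  (Pts.IsPerm.iso _ _).comp ((Pts.IsPerm.iso _ _).comp (Pts.IsPerm.iso _ _))

theorem isPerm_associator (x y z : Cob A) :
    IsPerm (α_ x y z).hom fun s => Pos.assoc s x.signs y.signs z.signs :=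
  ((Pts.IsPerm.iso _ _).comp (Pts.IsPerm.tensor (Pts.IsPerm.iso _ _) (Pts.IsPerm.id _))).comp
    ((Pts.IsPerm.iso _ _).comp
      ((Pts.IsPerm.tensor (Pts.IsPerm.id _) (Pts.IsPerm.iso _ _)).comp (Pts.IsPerm.iso _ _)))

theorem isPerm_rightUnitor (x : Cob A) : IsPerm (ρ_ x).hom fun _ =>
    ((Pos.append x.signs []).symm.trans
      ((Equiv.refl _).sumCongr (Equiv.equivOfIsEmpty _ _))).trans (Equiv.sumEmpty _ Empty) :=
  ((Pts.IsPerm.iso _ _).comp (Pts.IsPerm.tensor (Pts.IsPerm.id _) (Pts.IsPerm.iso _ _))).comp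
    (Pts.IsPerm.iso _ _)

theorem isPerm_leftUnitor (x : Cob A) : IsPerm (λ_ x).hom fun _ =>
    ((Pos.append [] x.signs).symm.trans
      ((Equiv.equivOfIsEmpty _ _).sumCongr (Equiv.refl _))).trans (Equiv.emptySum Empty _) :=
  ((Pts.IsPerm.iso _ _).comp (Pts.IsPerm.tensor (Pts.IsPerm.iso _ _) (Pts.IsPerm.id _))).comp
    (Pts.IsPerm.iso _ _)

/-- With a single sign in front, both bracketings compute to the same list, so the identity is a
morphism of the right type. This case suffices for inductions that add one sign at a time. -/
theorem associator_cons (s : Sgn) (l m : List Sgn) :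
    (α_ (⟨[s]⟩ : Cob A) ⟨l⟩ ⟨m⟩).hom = 𝟙 (⟨s :: (l ++ m)⟩ : Cob A) := by
  refine (isPerm_associator _ _ _).eq_perm (e' := fun _ => Equiv.refl _) fun t => ?_
  refine Pos.append_cases (l := [s] ++ l) ?_ fun i => Pos.assoc_inr (l := [s]) i
  refine Pos.append_cases (fun i => ?_) fun i => Pos.assoc_inl_inr (l := [s]) i
  refine (Pos.assoc_inl_inl i).trans ?_
  rcases i with _ | ⟨_, ⟨⟩⟩
  rfl

theorem rightUnitor_singleton (s : Sgn) :
    (ρ_ (⟨[s]⟩ : Cob A)).hom = 𝟙 (⟨[s]⟩ : Cob A) := by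
  refine (isPerm_rightUnitor _).eq_perm (e' := fun _ => Equiv.refl _) fun t => ?_
  rintro (_ | ⟨_, ⟨⟩⟩)
  rfl

theorem leftUnitor_eq (x : Cob A) : (λ_ x).hom = 𝟙 x := by
  refine (isPerm_leftUnitor x).eq_perm (e' := fun _ => Equiv.refl _) fun t => ?_
  intro i
  rfl

/-- Moving the first sign past `a`. -/
def moveHead (s : Sgn) (a b : List Sgn) : (⟨s :: (a ++ b)⟩ : Cob A) ⟶ ⟨a ++ s :: b⟩ :=
  ((β_ (⟨[s]⟩ : Cob A) ⟨a⟩).hom ▷ (⟨b⟩ : Cob A)) ≫ (α_ (⟨a⟩ : Cob A) ⟨[s]⟩ ⟨b⟩).hom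

/-- All that is needed of this bijection is where the first position goes: undoing the move then
makes any bijection with the same value there fix the head. -/
theorem exists_moveHead_eq_perm (s : Sgn) (a b : List Sgn) :
    ∃ e : ∀ t, Pos t (s :: (a ++ b)) ≃ Pos t (a ++ s :: b),
      moveHead (A := A) s a b = perm e ∧ e s (.head _) = Pos.inr a (.head b) := by
  have h1 : (β_ (⟨[s]⟩ : Cob A) ⟨a⟩).hom = perm _ :=
    (isPerm_braiding _ _).eq_perm fun _ _ => rfl
  have h2 : (α_ (⟨a⟩ : Cob A) ⟨[s]⟩ ⟨b⟩).hom = perm _ :=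
    (isPerm_associator _ _ _).eq_perm fun _ _ => rfl
  have h3 := (isPerm_whiskerRight (fun t => (Pos.append [s] a).symm.trans
      ((Equiv.sumComm _ _).trans (Pos.append (s := t) a [s]))) (⟨b⟩ : Cob A)).eq_perm
      fun _ _ => rfl
  refine ⟨_, (congrArg₂ _ ((congrArg (· ▷ _) h1).trans h3) h2).trans (perm_comp _ _), ?_⟩
  exact Pos.assoc_inl_inr (l := a) (m := [s]) (n := b) (.head [])

/-- Permutations are composed from braidings. -/
theorem perm_mem {W : MorphismProperty (Cob A)} (id : ∀ x, W (𝟙 x))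
    (comp : ∀ {x y z : Cob A} (f : x ⟶ y) (g : y ⟶ z), W f → W g → W (f ≫ g))
    (whiskerLeft : ∀ (x : Cob A) {y z : Cob A} (f : y ⟶ z), W f → W (x ◁ f))
    (whiskerRight : ∀ {y z : Cob A} (f : y ⟶ z) (x : Cob A), W f → W (f ▷ x))
    (braiding : ∀ x y : Cob A, W (β_ x y).hom) (associator : ∀ x y z : Cob A, W (α_ x y z).hom)
    {x y : Cob A} (e : ∀ s, Pos s x.signs ≃ Pos s y.signs) : W (perm e) := by
  obtain ⟨l⟩ := x
  obtain ⟨m⟩ := y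
  induction l generalizing m with
  | nil =>
    rcases m with _ | ⟨s, m⟩
    · have : perm e = 𝟙 (⟨[]⟩ : Cob A) :=
        InducedCategory.hom_ext (Pts.IsPerm.eq (Pts.IsPerm.iso _ _) (Pts.IsPerm.id _)
          (fun i => nomatch i) (fun i => nomatch i))
      rw [this]
      exact id _
    · exact nomatch (e s).symm (.head m)
  | cons s l ih =>
    change ∀ t, Pos t (s :: l) ≃ Pos t m at e
    -- The target is split at the image of the first position.
    obtain ⟨a, b, rfl, hi⟩ := Pos.exists_eq_append (e s (.head l))
    obtain ⟨f, hf, hf'⟩ := exists_moveHead_eq_perm (A := A) s a b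
    -- After the move is undone the first position is fixed, so a bijection `g` of the remaining
    -- positions is left for the induction hypothesis.
    obtain ⟨g, hg⟩ := Pos.exists_tail_equiv (l := l) (m := a ++ b) (fun t => (e t).trans (f t).symm)
      (by simp only [Equiv.trans_apply]; rw [hi, Equiv.symm_apply_eq, hf'])
    have h1 : (⟨[s]⟩ : Cob A) ◁ perm (x := ⟨l⟩) (y := ⟨a ++ b⟩) g =
        perm (x := ⟨s :: l⟩) (y := ⟨s :: (a ++ b)⟩) fun t => (e t).trans (f t).symm := by
      refine (isPerm_whiskerLeft _ _).eq_perm fun t => ?_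
      refine Pos.append_cases (l := [s]) (fun i => ?_) fun i => ?_
      · rcases i with _ | ⟨_, ⟨⟩⟩
        change Pos.head (a ++ b) = (f s).symm (e s (.head l))
        rw [hi, Equiv.eq_symm_apply, hf']
      · exact (hg t i).symm
    have h2 : perm e = (⟨[s]⟩ : Cob A) ◁ perm (x := ⟨l⟩) (y := ⟨a ++ b⟩) g ≫ moveHead s a b := by
      rw [h1, hf]
      refine Eq.trans ?_ (perm_comp _ _).symm
      congr 1
      funext t
      ext i
      simp
    rw [h2]
    exact comp _ _ (whiskerLeft _ _ (ih _ g)) (comp _ _ (whiskerRight _ _ (braiding _ _))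
      (associator _ _ _))

/-- A constant sequence. The absence of the other sign lets a constant `+` sequence and a constant
`-` sequence be concatenated without interfering. -/
theorem exists_signs_equiv_single (s t : Sgn) (hst : s ≠ t) (K : Type) [Finite K] :
    ∃ l, Nonempty (Pos s l ≃ K) ∧ IsEmpty (Pos t l) := by
  induction K using finite_induction with
  | equiv e h =>
    obtain ⟨l, ⟨f⟩, h⟩ := h
    exact ⟨l, ⟨f.trans e⟩, h⟩
  | empty => exact ⟨[], ⟨Equiv.equivOfIsEmpty _ _⟩, inferInstance⟩
  | sum_unit h =>
    obtain ⟨l, ⟨f⟩, h⟩ := h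
    refine ⟨[s] ++ l, ⟨(Pos.append _ _).symm.trans (((Pos.equivUnit s).sumCongr f).trans
      (Equiv.sumComm _ _))⟩, ⟨?_⟩⟩
    rintro (_ | ⟨_, i⟩)
    exacts [hst rfl, h.elim i]

/-- Every `0`-manifold is isomorphic to the one of a sign sequence. -/
theorem exists_signs_equiv (X : Pts A) :
    ∃ x : Cob A, Nonempty (Pos .plus x.signs ≃ X.pos) ∧ Nonempty (Pos .minus x.signs ≃ X.neg) := by
  obtain ⟨l, ⟨f⟩, h⟩ := exists_signs_equiv_single .plus .minus nofun X.pos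
  obtain ⟨m, ⟨g⟩, h'⟩ := exists_signs_equiv_single .minus .plus nofun X.neg
  exact ⟨⟨l ++ m⟩, ⟨(Pos.append _ _).symm.trans ((Equiv.sumEmpty _ _).trans f)⟩,
    ⟨(Pos.append _ _).symm.trans ((Equiv.emptySum _ _).trans g)⟩⟩

/-- The morphism of sign sequences obtained from a cobordism between `0`-manifolds which are
identified with the ones of the sign sequences. -/
def conj {x y : Cob A} {X Y : Pts A} (p : Pos .plus x.signs ≃ X.pos)
  (n : Pos .minus x.signs ≃ X.neg)
    (f : X ⟶ Y) (p' : Pos .plus y.signs ≃ Y.pos) (n' : Pos .minus y.signs ≃ Y.neg) : x ⟶ y :=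
  ⟨(isoOfEquiv (X := x.toPts) p n).hom ≫ f ≫ (isoOfEquiv (Y := y.toPts) p'.symm n'.symm).hom⟩

theorem conj_comp {x y z : Cob A} {X Y Z : Pts A} (p : Pos .plus x.signs ≃ X.pos)
    (n : Pos .minus x.signs ≃ X.neg) (f : X ⟶ Y) (p' : Pos .plus y.signs ≃ Y.pos)
    (n' : Pos .minus y.signs ≃ Y.neg) (g : Y ⟶ Z) (p'' : Pos .plus z.signs ≃ Z.pos)
    (n'' : Pos .minus z.signs ≃ Z.neg) :
    conj p n (f ≫ g) p'' n'' = conj p n f p' n' ≫ conj p' n' g p'' n'' := by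
  refine InducedCategory.hom_ext ?_
  have h : (isoOfEquiv (Y := y.toPts) p'.symm n'.symm).hom ≫ (isoOfEquiv p' n').hom = 𝟙 Y :=
    (isoOfEquiv (X := y.toPts) p' n').inv_hom_id
  simp only [conj, hom_comp, Category.assoc, reassoc_of% h]

theorem sumIso_hom (x y : Cob A) : (sumIso x y).hom =
    (isoOfEquiv (X := x.toPts.sum y.toPts) (Y := toPts ⟨x.signs ++ y.signs⟩)
      (Pos.append _ _) (Pos.append _ _)).hom := rfl

theorem sumIso_inv (x y : Cob A) : (sumIso x y).inv =
    (isoOfEquiv (X := toPts ⟨x.signs ++ y.signs⟩) (Y := x.toPts.sum y.toPts)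
      (Pos.append _ _).symm (Pos.append _ _).symm).hom := rfl

/-- The sign sequences `x` and `y` may interleave the points of the two parts. Permutations first
sort them into a concatenation; between these permutations the disjoint union is a tensor product of
sign sequences. -/
theorem conj_tensor {x y x₁ y₁ x₂ y₂ : Cob A} {X Y X' Y' : Pts A}
    (p : Pos .plus x.signs ≃ X.pos ⊕ X'.pos) (n : Pos .minus x.signs ≃ X.neg ⊕ X'.neg)
    (f : X ⟶ Y) (g : X' ⟶ Y')
    (p' : Pos .plus y.signs ≃ Y.pos ⊕ Y'.pos) (n' : Pos .minus y.signs ≃ Y.neg ⊕ Y'.neg)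
    (q₁ : Pos .plus x₁.signs ≃ X.pos) (r₁ : Pos .minus x₁.signs ≃ X.neg)
    (q₂ : Pos .plus x₂.signs ≃ X'.pos) (r₂ : Pos .minus x₂.signs ≃ X'.neg)
    (s₁ : Pos .plus y₁.signs ≃ Y.pos) (t₁ : Pos .minus y₁.signs ≃ Y.neg)
    (s₂ : Pos .plus y₂.signs ≃ Y'.pos) (t₂ : Pos .minus y₂.signs ≃ Y'.neg) :
    conj (X := X.sum X') (Y := Y.sum Y') p n (Pts.tensorHom f g) p' n' =
      conj (X := toPts ⟨x₁.signs ++ x₂.signs⟩) (Y := toPts ⟨y₁.signs ++ y₂.signs⟩)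
        (p.trans ((q₁.sumCongr q₂).symm.trans (Pos.append _ _)))
        (n.trans ((r₁.sumCongr r₂).symm.trans (Pos.append _ _)))
        (conj q₁ r₁ f s₁ t₁ ⊗ₘ conj q₂ r₂ g s₂ t₂).hom
        (p'.trans ((s₁.sumCongr s₂).symm.trans (Pos.append _ _)))
        (n'.trans ((t₁.sumCongr t₂).symm.trans (Pos.append _ _))) := by
  refine InducedCategory.hom_ext ?_
  simp only [conj, hom_tensorHom, ← tensorHom_comp, isoOfEquiv_tensor, Category.assoc, sumIso_hom,
    sumIso_inv]
  rw [← Category.assoc (isoOfEquiv (X := x.toPts) (Y := toPts ⟨x₁.signs ++ x₂.signs⟩) _ _).hom,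
    ← Category.assoc (_ ≫ _), isoOfEquiv_comp, isoOfEquiv_comp, isoOfEquiv_comp, isoOfEquiv_comp]
  congr 2
  · congr 2 <;> refine Equiv.ext fun i => ?_ <;>
      simp only [Equiv.trans_apply, Equiv.symm_apply_apply, Equiv.apply_symm_apply]
  · congr 2 <;> refine Equiv.ext fun i => ?_ <;> simp

theorem conj_isoOfEquiv {x y : Cob A} {X Y : Pts A} (p : Pos .plus x.signs ≃ X.pos)
    (n : Pos .minus x.signs ≃ X.neg) (q : X.pos ≃ Y.pos) (r : X.neg ≃ Y.neg)
    (p' : Pos .plus y.signs ≃ Y.pos) (n' : Pos .minus y.signs ≃ Y.neg) :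
    conj p n (isoOfEquiv q r).hom p' n' = perm fun
      | .plus => p.trans (q.trans p'.symm)
      | .minus => n.trans (r.trans n'.symm) :=
  InducedCategory.hom_ext (by simp only [conj, perm, isoOfEquiv_comp])

theorem conj_hom {x y x' y' : Cob A} (p : Pos .plus x.signs ≃ Pos .plus x'.signs)
    (n : Pos .minus x.signs ≃ Pos .minus x'.signs) (f : x' ⟶ y')
    (p' : Pos .plus y.signs ≃ Pos .plus y'.signs) (n' : Pos .minus y.signs ≃ Pos .minus y'.signs) :
    conj (X := x'.toPts) (Y := y'.toPts) p n f.hom p' n' =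
      perm (fun | .plus => p | .minus => n) ≫ f ≫ perm fun | .plus => p'.symm | .minus => n'.symm :=
  rfl

/-- A property of morphisms of the symmetric monoidal category of sign sequences holds for all
morphisms if it is closed under the operations and holds for the generators. -/
theorem generated {W : MorphismProperty (Cob A)} (id : ∀ x, W (𝟙 x))
    (comp : ∀ {x y z : Cob A} (f : x ⟶ y) (g : y ⟶ z), W f → W g → W (f ≫ g))
    (tensor : ∀ {x y x' y' : Cob A} (f : x ⟶ y) (g : x' ⟶ y'), W f → W g → W (f ⊗ₘ g))
    (braiding : ∀ x y : Cob A, W (β_ x y).hom) (associator : ∀ x y z : Cob A, W (α_ x y z).hom)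
    (h_dotPlus : ∀ a, W (dotPlus a)) (h_cup : W cup) (h_cap : W cap)
    (h_halfTopPlus : W halfTopPlus) (h_halfBotPlus : W halfBotPlus) {x y : Cob A} (f : x ⟶ y) :
    W f := by
  have hperm : ∀ {x y : Cob A} (e : ∀ s, Pos s x.signs ≃ Pos s y.signs), W (perm e) := by
    refine fun e => perm_mem id comp (fun x y z f hf => ?_) (fun f x hf => ?_) braiding associator e
    · rw [← id_tensorHom]; exact tensor _ _ (id _) hf
    · rw [← tensorHom_id]; exact tensor _ _ hf (id _)
  -- Asking for every identification of the boundary with sign sequences makes `W'` contain all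
  -- permutations and be closed under gluing, where an intermediate sequence may be chosen freely.
  let W' : MorphismProperty (Pts A) := fun X Y f => ∀ (x y : Cob A) (p : Pos .plus x.signs ≃ X.pos)
    (n : Pos .minus x.signs ≃ X.neg) (p' : Pos .plus y.signs ≃ Y.pos)
    (n' : Pos .minus y.signs ≃ Y.neg), W (conj p n f p' n')
  have hincl : ∀ {x y : Cob A} (f : x ⟶ y), W f → W' f.hom := fun f hf x y p n p' n' => by
    rw [conj_hom]
    exact comp _ _ (hperm _) (comp _ _ hf (hperm _))
  have hW' : IsGenerated W' :=
    { comp := by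
        intro X Y Z f g hf hg x z p n p' n'
        obtain ⟨y, ⟨q⟩, ⟨r⟩⟩ := exists_signs_equiv Y
        rw [conj_comp p n f q r]
        exact comp _ _ (hf x y p n q r) (hg y z q r p' n')
      tensor := by
        intro X Y X' Y' f g hf hg x y p n p' n'
        obtain ⟨x₁, ⟨q₁⟩, ⟨r₁⟩⟩ := exists_signs_equiv X
        obtain ⟨x₂, ⟨q₂⟩, ⟨r₂⟩⟩ := exists_signs_equiv X'
        obtain ⟨y₁, ⟨s₁⟩, ⟨t₁⟩⟩ := exists_signs_equiv Y
        obtain ⟨y₂, ⟨s₂⟩, ⟨t₂⟩⟩ := exists_signs_equiv Y'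
        rw [conj_tensor p n f g p' n' q₁ r₁ q₂ r₂ s₁ t₁ s₂ t₂, conj_hom]
        exact comp _ _ (hperm _) (comp _ _ (tensor _ _ (hf _ _ _ _ _ _) (hg _ _ _ _ _ _)) (hperm _))
      perm := by
        intro X Y q r x y p n p' n'
        rw [conj_isoOfEquiv]
        exact hperm _
      dotPlus := fun a => hincl _ (h_dotPlus a)
      cup := hincl _ h_cup
      cap := hincl _ h_cap
      halfTopPlus := hincl _ h_halfTopPlus
      halfBotPlus := hincl _ h_halfBotPlus }
  have h := hW'.all f.hom x y (Equiv.refl _) (Equiv.refl _) (Equiv.refl _) (Equiv.refl _)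
  -- A morphism of sign sequences is its own conjugate by identities.
  have h' : f = conj (X := x.toPts) (Y := y.toPts) (Equiv.refl _) (Equiv.refl _) f.hom
      (Equiv.refl _) (Equiv.refl _) :=
    InducedCategory.hom_ext ((Category.id_comp _).symm.trans
      (congrArg (_ ≫ ·) (Category.comp_id _).symm))
  rw [h']
  exact h

end Cob

/-! ### Isomorphisms of functors on cobordisms -/

universe v w

open Functor.LaxMonoidal (ε μ)
open Functor.OplaxMonoidal (η δ)

/-- Isomorphisms between the values of two functors at `+` and `-` which are compatible with the
generators of the category of cobordisms. -/
structure PointIso {D : Type v} [Category.{w} D] [MonoidalCategory D]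
    (F G : Cob A ⥤ D) [F.Monoidal] [G.Monoidal] where
  iso : ∀ s : Sgn, F.obj ⟨[s]⟩ ≅ G.obj ⟨[s]⟩
  dotPlus : ∀ a, F.map (Cob.dotPlus a) ≫ (iso .plus).hom = (iso .plus).hom ≫ G.map (Cob.dotPlus a)
  cup : ε F ≫ F.map Cob.cup ≫ δ F Cob.plus Cob.minus ≫ ((iso .plus).hom ⊗ₘ (iso .minus).hom) =
    ε G ≫ G.map Cob.cup ≫ δ G Cob.plus Cob.minus
  cap : ((iso .minus).hom ⊗ₘ (iso .plus).hom) ≫ μ G Cob.minus Cob.plus ≫ G.map Cob.cap ≫ η G =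
    μ F Cob.minus Cob.plus ≫ F.map Cob.cap ≫ η F
  halfTopPlus : ε F ≫ F.map Cob.halfTopPlus ≫ (iso .plus).hom = ε G ≫ G.map Cob.halfTopPlus
  halfBotPlus : (iso .plus).hom ≫ G.map Cob.halfBotPlus ≫ η G = F.map Cob.halfBotPlus ≫ η F

namespace PointIso

variable {D : Type v} [Category.{w} D] [MonoidalCategory D]
  {F G : Cob A ⥤ D}

section Monoidal

variable [F.Monoidal] [G.Monoidal] (e : PointIso F G)

/-- The isomorphism at a sign sequence. -/
def app : ∀ l : List Sgn, F.obj ⟨l⟩ ≅ G.obj ⟨l⟩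
  | [] => (Functor.Monoidal.εIso F).symm ≪≫ Functor.Monoidal.εIso G
  | s :: l => (Functor.Monoidal.μIso F ⟨[s]⟩ ⟨l⟩).symm ≪≫ (e.iso s ⊗ᵢ app l) ≪≫
      Functor.Monoidal.μIso G ⟨[s]⟩ ⟨l⟩

theorem app_unit : ε F ≫ (e.app []).hom = ε G := by
  simp [app]

theorem μ_app_cons (s : Sgn) (l : List Sgn) :
    μ F ⟨[s]⟩ ⟨l⟩ ≫ (e.app (s :: l)).hom = ((e.iso s).hom ⊗ₘ (e.app l).hom) ≫ μ G ⟨[s]⟩ ⟨l⟩ := by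
  simp only [app, Iso.trans_hom, Iso.symm_hom, Functor.Monoidal.μIso_inv, tensorIso_hom,
    Functor.Monoidal.μIso_hom]
  exact Functor.Monoidal.μ_δ_assoc _ _ _ _

/-- The left unitor of sign sequences is an identity, so left unitality determines this tensorator
outright. -/
theorem μ_unit (F : Cob A ⥤ D) [F.Monoidal] (y : Cob A) :
    μ F (𝟙_ (Cob A)) y = η F ▷ F.obj y ≫ (λ_ (F.obj y)).hom := by
  have h : μ F (𝟙_ (Cob A)) y ≫ F.map (λ_ y).hom = μ F (𝟙_ (Cob A)) y := by
    rw [Cob.leftUnitor_eq]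
    exact (congrArg (_ ≫ ·) (F.map_id y)).trans (Category.comp_id _)
  rw [Functor.LaxMonoidal.left_unitality, Functor.Monoidal.whiskerRight_η_ε_assoc, h]

theorem μ_cons (F : Cob A ⥤ D) [F.Monoidal] (s : Sgn) (l m : List Sgn) :
    μ F ⟨[s]⟩ ⟨l⟩ ▷ F.obj ⟨m⟩ ≫ μ F ⟨s :: l⟩ ⟨m⟩ =
      (α_ (F.obj ⟨[s]⟩) (F.obj ⟨l⟩) (F.obj ⟨m⟩)).hom ≫ F.obj ⟨[s]⟩ ◁ μ F ⟨l⟩ ⟨m⟩ ≫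
        μ F ⟨[s]⟩ ⟨l ++ m⟩ := by
  have h := Functor.LaxMonoidal.associativity F ⟨[s]⟩ ⟨l⟩ ⟨m⟩
  rw [Cob.associator_cons] at h
  refine Eq.trans ?_ h
  exact congrArg (_ ≫ ·) ((Category.comp_id _).symm.trans (congrArg (_ ≫ ·) (F.map_id _).symm))

/-- Induction on `l`. The isomorphism at a sequence is built by splitting off the first sign, and
`μ_cons` moves that sign out of the concatenation on both sides. -/
theorem μ_app (l m : List Sgn) :
    μ F ⟨l⟩ ⟨m⟩ ≫ (e.app (l ++ m)).hom = ((e.app l).hom ⊗ₘ (e.app m).hom) ≫ μ G ⟨l⟩ ⟨m⟩ := by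
  induction l with
  | nil =>
    change μ F (𝟙_ (Cob A)) ⟨m⟩ ≫ (e.app m).hom = _ ≫ μ G (𝟙_ (Cob A)) ⟨m⟩
    rw [μ_unit, μ_unit]
    simp only [app, Iso.trans_hom, Iso.symm_hom, Functor.Monoidal.εIso_inv,
      Functor.Monoidal.εIso_hom, MonoidalCategory.tensorHom_def, comp_whiskerRight, Category.assoc,
      whisker_exchange_assoc]
    rw [Functor.Monoidal.whiskerRight_ε_η_assoc]
    exact congrArg (_ ≫ ·) (MonoidalCategory.leftUnitor_naturality _).symm
  | cons s l ih =>
    -- Precomposing with an invertible tensorator separates the first sign from `l`.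
    rw [← cancel_epi (μ F ⟨[s]⟩ ⟨l⟩ ▷ F.obj ⟨m⟩)]
    change _ ≫ μ F ⟨s :: l⟩ ⟨m⟩ ≫ (e.app (s :: (l ++ m))).hom = _ ≫ _ ≫ μ G ⟨s :: l⟩ ⟨m⟩
    have h1 : μ F ⟨[s]⟩ ⟨l⟩ ▷ F.obj ⟨m⟩ ≫ μ F ⟨s :: l⟩ ⟨m⟩ ≫ (e.app (s :: (l ++ m))).hom =
        (α_ (F.obj ⟨[s]⟩) (F.obj ⟨l⟩) (F.obj ⟨m⟩)).hom ≫
          ((e.iso s).hom ⊗ₘ (μ F ⟨l⟩ ⟨m⟩ ≫ (e.app (l ++ m)).hom)) ≫ μ G ⟨[s]⟩ ⟨l ++ m⟩ := by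
      refine (Category.assoc _ _ _).symm.trans ((congrArg (· ≫ _) (μ_cons F s l m)).trans ?_)
      simp only [Category.assoc]
      refine congrArg (_ ≫ ·) ((congrArg (_ ≫ ·) (e.μ_app_cons s (l ++ m))).trans ?_)
      simp only [← id_tensorHom, tensorHom_comp_tensorHom_assoc, Category.id_comp]
    have h2 : μ F ⟨[s]⟩ ⟨l⟩ ▷ F.obj ⟨m⟩ ≫ ((e.app (s :: l)).hom ⊗ₘ (e.app m).hom) =
        (((e.iso s).hom ⊗ₘ (e.app l).hom) ⊗ₘ (e.app m).hom) ≫ μ G ⟨[s]⟩ ⟨l⟩ ▷ G.obj ⟨m⟩ := by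
      rw [← tensorHom_id, ← tensorHom_id]
      refine (tensorHom_comp_tensorHom _ _ _ _).trans ?_
      rw [tensorHom_comp_tensorHom, Category.id_comp, Category.comp_id, ← e.μ_app_cons s l]
    rw [h1, ih, reassoc_of% h2, μ_cons G s l m, associator_naturality_assoc]
    simp only [← id_tensorHom, tensorHom_comp_tensorHom_assoc, Category.comp_id]

theorem μ_singleton_unit (F : Cob A ⥤ D) [F.Monoidal] (s : Sgn) :
    μ F ⟨[s]⟩ (𝟙_ (Cob A)) = F.obj ⟨[s]⟩ ◁ η F ≫ (ρ_ (F.obj ⟨[s]⟩)).hom := by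
  have h : μ F ⟨[s]⟩ (𝟙_ (Cob A)) ≫ F.map (ρ_ (⟨[s]⟩ : Cob A)).hom = μ F ⟨[s]⟩ (𝟙_ (Cob A)) := by
    rw [Cob.rightUnitor_singleton]
    exact (congrArg (_ ≫ ·) (F.map_id _)).trans (Category.comp_id _)
  rw [Functor.LaxMonoidal.right_unitality, Functor.Monoidal.whiskerLeft_η_ε_assoc, h]

/-- The recursion attaches a unit factor to a single sign; right unitality of both functors removes
it. -/
theorem app_singleton (s : Sgn) : (e.app [s]).hom = (e.iso s).hom := by
  have h : μ F ⟨[s]⟩ (𝟙_ (Cob A)) ≫ (e.app [s]).hom =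
      ((e.iso s).hom ⊗ₘ (e.app []).hom) ≫ μ G ⟨[s]⟩ (𝟙_ (Cob A)) := e.μ_app_cons s []
  have h' : (e.app []).hom = η F ≫ ε G := rfl
  rw [μ_singleton_unit, μ_singleton_unit, h', MonoidalCategory.tensorHom_def,
    MonoidalCategory.whiskerLeft_comp, Category.assoc, Category.assoc, Category.assoc,
    Functor.Monoidal.whiskerLeft_ε_η_assoc, ← whisker_exchange_assoc] at h
  have h2 := h.trans (congrArg (_ ≫ ·) (MonoidalCategory.rightUnitor_naturality _))
  exact (cancel_epi _).1 ((cancel_epi _).1 h2)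

end Monoidal

variable [BraidedCategory D] [F.Braided] [G.Braided] (e : PointIso F G)

/-- The morphisms with a commuting naturality square are closed under composition and tensor product
and contain the braidings and associators. By `Cob.generated` only the five generators in `PointIso`
remain. -/
theorem naturality {x y : Cob A} (f : x ⟶ y) :
    F.map f ≫ (e.app y.signs).hom = (e.app x.signs).hom ≫ G.map f := by
  have hu : (e.app []).hom = η F ≫ ε G := rfl
  refine Cob.generated (W := fun x y f => F.map f ≫ (e.app y.signs).hom =
    (e.app x.signs).hom ≫ G.map f) ?_ ?_ ?_ ?_ ?_ ?_ ?_ ?_ ?_ ?_ f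
  · intro x
    rw [F.map_id, G.map_id, Category.id_comp, Category.comp_id]
  · intro x y z f g hf hg
    rw [F.map_comp, G.map_comp, Category.assoc, hg, reassoc_of% hf]
  · intro x y x' y' f g hf hg
    rw [← cancel_epi (μ F x x')]
    rw [← Functor.LaxMonoidal.μ_natural_assoc]
    refine (congrArg (_ ≫ ·) (e.μ_app y.signs y'.signs)).trans ?_
    refine Eq.trans ?_ ((congrArg (· ≫ _) (e.μ_app x.signs x'.signs)).symm.trans
      (Category.assoc _ _ _))
    rw [tensorHom_comp_tensorHom_assoc, hf, hg, Category.assoc, ← tensorHom_comp_tensorHom_assoc]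
    exact congrArg (_ ≫ ·) (Functor.LaxMonoidal.μ_natural G f g)
  · intro x y
    rw [← cancel_epi (μ F x y), Functor.LaxBraided.braided_assoc]
    refine (congrArg (_ ≫ ·) (e.μ_app y.signs x.signs)).trans ?_
    refine Eq.trans ?_ ((congrArg (· ≫ _) (e.μ_app x.signs y.signs)).symm.trans
      (Category.assoc _ _ _))
    rw [Category.assoc, ← BraidedCategory.braiding_naturality_assoc]
    exact congrArg (_ ≫ ·) (Functor.LaxBraided.braided (F := G) x y).symm
  · intro x y z
    let t : ∀ x : Cob A, F.obj x ⟶ G.obj x := fun x => (e.app x.signs).hom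
    have ht (x y : Cob A) : μ F x y ≫ t (x ⊗ y) = (t x ⊗ₘ t y) ≫ μ G x y := e.μ_app _ _
    change F.map (α_ x y z).hom ≫ t (x ⊗ y ⊗ z) = t ((x ⊗ y) ⊗ z) ≫ G.map (α_ x y z).hom
    -- From here on only the compatibility `ht` with the tensorators is used.
    clear_value t
    rw [← cancel_epi (μ F (x ⊗ y) z), ← cancel_epi (μ F x y ▷ F.obj z),
      Functor.LaxMonoidal.associativity_assoc, ht, reassoc_of% (ht (x ⊗ y) z)]
    rw [← tensorHom_id, ← id_tensorHom, tensorHom_comp_tensorHom_assoc,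
      tensorHom_comp_tensorHom_assoc, ht, ht, Category.id_comp, Category.id_comp,
      ← Category.comp_id (t z), ← tensorHom_comp_tensorHom_assoc, tensorHom_id,
      Functor.LaxMonoidal.associativity, associator_naturality_assoc, ← id_tensorHom,
      tensorHom_comp_tensorHom_assoc, Category.comp_id, Category.comp_id]
  · intro a
    change _ ≫ (e.app [_]).hom = (e.app [_]).hom ≫ _
    rw [app_singleton]
    exact e.dotPlus a
  · change F.map Cob.cup ≫ (e.app ([.plus] ++ [.minus])).hom = (e.app []).hom ≫ G.map Cob.cup
    have h := e.cup =≫ μ G _ _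
    simp only [Category.assoc, Functor.Monoidal.δ_μ, Category.comp_id] at h
    have h2 := e.μ_app [.plus] [.minus]
    rw [app_singleton, app_singleton] at h2
    rw [← cancel_epi (ε F), hu, Category.assoc, Functor.Monoidal.ε_η_assoc, ← h]
    refine congrArg (_ ≫ ·) (congrArg (_ ≫ ·) ?_)
    rw [← cancel_epi (μ F Cob.plus Cob.minus), Functor.Monoidal.μ_δ_assoc]
    exact h2
  · change F.map Cob.cap ≫ (e.app []).hom = (e.app ([.minus] ++ [.plus])).hom ≫ G.map Cob.cap
    have h2 := e.μ_app [.minus] [.plus]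
    rw [app_singleton, app_singleton] at h2
    rw [← cancel_mono (η G), hu, ← cancel_epi (μ F Cob.minus Cob.plus)]
    simp only [Category.assoc, Functor.Monoidal.ε_η, Category.comp_id]
    rw [← e.cap]
    refine Eq.trans ?_ (((congrArg (· ≫ _) h2).symm.trans (Category.assoc _ _ _)))
    exact (Category.assoc _ _ _).symm
  · change _ ≫ (e.app [_]).hom = (e.app []).hom ≫ _
    rw [app_singleton, ← cancel_epi (ε F), hu, e.halfTopPlus, Category.assoc,
      Functor.Monoidal.ε_η_assoc]
  · change _ ≫ (e.app []).hom = (e.app [_]).hom ≫ _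
    rw [app_singleton, ← cancel_mono (η G), hu]
    simp only [Category.assoc, Functor.Monoidal.ε_η, Category.comp_id]
    exact e.halfBotPlus.symm

/-- Isomorphisms which are compatible with the generators extend to a monoidal natural
isomorphism. -/
theorem exists_iso (e : PointIso F G) : ∃ i : F ≅ G, NatTrans.IsMonoidal i.hom :=
  ⟨NatIso.ofComponents (fun x => e.app x.signs) e.naturality,
    { unit := e.app_unit
      tensor := fun x y => e.μ_app x.signs y.signs }⟩

end PointIso

/-- Colours of the points of an oriented `0`-manifold by states. -/
abbrev Pts.Coloring (X : Pts A) (S : Type) : Type := (X.pos → S) × (X.neg → S)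

/-! ### Colourings of cobordisms by states. -/

namespace PreCob

variable {X Y Z X' Y' : Pts A} (Q : Automaton A)

/-- Colourings of the edges of a decorated cobordism by states of an automaton which are
compatible with the transitions, the initial and the accepting states, and with given colourings of
the boundary. The colour of an edge is recorded both at its origin and at its end. -/
structure IsColoring (F : PreCob X Y) (c : X.Coloring Q.State) (d : Y.Coloring Q.State)
    (e : Src X.pos Y.neg F.S F.V → Q.State) (e' : Tgt Y.pos X.neg F.T F.V → Q.State) : Prop where
  next : ∀ z, e' (F.next z) = e z
  src_bot : ∀ p, e (.bot p) = c.1 p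
  src_top : ∀ n, e (.top n) = d.2 n
  start : ∀ s, e (.start s) ∈ Q.nfa.start
  tgt_top : ∀ p, e' (.top p) = d.1 p
  tgt_bot : ∀ n, e' (.bot n) = c.2 n
  accept : ∀ t, e' (.finish t) ∈ Q.nfa.accept
  vert : ∀ v, F.label v = none → e (.vert v) = e' (.vert v)
  dot : ∀ v a, F.label v = some a → e (.vert v) ∈ Q.nfa.step (e' (.vert v)) a

/-- The matrix entries of the state sum of a decorated cobordism. -/
def Colorable (F : PreCob X Y) (c : X.Coloring Q.State) (d : Y.Coloring Q.State) : Prop :=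
  ∃ e e', F.IsColoring Q c d e e'

variable {Q}

/-- A walk crosses only ordinary points, and those preserve the colour. -/
theorem Leads.color_eq {F : PreCob X Y} {V T : Type} {v : V → F.V} {t : T → F.T}
    (hv : ∀ w, w ∉ Set.range v → F.label w = none) {c d e e'} (he : F.IsColoring Q c d e e')
    {z z'} (h : F.Leads v t z z') : e' z = e' (z'.map id id t v) := by
  induction h with
  | here z => rfl
  | step w hw z h ih => rw [← he.vert w (hv w hw), ← he.next, ih]

/-- The walk is deterministic and stops at the first point that is kept; injectivity of `v` and `t`
recovers the name of that point. -/
theorem Leads.unique {F : PreCob X Y} {V T : Type} {v : V → F.V} {t : T → F.T}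
    (hv : v.Injective) (ht : t.Injective)
    {z z₁ z₂} (h₁ : F.Leads v t z z₁) (h₂ : F.Leads v t z z₂) : z₁ = z₂ := by
  induction h₁ with
  | here z =>
    generalize hy : z.map id id t v = y at h₂
    cases h₂ with
    | here z₂ =>
      rcases z with _ | _ | _ | _ <;> rcases z₂ with _ | _ | _ | _ <;> simp_all [Tgt.map]
      exacts [ht hy, hv hy]
    | step w hw _ h =>
      rcases z with _ | _ | _ | x <;> simp [Tgt.map] at hy
      exact (hw ⟨x, hy⟩).elim
  | step w hw z h ih =>
    generalize hy : Tgt.vert w = y at h₂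
    cases h₂ with
    | here z₂ =>
      rcases z₂ with _ | _ | _ | x <;> simp [Tgt.map] at hy
      exact (hw ⟨x, hy.symm⟩).elim
    | step w' hw' _ h' =>
      cases hy
      exact ih h'

theorem Subdivision.exists_leads {F G : PreCob X Y} (h : Subdivision F G)
    (z : Tgt Y.pos X.neg F.T F.V) : ∃ z', F.Leads h.v h.t z z' := by
  rcases z with p | n | t | w
  · exact ⟨.top p, .of_eq rfl⟩
  · exact ⟨.bot n, .of_eq rfl⟩
  · exact ⟨.finish (h.t.symm t), .of_eq (by simp [Tgt.map])⟩
  · by_cases hw : w ∈ Set.range h.v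
    · obtain ⟨x, rfl⟩ := hw
      exact ⟨.vert x, .of_eq rfl⟩
    · exact h.new_leads w hw

/-- Colourings of the subdivided cobordism restrict to the coarse one. In the other direction an
edge end takes the colour of the kept end to which it leads. This makes the state sum well defined
on classes of cobordisms. -/
theorem Subdivision.colorable_iff {F G : PreCob X Y} (h : Subdivision F G) (c d) :
    F.Colorable Q c d ↔ G.Colorable Q c d := by
  constructor
  · rintro ⟨e, e', he⟩
    refine ⟨fun z => e (z.map id id h.s h.v), fun z => e' (z.map id id h.t h.v), ?_, ?_, ?_, ?_,
      ?_, ?_, ?_, ?_, ?_⟩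
    · intro z
      rw [← he.next, (h.next_leads z).color_eq h.label_new he]
    · exact fun p => he.src_bot p
    · exact fun p => he.src_top p
    · exact fun p => he.start _
    · exact fun p => he.tgt_top p
    · exact fun p => he.tgt_bot p
    · exact fun p => he.accept _
    · exact fun v hv => he.vert _ ((h.label_v v).trans hv)
    · exact fun v a hv => he.dot _ a ((h.label_v v).trans hv)
  · rintro ⟨e, e', he⟩
    -- `L` sends each edge end of `F` to the edge end of `G` at which its walk stops.
    choose L hL using h.exists_leads
    have hLu {z z'} (hz : F.Leads h.v h.t z z') : L z = z' :=
      (hL z).unique h.v_injective h.t.injective hz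
    have hmap (z) : L (z.map id id h.t h.v) = z := hLu (.here z)
    refine ⟨fun z => e' (L (F.next z)), fun z => e' (L z), fun _ => rfl, ?_, ?_, ?_, ?_,
      ?_, ?_, ?_, ?_⟩
    · intro p
      exact (congrArg e' (hLu (h.next_leads (.bot p)))).trans ((he.next _).trans (he.src_bot p))
    · intro p
      exact (congrArg e' (hLu (h.next_leads (.top p)))).trans ((he.next _).trans (he.src_top p))
    · intro s
      have := (congrArg e' (hLu (h.next_leads (.start (h.s.symm s))))).trans (he.next _)
      simp only [Src.map, Equiv.apply_symm_apply] at this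
      rw [this]
      exact he.start _
    · exact fun p => (congrArg e' (hmap (.top p))).trans (he.tgt_top p)
    · exact fun p => (congrArg e' (hmap (.bot p))).trans (he.tgt_bot p)
    · intro t
      have := congrArg e' (hmap (.finish (h.t.symm t)))
      simp only [Tgt.map, Equiv.apply_symm_apply] at this
      rw [this]
      exact he.accept _
    · intro w hw
      by_cases hx : w ∈ Set.range h.v
      · obtain ⟨x, rfl⟩ := hx
        rw [h.label_v] at hw
        have h1 := congrArg e' (hmap (.vert x))
        have h2 := (congrArg e' (hLu (h.next_leads (.vert x)))).trans (he.next _)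
        exact h2.trans ((he.vert x hw).trans h1.symm)
      · exact congrArg e' (hLu (.step w hx _ (hL _))).symm
    · intro w a hw
      by_cases hx : w ∈ Set.range h.v
      · obtain ⟨x, rfl⟩ := hx
        rw [h.label_v] at hw
        have h1 := congrArg e' (hmap (.vert x))
        have h2 := (congrArg e' (hLu (h.next_leads (.vert x)))).trans (he.next _)
        have h3 := he.dot x a hw
        rw [← h1, ← h2] at h3
        exact h3
      -- A vertex with a label is never among the erased ones.
      · rw [h.label_new w hx] at hw
        exact nomatch hw

/-- Gluing points are ordinary vertices, so the edges meeting there have a common colour. A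
colouring of the glued cobordism is thus a pair of colourings that agree on `Y`. -/
theorem colorable_comp (F : PreCob X Y) (G : PreCob Y Z) (c d) :
    (F.comp G).Colorable Q c d ↔ ∃ b, F.Colorable Q c b ∧ G.Colorable Q b d := by
  constructor
  · rintro ⟨e, e', he⟩
    -- The colour at a gluing point is read on the outgoing edge; the condition at ordinary vertices
    -- transfers it to the incoming one.
    let b : Y.Coloring Q.State :=
      (fun p => e (.vert (.inr (.inl p))), fun n => e (.vert (.inr (.inr n))))
    refine ⟨b, ⟨fun z => e ((glueSrc X.pos Y.pos Y.neg Z.neg F.S G.S F.V G.V).symm (.inl z)),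
      fun z => e' ((glueTgt Y.pos Z.pos X.neg Y.neg F.T G.T F.V G.V).symm (.inl z)),
      ?_, ?_, ?_, ?_, ?_, ?_, ?_, ?_, ?_⟩,
      ⟨fun z => e ((glueSrc X.pos Y.pos Y.neg Z.neg F.S G.S F.V G.V).symm (.inr z)),
      fun z => e' ((glueTgt Y.pos Z.pos X.neg Y.neg F.T G.T F.V G.V).symm (.inr z)),
      ?_, ?_, ?_, ?_, ?_, ?_, ?_, ?_, ?_⟩⟩
    · rintro (x | x | x | x)
      exacts [he.next (.bot x), he.next (.vert (.inr (.inr x))), he.next (.start (.inl x)),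
        he.next (.vert (.inl (.inl x)))]
    · exact fun p => he.src_bot p
    · exact fun p => rfl
    · exact fun s => he.start (.inl s)
    · exact fun p => (he.vert (.inr (.inl p)) rfl).symm
    · exact fun p => he.tgt_bot p
    · exact fun t => he.accept (.inl t)
    · exact fun v hv => he.vert (.inl (.inl v)) hv
    · exact fun v a hv => he.dot (.inl (.inl v)) a hv
    · rintro (x | x | x | x)
      exacts [he.next (.vert (.inr (.inl x))), he.next (.top x), he.next (.start (.inr x)),
        he.next (.vert (.inl (.inr x)))]
    · exact fun p => rfl
    · exact fun p => he.src_top p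
    · exact fun s => he.start (.inr s)
    · exact fun p => he.tgt_top p
    · exact fun p => (he.vert (.inr (.inr p)) rfl).symm
    · exact fun t => he.accept (.inr t)
    · exact fun v hv => he.vert (.inl (.inr v)) hv
    · exact fun v a hv => he.dot (.inl (.inr v)) a hv
  · rintro ⟨b, ⟨e, e', he⟩, ⟨f, f', hf⟩⟩
    refine ⟨fun z => Sum.elim e f (glueSrc X.pos Y.pos Y.neg Z.neg F.S G.S F.V G.V z),
      fun z => Sum.elim e' f' (glueTgt Y.pos Z.pos X.neg Y.neg F.T G.T F.V G.V z),
      ?_, ?_, ?_, ?_, ?_, ?_, ?_, ?_, ?_⟩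
    · have key (y) : Sum.elim e' f' (glueTgt Y.pos Z.pos X.neg Y.neg F.T G.T F.V G.V
          ((glueTgt Y.pos Z.pos X.neg Y.neg F.T G.T F.V G.V).symm y)) = Sum.elim e' f' y := by
        rw [Equiv.apply_symm_apply]
      rintro (x | x | (x | x) | ((x | x) | (x | x)))
      exacts [(key (.inl _)).trans (he.next (.bot x)), (key (.inr _)).trans (hf.next (.top x)),
        (key (.inl _)).trans (he.next (.start x)), (key (.inr _)).trans (hf.next (.start x)),
        (key (.inl _)).trans (he.next (.vert x)), (key (.inr _)).trans (hf.next (.vert x)),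
        (key (.inr _)).trans (hf.next (.bot x)), (key (.inl _)).trans (he.next (.top x))]
    · exact fun p => he.src_bot p
    · exact fun p => hf.src_top p
    · exact fun s => s.casesOn he.start hf.start
    · exact fun p => hf.tgt_top p
    · exact fun p => he.tgt_bot p
    · exact fun s => s.casesOn he.accept hf.accept
    · rintro ((v | v) | (p | n)) hv
      exacts [he.vert v hv, hf.vert v hv, (hf.src_bot p).trans (he.tgt_top p).symm,
        (he.src_top n).trans (hf.tgt_bot n).symm]
    · rintro ((v | v) | (p | n)) a hv
      exacts [he.dot v a hv, hf.dot v a hv, (nomatch hv), (nomatch hv)]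

theorem colorable_sum (F : PreCob X Y) (G : PreCob X' Y') (c : (X.sum X').Coloring Q.State)
    (d : (Y.sum Y').Coloring Q.State) :
    (F.sum G).Colorable Q c d ↔
      F.Colorable Q (c.1 ∘ .inl, c.2 ∘ .inl) (d.1 ∘ .inl, d.2 ∘ .inl) ∧
      G.Colorable Q (c.1 ∘ .inr, c.2 ∘ .inr) (d.1 ∘ .inr, d.2 ∘ .inr) := by
  constructor
  · rintro ⟨e, e', he⟩
    refine ⟨⟨fun z => e ((sumSrc X.pos X'.pos Y.neg Y'.neg F.S G.S F.V G.V).symm (.inl z)),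
      fun z => e' ((sumTgt Y.pos Y'.pos X.neg X'.neg F.T G.T F.V G.V).symm (.inl z)),
      ?_, ?_, ?_, ?_, ?_, ?_, ?_, ?_, ?_⟩,
      ⟨fun z => e ((sumSrc X.pos X'.pos Y.neg Y'.neg F.S G.S F.V G.V).symm (.inr z)),
      fun z => e' ((sumTgt Y.pos Y'.pos X.neg X'.neg F.T G.T F.V G.V).symm (.inr z)),
      ?_, ?_, ?_, ?_, ?_, ?_, ?_, ?_, ?_⟩⟩
    · rintro (x | x | x | x)
      exacts [he.next (.bot (.inl x)), he.next (.top (.inl x)), he.next (.start (.inl x)),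
        he.next (.vert (.inl x))]
    · exact fun p => he.src_bot (.inl p)
    · exact fun p => he.src_top (.inl p)
    · exact fun s => he.start (.inl s)
    · exact fun p => he.tgt_top (.inl p)
    · exact fun p => he.tgt_bot (.inl p)
    · exact fun t => he.accept (.inl t)
    · exact fun v hv => he.vert (.inl v) hv
    · exact fun v a hv => he.dot (.inl v) a hv
    · rintro (x | x | x | x)
      exacts [he.next (.bot (.inr x)), he.next (.top (.inr x)), he.next (.start (.inr x)),
        he.next (.vert (.inr x))]
    · exact fun p => he.src_bot (.inr p)
    · exact fun p => he.src_top (.inr p)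
    · exact fun s => he.start (.inr s)
    · exact fun p => he.tgt_top (.inr p)
    · exact fun p => he.tgt_bot (.inr p)
    · exact fun t => he.accept (.inr t)
    · exact fun v hv => he.vert (.inr v) hv
    · exact fun v a hv => he.dot (.inr v) a hv
  · rintro ⟨⟨e, e', he⟩, ⟨f, f', hf⟩⟩
    refine ⟨fun z => Sum.elim e f (sumSrc X.pos X'.pos Y.neg Y'.neg F.S G.S F.V G.V z),
      fun z => Sum.elim e' f' (sumTgt Y.pos Y'.pos X.neg X'.neg F.T G.T F.V G.V z),
      ?_, ?_, ?_, ?_, ?_, ?_, ?_, ?_, ?_⟩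
    · have key (y) : Sum.elim e' f' (sumTgt Y.pos Y'.pos X.neg X'.neg F.T G.T F.V G.V
          ((sumTgt Y.pos Y'.pos X.neg X'.neg F.T G.T F.V G.V).symm y)) = Sum.elim e' f' y := by
        rw [Equiv.apply_symm_apply]
      rintro ((x | x) | (x | x) | (x | x) | (x | x))
      exacts [(key (.inl _)).trans (he.next (.bot x)), (key (.inr _)).trans (hf.next (.bot x)),
        (key (.inl _)).trans (he.next (.top x)), (key (.inr _)).trans (hf.next (.top x)),
        (key (.inl _)).trans (he.next (.start x)), (key (.inr _)).trans (hf.next (.start x)),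
        (key (.inl _)).trans (he.next (.vert x)), (key (.inr _)).trans (hf.next (.vert x))]
    · exact fun p => p.casesOn he.src_bot hf.src_bot
    · exact fun p => p.casesOn he.src_top hf.src_top
    · exact fun s => s.casesOn he.start hf.start
    · exact fun p => p.casesOn he.tgt_top hf.tgt_top
    · exact fun p => p.casesOn he.tgt_bot hf.tgt_bot
    · exact fun s => s.casesOn he.accept hf.accept
    · exact fun v => v.casesOn he.vert hf.vert
    · exact fun v => v.casesOn he.dot hf.dot

theorem colorable_ofEquiv (p : X.pos ≃ Y.pos) (n : X.neg ≃ Y.neg) (c : X.Coloring Q.State)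
    (d : Y.Coloring Q.State) :
    (ofEquiv p n).Colorable Q c d ↔ c = (d.1 ∘ p, d.2 ∘ n) := by
  constructor
  · rintro ⟨e, e', he⟩
    refine Prod.ext (funext fun x => ?_) (funext fun x => ?_)
    · rw [← he.src_bot, ← he.next]
      exact he.tgt_top _
    · have h := he.next (.top (n x))
      rw [he.src_top] at h
      refine Eq.trans ?_ h
      rw [← he.tgt_bot]
      exact congrArg (fun y => e' (.bot y)) (n.symm_apply_apply x).symm
  · rintro rfl
    refine ⟨fun
      | .bot x => d.1 (p x)
      | .top x => d.2 x, fun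
      | .top x => d.1 x
      | .bot x => d.2 (n x), ?_, fun _ => rfl, fun _ => rfl, nofun, fun _ => rfl, fun _ => rfl,
      nofun, nofun, nofun⟩
    rintro (x | x | x | x)
    · rfl
    · exact congrArg d.2 (n.apply_symm_apply x)
    · exact x.elim
    · exact x.elim

end PreCob

/-! ### Boolean linear algebra: matrices as relations. -/

namespace 𝔹

theorem eq_zero_or_one (x : 𝔹) : x = 0 ∨ x = 1 := by
  cases x
  exacts [.inl rfl, .inr rfl]

theorem zero_ne_one : (0 : 𝔹) ≠ 1 := nofun

instance : Nontrivial 𝔹 := ⟨0, 1, zero_ne_one⟩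

/-- This turns identities between Boolean vectors and matrices into equivalences of propositions;
sums then become existential quantifiers and products become conjunctions. -/
theorem ext_iff {x y : 𝔹} : x = y ↔ (x = 1 ↔ y = 1) := by
  rcases eq_zero_or_one x with rfl | rfl <;> rcases eq_zero_or_one y with rfl | rfl <;>
    simp [zero_ne_one.symm]

theorem one_add_one : (1 : 𝔹) + 1 = 1 := rfl

theorem add_eq_one {x y : 𝔹} : x + y = 1 ↔ x = 1 ∨ y = 1 := by
  rcases eq_zero_or_one x with rfl | rfl <;> rcases eq_zero_or_one y with rfl | rfl <;>
    simp [one_add_one]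

theorem mul_eq_one {x y : 𝔹} : x * y = 1 ↔ x = 1 ∧ y = 1 := by
  rcases eq_zero_or_one x with rfl | rfl <;> rcases eq_zero_or_one y with rfl | rfl <;> simp

theorem sum_eq_one {ι : Type*} {s : Finset ι} {f : ι → 𝔹} :
    ∑ i ∈ s, f i = 1 ↔ ∃ i ∈ s, f i = 1 := by
  classical
  induction s using Finset.induction_on with
  | empty => simp
  | insert a s ha ih => simp [Finset.sum_insert ha, add_eq_one, ih]

end 𝔹

section Rel

variable {α β γ : Type}

theorem finsupp_ext {x y : α →₀ 𝔹} (h : ∀ a, x a = 1 ↔ y a = 1) : x = y :=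
  Finsupp.ext fun a => 𝔹.ext_iff.2 (h a)

/-- The sum of the basis vectors in a set. -/
noncomputable def indicatorVec [Finite α] (s : Set α) : α →₀ 𝔹 :=
  Finsupp.equivFunOnFinite.symm (s.indicator 1)

theorem indicatorVec_eq_one [Finite α] {s : Set α} {a : α} : indicatorVec s a = 1 ↔ a ∈ s := by
  classical
  change s.indicator 1 a = (1 : 𝔹) ↔ _
  by_cases h : a ∈ s <;> simp [h]

/-- The linear map whose matrix is a given relation. -/
noncomputable def relLin [Finite β] (r : α → β → Prop) : (α →₀ 𝔹) →ₗ[𝔹] (β →₀ 𝔹) :=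
  Finsupp.linearCombination 𝔹 fun a => indicatorVec {b | r a b}

theorem linearCombination_eq_one {f : α → β →₀ 𝔹} {x : α →₀ 𝔹} {b : β} :
    Finsupp.linearCombination 𝔹 f x b = 1 ↔ ∃ a, x a = 1 ∧ f a b = 1 := by
  rw [Finsupp.linearCombination_apply, Finsupp.sum_apply, Finsupp.sum, 𝔹.sum_eq_one]
  simp only [Finsupp.smul_apply, smul_eq_mul, 𝔹.mul_eq_one]
  refine ⟨fun ⟨a, _, h⟩ => ⟨a, h⟩, fun ⟨a, h⟩ => ⟨a, ?_, h⟩⟩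
  rw [Finsupp.mem_support_iff, h.1]
  exact 𝔹.zero_ne_one.symm

theorem relLin_eq_one [Finite β] {r : α → β → Prop} {x : α →₀ 𝔹} {b : β} :
    relLin r x b = 1 ↔ ∃ a, x a = 1 ∧ r a b := by
  rw [relLin, linearCombination_eq_one]
  simp only [indicatorVec_eq_one, Set.mem_ofPred_eq]

/-- Since `1 + 1 = 1`, a sum of products only records whether an intermediate index exists: the
matrix product is composition of relations. -/
theorem relLin_relLin [Finite β] [Finite γ] (r : α → β → Prop) (s : β → γ → Prop) (x : α →₀ 𝔹) :
    relLin s (relLin r x) = relLin (fun a c => ∃ b, r a b ∧ s b c) x := by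
  refine finsupp_ext fun c => ?_
  simp only [relLin_eq_one]
  constructor
  · rintro ⟨b, ⟨a, h1, h2⟩, h3⟩
    exact ⟨a, h1, b, h2, h3⟩
  · rintro ⟨a, h1, b, h2, h3⟩
    exact ⟨b, ⟨a, h1, h2⟩, h3⟩

end Rel

/-- The morphism of free modules given by a linear map. -/
def homOfLin {M N : FreeMod} (f : M.obj →ₗ[𝔹] N.obj) : M ⟶ N :=
  ObjectProperty.homMk (SemimoduleCat.ofHom f)

theorem hom_ext {M N : FreeMod} {f g : M ⟶ N} (h : ∀ x, lin f x = lin g x) : f = g :=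
  ObjectProperty.hom_ext _ (SemimoduleCat.hom_ext (LinearMap.ext h))

/-- The isomorphism of free modules given by a linear equivalence. -/
def isoOfLin {M N : FreeMod} (f : M.obj ≃ₗ[𝔹] N.obj) : M ≅ N where
  hom := homOfLin f.toLinearMap
  inv := homOfLin f.symm.toLinearMap
  hom_inv_id := hom_ext f.symm_apply_apply
  inv_hom_id := hom_ext f.apply_symm_apply

theorem tensor_hom_ext {M N P : FreeMod} {f g : M ⊗ N ⟶ P}
    (h : ∀ (x : M.obj) (y : N.obj), lin f (x ⊗ₜ[𝔹] y) = lin g (x ⊗ₜ[𝔹] y)) : f = g :=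
  ObjectProperty.hom_ext _ (SemimoduleCat.hom_ext (TensorProduct.ext' h))

theorem tensor_hom_ext₃ {M N P R : FreeMod} {f g : (M ⊗ N) ⊗ P ⟶ R}
    (h : ∀ (x : M.obj) (y : N.obj) (z : P.obj),
      lin f ((x ⊗ₜ[𝔹] y) ⊗ₜ[𝔹] z) = lin g ((x ⊗ₜ[𝔹] y) ⊗ₜ[𝔹] z)) : f = g :=
  ObjectProperty.hom_ext _ (SemimoduleCat.hom_ext (TensorProduct.ext_threefold h))

/-! ### The state sum as a symmetric monoidal functor. -/

namespace Automaton

variable (Q : Automaton A)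

instance (X : Pts A) : Finite (X.Coloring Q.State) :=
  inferInstanceAs (Finite ((X.pos → Q.State) × (X.neg → Q.State)))

/-- The value of the state sum on an oriented `0`-manifold. -/
noncomputable def stateObj (X : Pts A) : FreeMod :=
  ⟨SemimoduleCat.of 𝔹 (X.Coloring Q.State →₀ 𝔹),
    inferInstanceAs (Module.Free 𝔹 (X.Coloring Q.State →₀ 𝔹))⟩

/-- The matrix of the state sum of a morphism of oriented `0`-manifolds. -/
def stateRel {X Y : Pts A} (f : X ⟶ Y) : X.Coloring Q.State → Y.Coloring Q.State → Prop :=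
  Quot.lift (fun F : PreCob X Y => F.Colorable Q)
    (fun _ _ ⟨h⟩ => funext fun c => funext fun d => propext (h.colorable_iff c d)) f

variable {Q}

theorem stateRel_comp {X Y Z : Pts A} (f : X ⟶ Y) (g : Y ⟶ Z) (c d) :
    Q.stateRel (f ≫ g) c d ↔ ∃ b, Q.stateRel f c b ∧ Q.stateRel g b d := by
  obtain ⟨F⟩ := f
  obtain ⟨G⟩ := g
  exact PreCob.colorable_comp F G c d

theorem stateRel_isoOfEquiv {X Y : Pts A} (p : X.pos ≃ Y.pos) (n : X.neg ≃ Y.neg)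
    (c : X.Coloring Q.State) (d : Y.Coloring Q.State) :
    Q.stateRel (Pts.isoOfEquiv p n).hom c d ↔ c = (d.1 ∘ p, d.2 ∘ n) :=
  PreCob.colorable_ofEquiv p n c d

theorem stateRel_id (X : Pts A) (c d) : Q.stateRel (𝟙 X) c d ↔ c = d :=
  PreCob.colorable_ofEquiv (.refl _) (.refl _) c d

theorem stateRel_tensorHom {X Y X' Y' : Pts A} (f : X ⟶ Y) (g : X' ⟶ Y')
    (c : (X.sum X').Coloring Q.State) (d : (Y.sum Y').Coloring Q.State) :
    Q.stateRel (X := X ⊗ X') (Y := Y ⊗ Y') (f ⊗ₘ g) c d ↔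
      Q.stateRel f (c.1 ∘ .inl, c.2 ∘ .inl) (d.1 ∘ .inl, d.2 ∘ .inl) ∧
      Q.stateRel g (c.1 ∘ .inr, c.2 ∘ .inr) (d.1 ∘ .inr, d.2 ∘ .inr) := by
  obtain ⟨F⟩ := f
  obtain ⟨G⟩ := g
  exact PreCob.colorable_sum F G c d

variable (Q)

/-- The state sum of a morphism of oriented `0`-manifolds. -/
noncomputable def stateMap {X Y : Pts A} (f : X ⟶ Y) :
    (X.Coloring Q.State →₀ 𝔹) →ₗ[𝔹] (Y.Coloring Q.State →₀ 𝔹) := relLin (Q.stateRel f)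

/-- The state sum of an automaton. -/
noncomputable def stateFunctor : Pts A ⥤ FreeMod where
  obj := Q.stateObj
  map f := homOfLin (M := Q.stateObj _) (N := Q.stateObj _) (Q.stateMap f)
  map_id X := hom_ext fun x => finsupp_ext fun c => by
    refine relLin_eq_one.trans ?_
    simp only [stateRel_id, exists_eq_right]
    rfl
  map_comp f g := hom_ext fun x => by
    refine Eq.trans ?_ (relLin_relLin (Q.stateRel f) (Q.stateRel g) x).symm
    exact congrArg (fun r => relLin r x)
      (funext fun c => funext fun d => propext (stateRel_comp f g c d))

variable {Q}

theorem stateMap_eq_one {X Y : Pts A} (f : X ⟶ Y) (x : X.Coloring Q.State →₀ 𝔹)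
    (d : Y.Coloring Q.State) :
    Q.stateMap f x d = 1 ↔
      ∃ c, x c = 1 ∧ Q.stateRel f c d := relLin_eq_one

/-- Permutations act by renaming coordinates. As associators, unitors and braidings are
permutations, the coherence laws reduce to identities between coordinates. -/
theorem stateMap_isoOfEquiv {X Y : Pts A} (p : X.pos ≃ Y.pos) (n : X.neg ≃ Y.neg)
    (x : X.Coloring Q.State →₀ 𝔹) (d : Y.Coloring Q.State) :
    Q.stateMap (Pts.isoOfEquiv p n).hom x d =
      x (d.1 ∘ p, d.2 ∘ n) := by
  refine 𝔹.ext_iff.2 ((stateMap_eq_one _ _ _).trans ?_)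
  simp only [stateRel_isoOfEquiv]
  exact exists_eq_right

/-- Colourings of a disjoint union. -/
def coloringSum (S : Type) (X Y : Pts A) :
    X.Coloring S × Y.Coloring S ≃ (X.sum Y).Coloring S :=
  (Equiv.prodProdProdComm _ _ _ _).trans
    ((Equiv.sumArrowEquivProdArrow _ _ _).symm.prodCongr (Equiv.sumArrowEquivProdArrow _ _ _).symm)

variable (Q)

/-- The state sum of a disjoint union. -/
noncomputable def stateTensor (X Y : Pts A) :
    (X.Coloring Q.State →₀ 𝔹) ⊗[𝔹] (Y.Coloring Q.State →₀ 𝔹) ≃ₗ[𝔹]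
      ((X.sum Y).Coloring Q.State →₀ 𝔹) :=
  finsuppTensorFinsupp' 𝔹 _ _ ≪≫ₗ Finsupp.domLCongr (coloringSum Q.State X Y)

variable {Q}

theorem stateTensor_tmul (X Y : Pts A) (x : X.Coloring Q.State →₀ 𝔹) (y : Y.Coloring Q.State →₀ 𝔹)
    (c : (X.sum Y).Coloring Q.State) :
    Q.stateTensor X Y (x ⊗ₜ[𝔹] y) c =
      x (c.1 ∘ .inl, c.2 ∘ .inl) * y (c.1 ∘ .inr, c.2 ∘ .inr) := by
  rw [stateTensor, LinearEquiv.trans_apply, Finsupp.domLCongr_apply, Finsupp.domCongr_apply,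
    Finsupp.equivMapDomain_apply]
  exact finsuppTensorFinsupp'_apply_apply 𝔹 _ _ x y _ _

instance (S : Type) : Subsingleton ((Pts.empty : Pts A).Coloring S) :=
  inferInstanceAs (Subsingleton ((Empty → S) × (Empty → S)))

variable (Q)

/-- The tensorator of the state sum. -/
noncomputable def stateμ (X Y : Pts A) :
    Q.stateFunctor.obj X ⊗ Q.stateFunctor.obj Y ≅ Q.stateFunctor.obj (X ⊗ Y) :=
  isoOfLin (M := Q.stateFunctor.obj X ⊗ Q.stateFunctor.obj Y) (N := Q.stateFunctor.obj (X ⊗ Y))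
    (Q.stateTensor X Y)

/-- The unit constraint of the state sum. -/
noncomputable def stateε : 𝟙_ FreeMod ≅ Q.stateFunctor.obj (𝟙_ (Pts A)) :=
  isoOfLin (M := 𝟙_ FreeMod) (N := Q.stateFunctor.obj (𝟙_ (Pts A)))
    (Finsupp.uniqueLinearEquiv 𝔹 𝔹
      ((Empty.elim, Empty.elim) : (Pts.empty : Pts A).Coloring Q.State)).symm

variable {Q}

/-- A colouring of a disjoint union exists exactly when both parts have one, and a conjunction is a
product in `𝔹`. -/
theorem stateTensor_stateMap {X Y X' Y' : Pts A} (f : X ⟶ Y) (g : X' ⟶ Y')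
    (x : X.Coloring Q.State →₀ 𝔹) (y : X'.Coloring Q.State →₀ 𝔹) :
    Q.stateTensor Y Y' (Q.stateMap f x ⊗ₜ[𝔹] Q.stateMap g y) =
      Q.stateMap (X := X ⊗ X') (Y := Y ⊗ Y') (f ⊗ₘ g) (Q.stateTensor X X' (x ⊗ₜ[𝔹] y)) := by
  refine finsupp_ext fun d => Iff.trans ?_ (stateMap_eq_one (f ⊗ₘ g) _ d).symm
  have h (c : (X.sum X').Coloring Q.State) : Q.stateTensor X X' (x ⊗ₜ[𝔹] y) c = 1 ↔
      x (c.1 ∘ .inl, c.2 ∘ .inl) = 1 ∧ y (c.1 ∘ .inr, c.2 ∘ .inr) = 1 := by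
    rw [stateTensor_tmul, 𝔹.mul_eq_one]
  rw [stateTensor_tmul, 𝔹.mul_eq_one, stateMap_eq_one, stateMap_eq_one]
  constructor
  · rintro ⟨⟨c, h1, h2⟩, ⟨c', h3, h4⟩⟩
    exact ⟨(Sum.elim c.1 c'.1, Sum.elim c.2 c'.2), (h _).2 ⟨h1, h3⟩,
      (stateRel_tensorHom _ _ _ _).2 ⟨h2, h4⟩⟩
  · rintro ⟨c, h', h''⟩
    obtain ⟨h1, h3⟩ := (h c).1 h'
    obtain ⟨h2, h4⟩ := (stateRel_tensorHom _ _ _ _).1 h''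
    exact ⟨⟨_, h1, h2⟩, ⟨_, h3, h4⟩⟩

theorem stateμ_natural {X Y X' Y' : Pts A} (f : X ⟶ Y) (g : X' ⟶ Y') :
    (Q.stateFunctor.map f ⊗ₘ Q.stateFunctor.map g) ≫ (Q.stateμ Y Y').hom =
      (Q.stateμ X X').hom ≫ Q.stateFunctor.map (f ⊗ₘ g) :=
  tensor_hom_ext (stateTensor_stateMap f g)

theorem stateε_apply (r : 𝔹) (c : (Pts.empty : Pts A).Coloring Q.State) :
    (show (Pts.empty : Pts A).Coloring Q.State →₀ 𝔹 from lin Q.stateε.hom r) c = r :=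
  Finsupp.uniqueLinearEquiv_symm_apply_apply 𝔹 𝔹 _ r c

variable (Q)

/-- The monoidal structure of the state sum. -/
noncomputable def stateCoreMonoidal : Q.stateFunctor.CoreMonoidal where
  εIso := Q.stateε
  μIso := Q.stateμ
  μIso_hom_natural_left f X' := by
    have h := stateμ_natural (Q := Q) f (𝟙 X')
    rwa [CategoryTheory.Functor.map_id, tensorHom_id, tensorHom_id] at h
  μIso_hom_natural_right X' f := by
    have h := stateμ_natural (Q := Q) (𝟙 X') f
    rwa [CategoryTheory.Functor.map_id, id_tensorHom, id_tensorHom] at h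
  associativity X Y Z := by
    -- On pure tensors and in one coordinate, associativity of the tensorator is associativity of
    -- multiplication in `𝔹`.
    refine tensor_hom_ext₃ fun x y z => Finsupp.ext fun d => ?_
    refine (stateMap_isoOfEquiv _ _ _ d).trans ?_
    refine (stateTensor_tmul _ _ _ _ _).trans ?_
    refine (congrArg (· * _) (stateTensor_tmul _ _ _ _ _)).trans ?_
    refine Eq.trans ?_ (stateTensor_tmul _ _ _ _ _).symm
    refine Eq.trans ?_ (congrArg (_ * ·) (stateTensor_tmul _ _ _ _ _).symm)
    exact mul_assoc _ _ _
  left_unitality X := by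
    refine tensor_hom_ext fun r x => Finsupp.ext fun d => ?_
    refine Eq.symm ((stateMap_isoOfEquiv _ _ _ d).trans ?_)
    refine (stateTensor_tmul _ _ _ _ _).trans ?_
    exact congrArg (· * _) (stateε_apply _ _)
  right_unitality X := by
    refine tensor_hom_ext fun x r => Finsupp.ext fun d => ?_
    refine Eq.symm ((stateMap_isoOfEquiv _ _ _ d).trans ?_)
    refine (stateTensor_tmul _ _ _ _ _).trans ?_
    exact (congrArg (_ * ·) (stateε_apply _ _)).trans (mul_comm _ _)

noncomputable instance : Q.stateFunctor.Monoidal := Q.stateCoreMonoidal.toMonoidal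

noncomputable instance : Q.stateFunctor.Braided where
  braided X Y := by
    refine tensor_hom_ext fun x y => Finsupp.ext fun d => ?_
    refine (stateMap_isoOfEquiv _ _ _ d).trans ?_
    refine (stateTensor_tmul _ _ _ _ _).trans ?_
    exact (mul_comm _ _).trans (stateTensor_tmul _ _ _ _ _).symm

/-- The topological quantum field theory of an automaton. -/
noncomputable def tqft : TQFT A where
  toFunctor := Cob.incl ⋙ Q.stateFunctor

end Automaton

/-! ### Relations between the basic cobordisms. -/

namespace Cob

open PreCob

/-- Disjoint union of cobordisms between sign sequences. -/
def tensorPreCob {x y x' y' : Cob A} (F : PreCob x.toPts y.toPts) (G : PreCob x'.toPts y'.toPts) :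
    PreCob (x ⊗ x').toPts (y ⊗ y').toPts :=
  (F.sum G).relabel (Pos.append _ _).symm (Pos.append _ _).symm (Pos.append _ _) (Pos.append _ _)

theorem ofPreCob_tensor {x y x' y' : Cob A} (F : PreCob x.toPts y.toPts)
    (G : PreCob x'.toPts y'.toPts) :
    ofPreCob F ⊗ₘ ofPreCob G = ofPreCob (tensorPreCob F G) :=
  InducedCategory.hom_ext (isoOfEquiv_comp_toHom_comp_isoOfEquiv _ _ _ _ _)

theorem ofPreCob_whiskerRight {x y : Cob A} (F : PreCob x.toPts y.toPts) (z : Cob A) :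
    ofPreCob F ▷ z = ofPreCob (tensorPreCob F (ofEquiv (X := z.toPts) (.refl _) (.refl _))) :=
  (tensorHom_id _ _).symm.trans (ofPreCob_tensor F _)

theorem whiskerLeft_ofPreCob {x y : Cob A} (F : PreCob x.toPts y.toPts) (z : Cob A) :
    z ◁ ofPreCob F = ofPreCob (tensorPreCob (ofEquiv (X := z.toPts) (.refl _) (.refl _)) F) :=
  (id_tensorHom _ _).symm.trans (ofPreCob_tensor _ F)

theorem ofPreCob_eq {x y : Cob A} {F G : PreCob x.toPts y.toPts} (h : Subdivision F G) :
    ofPreCob F = ofPreCob G := InducedCategory.hom_ext (toHom_eq_of_rel ⟨h⟩)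

theorem comp_eq {x y z : Cob A} {f f' : x ⟶ y} {g g' : y ⟶ z} {h : x ⟶ z} (hf : f = f')
    (hg : g = g') (h' : f' ≫ g' = h) : f ≫ g = h := by
  rw [hf, hg, h']

/-- The glued strand carries no label and passes through three gluing points; erasing them leaves
the identity interval. The middle object is written as the list `+ - +`, so that no associator
occurs. -/
theorem zigzag_plus :
    CategoryStruct.comp (obj := Cob A) (X := ⟨[.plus]⟩) (Y := ⟨[.plus, .minus, .plus]⟩)
      (Z := ⟨[.plus]⟩) (cup ▷ (plus : Cob A)) (plus ◁ cap) = 𝟙 (⟨[.plus]⟩ : Cob A) := by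
  refine comp_eq (ofPreCob_whiskerRight (x := ⟨[]⟩) (y := ⟨[.plus, .minus]⟩) _ _)
    (whiskerLeft_ofPreCob (x := ⟨[.minus, .plus]⟩) (y := ⟨[]⟩) _ _)
    (ofPreCob_eq (x := ⟨[.plus]⟩) (y := ⟨[.plus]⟩) (G := ofEquiv (.refl _) (.refl _)) ?_)
  have hV {V : Type} (w : V) : w ∉ Set.range (Empty.elim : Empty → V) := fun ⟨x, _⟩ => x.elim
  refine
    { v := Empty.elim
      s := Equiv.equivOfIsEmpty Empty ((Empty ⊕ Empty) ⊕ (Empty ⊕ Empty))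
      t := Equiv.equivOfIsEmpty Empty ((Empty ⊕ Empty) ⊕ (Empty ⊕ Empty))
      v_injective := fun x => x.elim
      label_v := fun x => x.elim
      label_new := ?_
      next_leads := ?_
      new_leads := ?_ }
  · rintro (((⟨⟨⟩⟩ | ⟨⟨⟩⟩) | (⟨⟨⟩⟩ | ⟨⟨⟩⟩)) | _) _
    rfl
  · rintro (⟨_ | ⟨_, ⟨⟩⟩⟩ | ⟨_ | ⟨_, ⟨⟩⟩⟩ | ⟨⟨⟩⟩ | ⟨⟨⟩⟩)
    iterate 3 refine Leads.cons _ rfl (hV _) ?_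
    exact .of_eq rfl
  -- The strand meets the last `+`, then `-`, then the first `+`; the iteration counts are the
  -- numbers of gluing points still to be crossed before the top.
  · rintro (((⟨⟨⟩⟩ | ⟨⟨⟩⟩) | (⟨⟨⟩⟩ | ⟨⟨⟩⟩))
      | ((_ | ⟨_, _ | ⟨_, _ | ⟨_, ⟨⟩⟩⟩⟩) | (_ | ⟨_, _ | ⟨_, _ | ⟨_, ⟨⟩⟩⟩⟩))) _ <;>
      refine ⟨.top (Pos.head _), ?_⟩
    · iterate 1 refine Leads.cons _ rfl (hV _) ?_
      exact .of_eq rfl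
    · iterate 3 refine Leads.cons _ rfl (hV _) ?_
      exact .of_eq rfl
    · iterate 2 refine Leads.cons _ rfl (hV _) ?_
      exact .of_eq rfl

theorem zigzag_minus :
    CategoryStruct.comp (obj := Cob A) (X := ⟨[.minus]⟩) (Y := ⟨[.minus, .plus, .minus]⟩)
      (Z := ⟨[.minus]⟩)
      ((minus : Cob A) ◁ cup) (cap ▷ minus) = 𝟙 (⟨[.minus]⟩ : Cob A) := by
  refine comp_eq (whiskerLeft_ofPreCob (x := ⟨[]⟩) (y := ⟨[.plus, .minus]⟩) _ _)
    (ofPreCob_whiskerRight (x := ⟨[.minus, .plus]⟩) (y := ⟨[]⟩) _ _)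
    (ofPreCob_eq (x := ⟨[.minus]⟩) (y := ⟨[.minus]⟩) (G := ofEquiv (.refl _) (.refl _)) ?_)
  have hV {V : Type} (w : V) : w ∉ Set.range (Empty.elim : Empty → V) := fun ⟨x, _⟩ => x.elim
  refine
    { v := Empty.elim
      s := Equiv.equivOfIsEmpty Empty ((Empty ⊕ Empty) ⊕ (Empty ⊕ Empty))
      t := Equiv.equivOfIsEmpty Empty ((Empty ⊕ Empty) ⊕ (Empty ⊕ Empty))
      v_injective := fun x => x.elim
      label_v := fun x => x.elim
      label_new := ?_
      next_leads := ?_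
      new_leads := ?_ }
  · rintro (((⟨⟨⟩⟩ | ⟨⟨⟩⟩) | (⟨⟨⟩⟩ | ⟨⟨⟩⟩)) | _) _
    rfl
  · rintro (⟨_ | ⟨_, ⟨⟩⟩⟩ | ⟨_ | ⟨_, ⟨⟩⟩⟩ | ⟨⟨⟩⟩ | ⟨⟨⟩⟩)
    iterate 3 refine Leads.cons _ rfl (hV _) ?_
    exact .of_eq rfl
  · rintro (((⟨⟨⟩⟩ | ⟨⟨⟩⟩) | (⟨⟨⟩⟩ | ⟨⟨⟩⟩))
      | ((_ | ⟨_, _ | ⟨_, _ | ⟨_, ⟨⟩⟩⟩⟩) | (_ | ⟨_, _ | ⟨_, _ | ⟨_, ⟨⟩⟩⟩⟩))) _ <;>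
      refine ⟨.bot (Pos.head _), ?_⟩
    · iterate 2 refine Leads.cons _ rfl (hV _) ?_
      exact .of_eq rfl
    · iterate 1 refine Leads.cons _ rfl (hV _) ?_
      exact .of_eq rfl
    · iterate 3 refine Leads.cons _ rfl (hV _) ?_
      exact .of_eq rfl

/-- An interval with one defect labelled `a` from `+` to `-`, both at the bottom. -/
def dotCap (a : A) : PreCob (toPts (A := A) ⟨[.minus, .plus]⟩) (toPts ⟨[]⟩) where
  V := Unit
  S := Empty
  T := Empty
  label := fun _ => some a
  next :=
    { toFun := fun
        | .bot (.tail _ (.head _)) => .vert ()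
        | .vert _ => .bot (.head _)
      invFun := fun
        | .vert _ => .bot (.tail _ (.head _))
        | .bot (.head _) => .vert ()
      left_inv := by
        rintro (⟨_ | ⟨_, (_ | ⟨_, ⟨⟩⟩)⟩⟩ | ⟨⟨⟩⟩ | ⟨⟨⟩⟩ | _) <;> rfl
      right_inv := by rintro (⟨⟨⟩⟩ | ⟨_ | ⟨_, (_ | ⟨_, ⟨⟩⟩)⟩⟩ | ⟨⟨⟩⟩ | _) <;> rfl }

/-- A dot slides along the cap: a dot on either leg gives the same dotted cap, and `dotPlus_cap` is
the other half. Applying a functor, the values on the two dotted intervals become transposes of each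
other. -/
theorem dotMinus_cap (a : A) : dotMinus a ▷ plus ≫ cap = ofPreCob (dotCap a) := by
  refine comp_eq (ofPreCob_whiskerRight _ _) rfl (ofPreCob_eq (x := ⟨[.minus, .plus]⟩)
    (y := ⟨[]⟩) ?_)
  have hV (w) : Sum.inr w ∉ Set.range fun _ : Unit =>
      (Sum.inl (.inl (.inl ())) : ((Unit ⊕ Empty) ⊕ Empty) ⊕ (Pos .plus [.minus, .plus] ⊕
        Pos .minus [.minus, .plus])) := by rintro ⟨_, ⟨⟩⟩
  refine
    { v := fun _ => .inl (.inl (.inl ()))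
      s := Equiv.equivOfIsEmpty Empty ((Empty ⊕ Empty) ⊕ Empty)
      t := Equiv.equivOfIsEmpty Empty ((Empty ⊕ Empty) ⊕ Empty)
      v_injective := fun _ _ _ => rfl
      label_v := fun _ => rfl
      label_new := ?_
      next_leads := ?_
      new_leads := ?_ }
  · rintro (((_ | ⟨⟨⟩⟩) | ⟨⟨⟩⟩) | _) h
    · exact (h ⟨(), rfl⟩).elim
    · rfl
  · rintro (⟨_ | ⟨_, _ | ⟨_, ⟨⟩⟩⟩⟩ | ⟨⟨⟩⟩ | ⟨⟨⟩⟩ | _)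
    · iterate 2 refine Leads.cons _ rfl (hV _) ?_
      exact .of_eq rfl
    · exact .of_eq rfl
  · rintro (((_ | ⟨⟨⟩⟩) | ⟨⟨⟩⟩) | ((_ | ⟨_, _ | ⟨_, ⟨⟩⟩⟩) | (_ | ⟨_, _ | ⟨_, ⟨⟩⟩⟩))) h
    · exact (h ⟨(), rfl⟩).elim
    · refine ⟨.vert (), ?_⟩
      iterate 2 refine Leads.cons _ rfl (hV _) ?_
      exact .of_eq rfl
    · refine ⟨.vert (), ?_⟩
      iterate 1 refine Leads.cons _ rfl (hV _) ?_
      exact .of_eq rfl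

theorem dotPlus_cap (a : A) : minus ◁ dotPlus a ≫ cap = ofPreCob (dotCap a) := by
  refine comp_eq (whiskerLeft_ofPreCob _ _) rfl (ofPreCob_eq (x := ⟨[.minus, .plus]⟩)
    (y := ⟨[]⟩) ?_)
  have hV (w) : Sum.inr w ∉ Set.range fun _ : Unit =>
      (Sum.inl (.inl (.inr ())) : ((Empty ⊕ Unit) ⊕ Empty) ⊕ (Pos .plus [.minus, .plus] ⊕
        Pos .minus [.minus, .plus])) := by rintro ⟨_, ⟨⟩⟩
  refine
    { v := fun _ => .inl (.inl (.inr ()))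
      s := Equiv.equivOfIsEmpty Empty ((Empty ⊕ Empty) ⊕ Empty)
      t := Equiv.equivOfIsEmpty Empty ((Empty ⊕ Empty) ⊕ Empty)
      v_injective := fun _ _ _ => rfl
      label_v := fun _ => rfl
      label_new := ?_
      next_leads := ?_
      new_leads := ?_ }
  · rintro (((⟨⟨⟩⟩ | _) | ⟨⟨⟩⟩) | _) h
    · exact (h ⟨(), rfl⟩).elim
    · rfl
  · rintro (⟨_ | ⟨_, _ | ⟨_, ⟨⟩⟩⟩⟩ | ⟨⟨⟩⟩ | ⟨⟨⟩⟩ | _)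
    · exact .of_eq rfl
    · iterate 2 refine Leads.cons _ rfl (hV _) ?_
      exact .of_eq rfl
  · rintro (((⟨⟨⟩⟩ | _) | ⟨⟨⟩⟩) | ((_ | ⟨_, _ | ⟨_, ⟨⟩⟩⟩) | (_ | ⟨_, _ | ⟨_, ⟨⟩⟩⟩))) h
    · exact (h ⟨(), rfl⟩).elim
    · refine ⟨.bot (Pos.head _), ?_⟩
      iterate 2 refine Leads.cons _ rfl (hV _) ?_
      exact .of_eq rfl
    · refine ⟨.bot (Pos.head _), ?_⟩
      iterate 1 refine Leads.cons _ rfl (hV _) ?_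
      exact .of_eq rfl

/-- The cap bends a half-interval with its end `-` at the top into one with its end `+` at the
bottom. This ties the remaining half-intervals to the generating ones. -/
theorem halfTopMinus_cap :
    CategoryStruct.comp (X := (⟨[.plus]⟩ : Cob A)) (halfTopMinus ▷ plus) cap = halfBotPlus := by
  refine comp_eq (ofPreCob_whiskerRight (x := ⟨[]⟩) _ _) rfl (ofPreCob_eq (x := ⟨[.plus]⟩)
    (y := ⟨[]⟩) ?_)
  have hV {V : Type} (w : V) : w ∉ Set.range (Empty.elim : Empty → V) := fun ⟨x, _⟩ => x.elim
  refine
    { v := Empty.elim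
      s := Equiv.equivOfIsEmpty Empty ((Empty ⊕ Empty) ⊕ Empty)
      t := (show Unit ≃ (Unit ⊕ Empty) ⊕ Empty from
        ((Equiv.sumEmpty _ Empty).trans (Equiv.sumEmpty _ Empty)).symm)
      v_injective := fun x => x.elim
      label_v := fun x => x.elim
      label_new := ?_
      next_leads := ?_
      new_leads := ?_ }
  · rintro (((⟨⟨⟩⟩ | ⟨⟨⟩⟩) | ⟨⟨⟩⟩) | _) h
    rfl
  · rintro (⟨_ | ⟨_, ⟨⟩⟩⟩ | ⟨⟨⟩⟩ | ⟨⟨⟩⟩ | ⟨⟨⟩⟩)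
    iterate 2 refine Leads.cons _ rfl (hV _) ?_
    exact .of_eq rfl
  · rintro (((⟨⟨⟩⟩ | ⟨⟨⟩⟩) | ⟨⟨⟩⟩) | ((_ | ⟨_, _ | ⟨_, ⟨⟩⟩⟩) | (_ | ⟨_, _ | ⟨_, ⟨⟩⟩⟩))) _ <;>
      refine ⟨.finish (), ?_⟩
    · iterate 2 refine Leads.cons _ rfl (hV _) ?_
      exact .of_eq rfl
    · iterate 1 refine Leads.cons _ rfl (hV _) ?_
      exact .of_eq rfl

theorem halfTopPlus_cap :
    CategoryStruct.comp (X := (⟨[.minus]⟩ : Cob A)) (minus ◁ halfTopPlus) cap = halfBotMinus := by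
  refine comp_eq (whiskerLeft_ofPreCob (x := ⟨[]⟩) _ _) rfl (ofPreCob_eq (x := ⟨[.minus]⟩)
    (y := ⟨[]⟩) ?_)
  have hV {V : Type} (w : V) : w ∉ Set.range (Empty.elim : Empty → V) := fun ⟨x, _⟩ => x.elim
  refine
    { v := Empty.elim
      s := (show Unit ≃ (Empty ⊕ Unit) ⊕ Empty from
        ((Equiv.sumEmpty _ Empty).trans (Equiv.emptySum Empty _)).symm)
      t := Equiv.equivOfIsEmpty Empty ((Empty ⊕ Empty) ⊕ Empty)
      v_injective := fun x => x.elim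
      label_v := fun x => x.elim
      label_new := ?_
      next_leads := ?_
      new_leads := ?_ }
  · rintro (((⟨⟨⟩⟩ | ⟨⟨⟩⟩) | ⟨⟨⟩⟩) | _) h
    rfl
  · rintro (⟨_ | ⟨_, ⟨⟩⟩⟩ | ⟨⟨⟩⟩ | _ | ⟨⟨⟩⟩)
    iterate 2 refine Leads.cons _ rfl (hV _) ?_
    exact .of_eq rfl
  · rintro (((⟨⟨⟩⟩ | ⟨⟨⟩⟩) | ⟨⟨⟩⟩) | ((_ | ⟨_, _ | ⟨_, ⟨⟩⟩⟩) | (_ | ⟨_, _ | ⟨_, ⟨⟩⟩⟩))) _ <;>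
      refine ⟨.bot (Pos.head _), ?_⟩
    · iterate 2 refine Leads.cons _ rfl (hV _) ?_
      exact .of_eq rfl
    · iterate 1 refine Leads.cons _ rfl (hV _) ?_
      exact .of_eq rfl

end Cob

namespace Cob

theorem rightUnitor_inv_singleton (s : Sgn) :
    (ρ_ (⟨[s]⟩ : Cob A)).inv = 𝟙 (⟨[s]⟩ : Cob A) := by
  have := (ρ_ (⟨[s]⟩ : Cob A)).inv_hom_id
  rw [rightUnitor_singleton] at this
  exact (Category.comp_id _).symm.trans this

theorem leftUnitor_inv_eq (x : Cob A) : (λ_ x).inv = 𝟙 x := by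
  have := (λ_ x).inv_hom_id
  rw [leftUnitor_eq] at this
  exact (Category.comp_id _).symm.trans this

theorem associator_inv_cons (s : Sgn) (l m : List Sgn) :
    (α_ (⟨[s]⟩ : Cob A) ⟨l⟩ ⟨m⟩).inv = 𝟙 (⟨s :: (l ++ m)⟩ : Cob A) := by
  have := (α_ (⟨[s]⟩ : Cob A) ⟨l⟩ ⟨m⟩).inv_hom_id
  rw [associator_cons] at this
  exact (Category.comp_id _).symm.trans this

/-- The zigzag with its associator and unitors written out, in the form that can be transported
along any monoidal functor. On these objects they are all identities. -/
theorem cup_cap_plus : cup ▷ plus ≫ (α_ plus minus plus).hom ≫ plus ◁ cap =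
    (λ_ (plus : Cob A)).hom ≫ (ρ_ (plus : Cob A)).inv := by
  rw [leftUnitor_eq, rightUnitor_inv_singleton]
  refine Eq.trans ?_ (zigzag_plus.trans (Category.comp_id _).symm)
  refine congrArg (_ ≫ ·) ?_
  exact (congrArg (· ≫ _) (associator_cons .plus [.minus] [.plus])).trans (Category.id_comp _)

theorem cup_cap_minus : minus ◁ cup ≫ (α_ minus plus minus).inv ≫ cap ▷ minus =
    (ρ_ (minus : Cob A)).hom ≫ (λ_ (minus : Cob A)).inv := by
  rw [leftUnitor_inv_eq, rightUnitor_singleton]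
  refine Eq.trans ?_ (zigzag_minus.trans (Category.comp_id _).symm)
  refine congrArg (_ ≫ ·) ?_
  exact (congrArg (· ≫ _) (associator_inv_cons .minus [.plus] [.minus])).trans (Category.id_comp _)

theorem halfTopMinus_whiskerRight_cap :
    halfTopMinus ▷ plus ≫ cap = (λ_ (plus : Cob A)).hom ≫ halfBotPlus := by
  rw [leftUnitor_eq]
  exact halfTopMinus_cap.trans (Category.id_comp _).symm

theorem whiskerLeft_halfTopPlus_cap :
    minus ◁ halfTopPlus ≫ cap = (ρ_ (minus : Cob A)).hom ≫ halfBotMinus := by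
  rw [rightUnitor_singleton]
  exact halfTopPlus_cap.trans (Category.id_comp _).symm

end Cob

/-! ### Transport of duality relations along a monoidal functor. -/

section Pairing

universe v₁ v₂ u₁ u₂

variable {C : Type u₁} [Category.{v₁} C] [MonoidalCategory C] {D : Type u₂} [Category.{v₂} D]
  [MonoidalCategory D] (F : C ⥤ D) [F.Monoidal] {X Y : C} {c : 𝟙_ C ⟶ X ⊗ Y} {e : Y ⊗ X ⟶ 𝟙_ C}

/-- Monoidal functors preserve dual pairs: the tensorators in the middle cancel against each other,
and the unit constraints turn the images of `c` and `e` into a coevaluation and an evaluation. -/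
theorem map_zigzag (h : c ▷ X ≫ (α_ X Y X).hom ≫ X ◁ e = (λ_ X).hom ≫ (ρ_ X).inv) :
    (ε F ≫ F.map c ≫ δ F X Y) ▷ F.obj X ≫ (α_ _ _ _).hom ≫
      F.obj X ◁ (μ F Y X ≫ F.map e ≫ η F) = (λ_ (F.obj X)).hom ≫ (ρ_ (F.obj X)).inv := by
  have h' := congrArg F.map h
  simp only [F.map_comp, Functor.Monoidal.map_whiskerRight, Functor.Monoidal.map_associator,
    Functor.Monoidal.map_whiskerLeft, Functor.Monoidal.map_leftUnitor,
    Functor.Monoidal.map_rightUnitor_inv, Category.assoc, Functor.Monoidal.μ_δ_assoc,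
    cancel_epi] at h'
  simp only [← Category.assoc, cancel_mono] at h'
  have h'' := ε F ▷ F.obj X ≫= h' =≫ F.obj X ◁ η F
  simpa using h''

theorem map_zigzag' (h : Y ◁ c ≫ (α_ Y X Y).inv ≫ e ▷ Y = (ρ_ Y).hom ≫ (λ_ Y).inv) :
    F.obj Y ◁ (ε F ≫ F.map c ≫ δ F X Y) ≫ (α_ _ _ _).inv ≫
      (μ F Y X ≫ F.map e ≫ η F) ▷ F.obj Y = (ρ_ (F.obj Y)).hom ≫ (λ_ (F.obj Y)).inv := by
  have h' := congrArg F.map h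
  simp only [F.map_comp, Functor.Monoidal.map_whiskerRight, Functor.Monoidal.map_associator_inv,
    Functor.Monoidal.map_whiskerLeft, Functor.Monoidal.map_leftUnitor_inv,
    Functor.Monoidal.map_rightUnitor, Category.assoc, Functor.Monoidal.μ_δ_assoc,
    cancel_epi] at h'
  simp only [← Category.assoc, cancel_mono] at h'
  have h'' := F.obj Y ◁ ε F ≫= h' =≫ η F ▷ F.obj Y
  simpa using h''

theorem map_bend {f : 𝟙_ C ⟶ Y} {g : X ⟶ 𝟙_ C} (h : f ▷ X ≫ e = (λ_ X).hom ≫ g) :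
    (ε F ≫ F.map f) ▷ F.obj X ≫ μ F Y X ≫ F.map e ≫ η F = (λ_ (F.obj X)).hom ≫ F.map g ≫ η F := by
  rw [comp_whiskerRight, Category.assoc, Functor.LaxMonoidal.μ_natural_left_assoc,
    ← F.map_comp_assoc, h, F.map_comp_assoc, Functor.LaxMonoidal.left_unitality]
  simp only [Category.assoc]

theorem map_bend' {f : 𝟙_ C ⟶ X} {g : Y ⟶ 𝟙_ C} (h : Y ◁ f ≫ e = (ρ_ Y).hom ≫ g) :
    F.obj Y ◁ (ε F ≫ F.map f) ≫ μ F Y X ≫ F.map e ≫ η F = (ρ_ (F.obj Y)).hom ≫ F.map g ≫ η F := by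
  rw [MonoidalCategory.whiskerLeft_comp, Category.assoc,
    Functor.LaxMonoidal.μ_natural_right_assoc,
    ← F.map_comp_assoc, h, F.map_comp_assoc, Functor.LaxMonoidal.right_unitality]
  simp only [Category.assoc]

end Pairing

/-! ### Duality between the values at `+` and `-`. -/

namespace TQFT

variable (F : TQFT A)

/-- The value at a positive point. -/
abbrev posObj : FreeMod := F.toFunctor.obj Cob.plus

/-- The value at a negative point. -/
abbrev negObj : FreeMod := F.toFunctor.obj Cob.minus

/-- The value of the cap, as a morphism. -/
def capHom : F.negObj ⊗ F.posObj ⟶ 𝟙_ FreeMod :=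
  μ F.toFunctor Cob.minus Cob.plus ≫ F.toFunctor.map Cob.cap ≫ η F.toFunctor

/-- The value of the cup, as a morphism. -/
def cupHom : 𝟙_ FreeMod ⟶ F.posObj ⊗ F.negObj :=
  ε F.toFunctor ≫ F.toFunctor.map Cob.cup ≫ δ F.toFunctor Cob.plus Cob.minus

/-- The pairing given by the cap. -/
def ev : F.negObj.obj →ₗ[𝔹] F.posObj.obj →ₗ[𝔹] 𝔹 :=
  TensorProduct.curry (lin F.capHom : F.negObj.obj ⊗[𝔹] F.posObj.obj →ₗ[𝔹] 𝔹)

/-- Once the image of the cup is a finite sum of pure tensors, the two zigzag relations expand every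
vector at `+` and at `-` in the factors of these tensors. Finite generation and perfectness of the
pairing both come from here. -/
theorem exists_cup : ∃ S : Finset (F.posObj.obj × F.negObj.obj),
    (lin F.cupHom (1 : 𝔹) : F.posObj.obj ⊗[𝔹] F.negObj.obj) = ∑ p ∈ S, p.1 ⊗ₜ[𝔹] p.2 ∧
    (∀ x, ∑ p ∈ S, F.ev p.2 x • p.1 = x) ∧ ∀ y, ∑ p ∈ S, F.ev y p.1 • p.2 = y := by
  obtain ⟨S, hS⟩ := TensorProduct.exists_finset
    (lin F.cupHom (1 : 𝔹) : F.posObj.obj ⊗[𝔹] F.negObj.obj)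
  refine ⟨S, hS, fun x => ?_, fun y => ?_⟩
  · have h : F.cupHom ▷ F.posObj ≫ (α_ _ _ _).hom ≫ F.posObj ◁ F.capHom ≫ (ρ_ _).hom =
        (λ_ _).hom := by
      have h := map_zigzag F.toFunctor Cob.cup_cap_plus =≫ (ρ_ _).hom
      simp only [Category.assoc, Iso.inv_hom_id, Category.comp_id] at h
      exact h
    -- `L` contracts the last two factors by the pairing, so the zigzag says that `L` sends the cup
    -- tensored with `x` back to `x`.
    let L : (F.posObj.obj ⊗[𝔹] F.negObj.obj) ⊗[𝔹] F.posObj.obj →ₗ[𝔹] F.posObj.obj :=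
      lin ((α_ _ _ _).hom ≫ F.posObj ◁ F.capHom ≫ (ρ_ _).hom)
    have hL (v : F.posObj.obj) (w : F.negObj.obj) : L ((v ⊗ₜ[𝔹] w) ⊗ₜ[𝔹] x) = F.ev w x • v := rfl
    have h1 : L ((show F.posObj.obj ⊗[𝔹] F.negObj.obj from lin F.cupHom (1 : 𝔹)) ⊗ₜ[𝔹] x) = x :=
      (congrArg (fun f => lin f ((1 : 𝔹) ⊗ₜ[𝔹] x)) h).trans (one_smul 𝔹 x)
    clear_value L
    refine Eq.trans ?_ h1
    simp only [hS, TensorProduct.sum_tmul, map_sum, hL]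
  · have h : F.negObj ◁ F.cupHom ≫ (α_ _ _ _).inv ≫ F.capHom ▷ F.negObj ≫ (λ_ _).hom =
        (ρ_ _).hom := by
      have h := map_zigzag' F.toFunctor Cob.cup_cap_minus =≫ (λ_ _).hom
      simp only [Category.assoc, Iso.inv_hom_id, Category.comp_id] at h
      exact h
    let L : F.negObj.obj ⊗[𝔹] (F.posObj.obj ⊗[𝔹] F.negObj.obj) →ₗ[𝔹] F.negObj.obj :=
      lin ((α_ _ _ _).inv ≫ F.capHom ▷ F.negObj ≫ (λ_ _).hom)
    have hL (v : F.posObj.obj) (w : F.negObj.obj) : L (y ⊗ₜ[𝔹] (v ⊗ₜ[𝔹] w)) = F.ev y v • w := rfl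
    have h1 : L (y ⊗ₜ[𝔹] (show F.posObj.obj ⊗[𝔹] F.negObj.obj from lin F.cupHom (1 : 𝔹))) = y :=
      (congrArg (fun f => lin f (y ⊗ₜ[𝔹] (1 : 𝔹))) h).trans (one_smul 𝔹 y)
    clear_value L
    refine Eq.trans ?_ h1
    simp only [hS, TensorProduct.tmul_sum, map_sum, hL]

theorem ev_dotMinus (a : A) (y x) : F.ev (lin (F.toFunctor.map (Cob.dotMinus a)) y) x =
    F.ev y (lin (F.toFunctor.map (Cob.dotPlus a)) x) := by
  have h : F.toFunctor.map (Cob.dotMinus a) ▷ _ ≫ F.capHom =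
      _ ◁ F.toFunctor.map (Cob.dotPlus a) ≫ F.capHom := by
    rw [capHom, Functor.LaxMonoidal.μ_natural_left_assoc,
      Functor.LaxMonoidal.μ_natural_right_assoc, ← F.toFunctor.map_comp_assoc,
      ← F.toFunctor.map_comp_assoc, Cob.dotMinus_cap, Cob.dotPlus_cap]
  exact congrArg (fun f => lin f (y ⊗ₜ[𝔹] x)) h

theorem ev_halfTopMinus (x) :
    F.ev (lin (ε F.toFunctor ≫ F.toFunctor.map Cob.halfTopMinus) (1 : 𝔹)) x =
      lin (F.toFunctor.map Cob.halfBotPlus ≫ η F.toFunctor) x := by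
  have h := congrArg (fun f => lin f ((1 : 𝔹) ⊗ₜ[𝔹] x))
    (map_bend F.toFunctor Cob.halfTopMinus_whiskerRight_cap)
  exact h.trans (congrArg (lin (F.toFunctor.map Cob.halfBotPlus ≫ η F.toFunctor)) (one_smul 𝔹 x))

theorem ev_halfTopPlus (y) :
    F.ev y (lin (ε F.toFunctor ≫ F.toFunctor.map Cob.halfTopPlus) (1 : 𝔹)) =
      lin (F.toFunctor.map Cob.halfBotMinus ≫ η F.toFunctor) y := by
  have h := congrArg (fun f => lin f (y ⊗ₜ[𝔹] (1 : 𝔹)))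
    (map_bend' F.toFunctor Cob.whiskerLeft_halfTopPlus_cap)
  exact h.trans (congrArg (lin (F.toFunctor.map Cob.halfBotMinus ≫ η F.toFunctor)) (one_smul 𝔹 y))

end TQFT

namespace TQFT

open Functor.LaxMonoidal Functor.OplaxMonoidal

variable (F : TQFT A)

/-- The inverse is `f ↦ ∑ f(v) w` over the tensors `v ⊗ w` of the cup. Injectivity uses the
expansion at `-`, surjectivity the one at `+`. -/
theorem ev_bijective : Function.Bijective F.ev := by
  obtain ⟨S, -, h1, h2⟩ := F.exists_cup
  constructor
  · intro y y' h
    rw [← h2 y, ← h2 y', h]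
  · intro f
    refine ⟨∑ p ∈ S, f p.1 • p.2, LinearMap.ext fun x => ?_⟩
    simp only [map_sum, map_smul, LinearMap.sum_apply, LinearMap.smul_apply]
    conv_rhs => rw [← h1 x]
    simp only [map_sum, map_smul, smul_eq_mul]
    exact Finset.sum_congr rfl fun p _ => mul_comm _ _

/-- The value at a negative point is dual to the value at a positive point. -/
noncomputable def negEquiv : F.negObj.obj ≃ₗ[𝔹] Module.Dual 𝔹 F.posObj.obj :=
  LinearEquiv.ofBijective F.ev F.ev_bijective

theorem dual_eq_sum {ι : Type} [Fintype ι] (f : Module.Dual 𝔹 (ι →₀ 𝔹)) :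
    f = ∑ i, f (Finsupp.single i 1) • Finsupp.lapply i := by
  classical
  refine Finsupp.lhom_ext' fun i => LinearMap.ext_ring ?_
  simp [Finsupp.single_apply]

/-- Compatibility with the cap and with three of the half-intervals and dotted intervals determines
the other values. -/
theorem exists_realization {Q : Automaton A} (pos : F.posObj.obj ≃ₗ[𝔹] Q.Vec)
    (h_dot : ∀ a x, pos (lin (F.toFunctor.map (Cob.dotPlus a)) x) = Q.act a (pos x))
    (h_top : pos (lin (ε F.toFunctor ≫ F.toFunctor.map Cob.halfTopPlus) (1 : 𝔹)) = Q.initVec)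
    (h_bot : ∀ x, lin (F.toFunctor.map Cob.halfBotPlus ≫ η F.toFunctor) x = Q.acceptFun (pos x)) :
    Nonempty (Realization Q F) := by
  classical
  -- The required value of the cap forces this choice, and conversely makes the cap correct at once.
  let neg : F.negObj.obj ≃ₗ[𝔹] Module.Dual 𝔹 Q.Vec := F.negEquiv ≪≫ₗ pos.symm.dualMap
  have hneg (y v) : neg y v = F.ev y (pos.symm v) := rfl
  refine ⟨⟨pos, neg, h_dot, fun a y => LinearMap.ext fun v => ?_, ?_, fun y x => ?_, h_top, h_bot,
    LinearMap.ext fun v => ?_, fun y => ?_⟩⟩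
  · rw [hneg, ev_dotMinus, LinearMap.dualMap_apply, hneg]
    congr 1
    rw [LinearEquiv.eq_symm_apply, h_dot, LinearEquiv.apply_symm_apply]
  · have := Fintype.ofFinite Q.State
    obtain ⟨S, hS, h1, -⟩ := F.exists_cup
    rw [finsum_eq_sum_of_fintype]
    refine hS.trans ?_
    -- Each right factor of the cup is expanded in the dual basis. Moving the scalars to the left
    -- factors and summing over `S` first produces the basis vectors by `h1`.
    have hw (w) : w = ∑ q, F.ev w (pos.symm (Q.basis q)) • neg.symm (Finsupp.lapply q) := by
      apply neg.injective
      simp only [map_sum, map_smul, LinearEquiv.apply_symm_apply]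
      exact dual_eq_sum _
    have h2 (p : F.posObj.obj × F.negObj.obj) : p.1 ⊗ₜ[𝔹] p.2 =
        ∑ q, (F.ev p.2 (pos.symm (Q.basis q)) • p.1) ⊗ₜ[𝔹] neg.symm (Finsupp.lapply q) := by
      conv_lhs => rw [hw p.2, TensorProduct.tmul_sum]
      exact Finset.sum_congr rfl fun q _ => by rw [TensorProduct.smul_tmul]
    rw [Finset.sum_congr rfl fun p _ => h2 p, Finset.sum_comm]
    refine Finset.sum_congr rfl fun q _ => ?_
    rw [← TensorProduct.sum_tmul, h1]
  · exact (congrArg (F.ev y) (pos.symm_apply_apply x)).symm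
  · rw [hneg, ev_halfTopMinus, h_bot, LinearEquiv.apply_symm_apply]
  · rw [hneg, ← h_top, LinearEquiv.symm_apply_apply, ev_halfTopPlus]

end TQFT

/-! ### Coordinates of the linear data, and the automaton of a functor. -/

namespace Automaton

variable (Q : Automaton A)

theorem sumVec_eq_one {s : Set Q.State} {q : Q.State} : Q.sumVec s q = 1 ↔ q ∈ s := by
  classical
  rw [sumVec, Finsupp.finsetSum_apply, 𝔹.sum_eq_one]
  simp only [Set.Finite.mem_toFinset, basis, Finsupp.single_apply]
  constructor
  · rintro ⟨q', h, h'⟩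
    split_ifs at h' with hq
    exact hq ▸ h
  · exact fun h => ⟨q, h, if_pos rfl⟩

theorem act_eq_one {a : A} {x : Q.Vec} {q : Q.State} :
    Q.act a x q = 1 ↔ ∃ p, x p = 1 ∧ q ∈ Q.nfa.step p a := by
  rw [act, linearCombination_eq_one]
  simp only [sumVec_eq_one]

theorem initVec_eq_one {q : Q.State} : Q.initVec q = 1 ↔ q ∈ Q.nfa.start := Q.sumVec_eq_one

theorem acceptFun_eq_one {x : Q.Vec} : Q.acceptFun x = 1 ↔ ∃ q, x q = 1 ∧ q ∈ Q.nfa.accept := by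
  classical
  rw [acceptFun, Finsupp.linearCombination_apply, Finsupp.sum, 𝔹.sum_eq_one]
  simp only [smul_eq_mul, 𝔹.mul_eq_one]
  constructor
  · rintro ⟨q, -, h, h'⟩
    by_contra! hq
    rw [Set.indicator_of_notMem (hq q h)] at h'
    exact 𝔹.zero_ne_one h'
  · rintro ⟨q, h, h'⟩
    refine ⟨q, ?_, h, Set.indicator_of_mem h' _⟩
    rw [Finsupp.mem_support_iff, h]
    exact 𝔹.zero_ne_one.symm

end Automaton

namespace TQFT

open Functor.LaxMonoidal Functor.OplaxMonoidal

/-- The value at `+` is free by assumption and finitely generated by duality, so it has a finite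
basis, which serves as the set of states. A Boolean vector is the subset of the basis where its
coordinate is `1`, so the generators yield exactly the data of an automaton. -/
theorem exists_automaton (F : TQFT A) : ∃ Q : Automaton A, Nonempty (Realization Q F) := by
  classical
  have hfree : Module.Free 𝔹 F.posObj.obj := F.posObj.property
  have hfin : Module.Finite 𝔹 F.posObj.obj := by
    obtain ⟨S, -, h, -⟩ := F.exists_cup
    -- The left factors of the cup span, by the expansion from the zigzag.
    refine ⟨S.image Prod.fst, top_le_iff.1 fun x _ => ?_⟩
    rw [← h x]
    exact Submodule.sum_mem _ fun p hp => Submodule.smul_mem _ _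
      (Submodule.subset_span (Finset.mem_coe.2 (Finset.mem_image_of_mem _ hp)))
  let b := Module.Free.chooseBasis 𝔹 F.posObj.obj
  have : Finite (Module.Free.ChooseBasisIndex 𝔹 F.posObj.obj) := inferInstance
  let Q : Automaton A :=
    { State := Module.Free.ChooseBasisIndex 𝔹 F.posObj.obj
      nfa :=
        { step := fun q a => {q' | b.repr (lin (F.toFunctor.map (Cob.dotPlus a)) (b q)) q' = 1}
          start := {q | b.repr (lin (ε F.toFunctor ≫ F.toFunctor.map Cob.halfTopPlus)
            (1 : 𝔹)) q = 1}
          accept := {q | lin (F.toFunctor.map Cob.halfBotPlus ≫ η F.toFunctor) (b q) = (1 : 𝔹)} } }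
  refine ⟨Q, F.exists_realization (Q := Q) b.repr ?_ ?_ ?_⟩
  · intro a
    suffices h : b.repr.toLinearMap ∘ₗ lin (F.toFunctor.map (Cob.dotPlus a)) =
      Q.act a ∘ₗ b.repr.toLinearMap from LinearMap.congr_fun h
    refine b.ext fun q => finsupp_ext fun q' => ?_
    refine Iff.trans ?_ Q.act_eq_one.symm
    simp only [LinearEquiv.coe_coe, Module.Basis.repr_self, Finsupp.single_apply]
    constructor
    · exact fun h => ⟨q, if_pos rfl, h⟩
    · rintro ⟨p, hp, h⟩
      split_ifs at hp with hq
      exact hq ▸ h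
  · exact finsupp_ext fun q => Q.initVec_eq_one.symm
  · suffices h : lin (F.toFunctor.map Cob.halfBotPlus ≫ η F.toFunctor) =
      Q.acceptFun ∘ₗ b.repr.toLinearMap from LinearMap.congr_fun h
    refine b.ext fun q => 𝔹.ext_iff.2 ?_
    refine Iff.trans ?_ Q.acceptFun_eq_one.symm
    simp only [LinearEquiv.coe_coe, Module.Basis.repr_self, Finsupp.single_apply]
    constructor
    · exact fun h => ⟨q, if_pos rfl, h⟩
    · rintro ⟨p, hp, h⟩
      split_ifs at hp with hq
      exact hq ▸ h

end TQFT

/-! ### Values of the state sum on the generators. -/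

namespace Automaton

variable (Q : Automaton A)

/-- Colourings of a positively oriented point are states. -/
def coloringPlus (S : Type) : (Cob.toPts (A := A) Cob.plus).Coloring S ≃ S where
  toFun d := d.1 (.head _)
  invFun q := (fun _ => q, fun i => nomatch i)
  left_inv _ := Prod.ext (funext fun | .head _ => rfl) (funext fun i => nomatch i)
  right_inv _ := rfl

theorem stateRel_dotPlus (a : A) (c d) : Q.stateRel (Cob.dotPlus a).hom c d ↔
    d.1 (.head _) ∈ Q.nfa.step (c.1 (.head _)) a := by
  constructor
  · rintro ⟨e, e', he⟩
    have h := he.dot () a rfl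
    rw [← he.next] at h
    rw [← he.tgt_top, ← he.src_bot, ← he.next]
    exact h
  · intro h
    refine ⟨fun
      | .bot p => c.1 p
      | .vert _ => d.1 (.head _), fun
      | .top p => d.1 p
      | .vert _ => c.1 (.head _), ?_, fun _ => rfl, (fun i => nomatch i), nofun, fun _ => rfl,
        (fun i => nomatch i), nofun, nofun, ?_⟩
    · rintro (⟨_ | ⟨_, ⟨⟩⟩⟩ | ⟨_ | ⟨_, ⟨⟩⟩⟩ | ⟨⟨⟩⟩ | _) <;> rfl
    · rintro _ _ ⟨⟩
      exact h

theorem stateRel_halfTopPlus (c₀ d) : Q.stateRel (Cob.halfTopPlus (A := A)).hom c₀ d ↔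
    d.1 (.head _) ∈ Q.nfa.start := by
  constructor
  · rintro ⟨e, e', he⟩
    have h := he.start ()
    rw [← he.next] at h
    rw [← he.tgt_top]
    exact h
  · intro h
    refine ⟨fun
      | .start _ => d.1 (.head _), fun
      | .top p => d.1 p, ?_, (fun i => nomatch i), (fun i => nomatch i), fun _ => h, fun _ => rfl,
        (fun i => nomatch i), nofun, nofun, nofun⟩
    rintro (⟨⟨⟩⟩ | ⟨_ | ⟨_, ⟨⟩⟩⟩ | _ | ⟨⟨⟩⟩)
    rfl

theorem stateRel_halfBotPlus (c d) : Q.stateRel (Cob.halfBotPlus (A := A)).hom c d ↔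
    c.1 (.head _) ∈ Q.nfa.accept := by
  constructor
  · rintro ⟨e, e', he⟩
    have h := he.accept ()
    rw [← he.src_bot, ← he.next]
    exact h
  · intro h
    refine ⟨fun
      | .bot p => c.1 p, fun
      | .finish _ => c.1 (.head _), ?_, fun _ => rfl, (fun i => nomatch i), nofun,
        (fun i => nomatch i), (fun i => nomatch i), fun _ => h, nofun, nofun⟩
    rintro (⟨_ | ⟨_, ⟨⟩⟩⟩ | ⟨⟨⟩⟩ | ⟨⟨⟩⟩ | ⟨⟨⟩⟩)
    rfl

/-- By `TQFT.exists_realization` only the upward dotted interval and the two half-intervals at `+`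
have to be computed. For each of them the existence of a colouring is a single membership condition.
-/
theorem exists_realization_tqft : Nonempty (TQFT.Realization Q Q.tqft) := by
  let pos : ((Cob.toPts (A := A) Cob.plus).Coloring Q.State →₀ 𝔹) ≃ₗ[𝔹] Q.Vec :=
    Finsupp.domLCongr (coloringPlus Q.State)
  have hpos (x) (c : (Cob.toPts (A := A) Cob.plus).Coloring Q.State) :
      pos x (c.1 (.head _)) = x c :=
    congrArg x ((coloringPlus Q.State).symm_apply_apply c)
  have hε (c) : (show (Cob.toPts (A := A) ⟨[]⟩).Coloring Q.State →₀ 𝔹 from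
      lin (Functor.LaxMonoidal.ε Q.tqft.toFunctor) (1 : 𝔹)) c = 1 :=
    (stateMap_isoOfEquiv _ _ _ _).trans (stateε_apply _ _)
  have hη (x : (Cob.toPts (A := A) ⟨[]⟩).Coloring Q.State →₀ 𝔹) :
      lin (Functor.OplaxMonoidal.η Q.tqft.toFunctor) x =
        x ((fun i => nomatch i), (fun i => nomatch i)) := by
    refine (stateMap_isoOfEquiv _ _ x _).trans (congrArg x ?_)
    exact Subsingleton.elim _ _
  refine TQFT.exists_realization _ (Q := Q) pos ?_ ?_ ?_
  · intro a x
    refine finsupp_ext fun q => (stateMap_eq_one _ _ _).trans (Iff.trans ?_ Q.act_eq_one.symm)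
    constructor
    · rintro ⟨c, h1, h2⟩
      exact ⟨c.1 (.head _), (hpos x c).trans h1,
        (Q.stateRel_dotPlus a _ _).1 h2⟩
    · rintro ⟨p, h1, h2⟩
      exact ⟨(coloringPlus Q.State).symm p, h1, (Q.stateRel_dotPlus a _ _).2 h2⟩
  · refine finsupp_ext fun q => (stateMap_eq_one _ _ _).trans (Iff.trans ?_ Q.initVec_eq_one.symm)
    constructor
    · rintro ⟨c, -, h2⟩
      exact (Q.stateRel_halfTopPlus _ _).1 h2
    · exact fun h => ⟨((fun i => nomatch i), (fun i => nomatch i)), hε _,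
        (Q.stateRel_halfTopPlus _ _).2 h⟩
  · intro x
    refine (hη (Q.stateMap Cob.halfBotPlus.hom x)).trans
      (𝔹.ext_iff.2 ((stateMap_eq_one _ _ _).trans (Iff.trans ?_ Q.acceptFun_eq_one.symm)))
    constructor
    · rintro ⟨c, h1, h2⟩
      exact ⟨c.1 (.head _), (hpos x c).trans h1,
        (Q.stateRel_halfBotPlus _ _).1 h2⟩
    · rintro ⟨p, h1, h2⟩
      exact ⟨(coloringPlus Q.State).symm p, h1, (Q.stateRel_halfBotPlus _ _).2 h2⟩

end Automaton

/-! ### Uniqueness of bases over the Boolean semiring. -/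

section Basis

variable {α β : Type}

/-- The relation `x + y = y` is the inclusion order on supports, and additive bijections preserve
it. Basis vectors are its minimal nonzero elements, hence go to basis vectors. -/
theorem exists_single_of_linearEquiv (E : (α →₀ 𝔹) ≃ₗ[𝔹] (β →₀ 𝔹)) (a : α) :
    ∃ b, E (Finsupp.single a 1) = Finsupp.single b 1 := by
  classical
  have h0 : E (Finsupp.single a 1) ≠ 0 := by
    rw [ne_eq, E.map_eq_zero_iff, Finsupp.single_eq_zero]
    exact 𝔹.zero_ne_one.symm
  obtain ⟨b, hb⟩ := Finsupp.ne_iff.1 h0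
  have hb' := (𝔹.eq_zero_or_one _).resolve_left hb
  -- A basis vector `b` in the support of the image of `a` lies below that image.
  have h1 : E (Finsupp.single a 1) + Finsupp.single b 1 = E (Finsupp.single a 1) := by
    refine finsupp_ext fun c => ?_
    rw [Finsupp.add_apply, 𝔹.add_eq_one, Finsupp.single_apply]
    refine or_iff_left_of_imp fun h => ?_
    split_ifs at h with hc
    exact hc ▸ hb'
  refine ⟨b, E.symm.injective ?_⟩
  have h2 := congrArg E.symm h1
  rw [map_add, E.symm_apply_apply] at h2
  rw [E.symm_apply_apply]
  have h3 : E.symm (Finsupp.single b 1) ≠ 0 := by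
    rw [ne_eq, E.symm.map_eq_zero_iff, Finsupp.single_eq_zero]
    exact 𝔹.zero_ne_one.symm
  obtain ⟨a', ha'⟩ := Finsupp.ne_iff.1 h3
  have ha'' := (𝔹.eq_zero_or_one _).resolve_left ha'
  -- Pulled back, the preimage of `b` lies below `a`; being nonzero, it must be `a`.
  have h4 (c) (hc : E.symm (Finsupp.single b 1) c = 1) : a = c := by
    have h := DFunLike.congr_fun h2 c
    rw [Finsupp.add_apply, hc, Finsupp.single_apply] at h
    by_contra hne
    rw [if_neg hne] at h
    exact 𝔹.zero_ne_one h.symm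
  refine finsupp_ext fun c => ⟨fun h => ?_, fun h => ?_⟩
  · rw [Finsupp.single_apply] at h
    split_ifs at h with hc
    rw [← hc, h4 a' ha'']
    exact ha''
  · rw [h4 c h, Finsupp.single_eq_same]

/-- Linear equivalences of free modules over the Boolean semiring permute the basis vectors. -/
theorem exists_equiv_of_linearEquiv (E : (α →₀ 𝔹) ≃ₗ[𝔹] (β →₀ 𝔹)) :
    ∃ e : α ≃ β, E = Finsupp.domLCongr e := by
  choose f hf using exists_single_of_linearEquiv E
  choose g hg using exists_single_of_linearEquiv E.symm
  have key {γ : Type} {x y : γ} (h : Finsupp.single x (1 : 𝔹) = Finsupp.single y 1) : x = y :=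
    Finsupp.single_left_injective 𝔹.zero_ne_one.symm h
  refine ⟨⟨f, g, fun a => key ?_, fun b => key ?_⟩, ?_⟩
  · rw [← hg, ← hf, E.symm_apply_apply]
  · rw [← hf, ← hg, E.apply_symm_apply]
  · refine LinearEquiv.toLinearMap_injective (Finsupp.lhom_ext' fun a => LinearMap.ext_ring ?_)
    simp [hf]

theorem domLCongr_apply_apply (e : α ≃ β) (x : α →₀ 𝔹) (a : α) :
    (Finsupp.domLCongr e : (α →₀ 𝔹) ≃ₗ[𝔹] (β →₀ 𝔹)) x (e a) = x a := by
  simp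

end Basis

/-! ### Realizations compared along isomorphisms. -/

namespace Automaton

theorem Iso.act_domLCongr {Q R : Automaton A} (e : Iso Q R) (a : A) (x : Q.Vec) :
    R.act a (Finsupp.domLCongr (R := 𝔹) e.toEquiv x) =
      Finsupp.domLCongr (R := 𝔹) e.toEquiv (Q.act a x) := by
  refine finsupp_ext fun r => ?_
  obtain ⟨q, rfl⟩ := e.toEquiv.surjective r
  rw [act_eq_one, domLCongr_apply_apply, act_eq_one, ← e.toEquiv.exists_congr_right]
  simp only [domLCongr_apply_apply, e.step_iff]

theorem Iso.initVec_eq {Q R : Automaton A} (e : Iso Q R) :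
    R.initVec = Finsupp.domLCongr (R := 𝔹) e.toEquiv Q.initVec := by
  refine finsupp_ext fun r => ?_
  obtain ⟨q, rfl⟩ := e.toEquiv.surjective r
  rw [initVec_eq_one, domLCongr_apply_apply, initVec_eq_one, e.start_iff]

theorem Iso.acceptFun_domLCongr {Q R : Automaton A} (e : Iso Q R) (x : Q.Vec) :
    R.acceptFun (Finsupp.domLCongr (R := 𝔹) e.toEquiv x) = Q.acceptFun x := by
  rw [𝔹.ext_iff, acceptFun_eq_one, acceptFun_eq_one, ← e.toEquiv.exists_congr_right]
  simp only [domLCongr_apply_apply, e.accept_iff]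

end Automaton

namespace TQFT

open Functor.LaxMonoidal Functor.OplaxMonoidal

variable {F G : TQFT A} {Q R : Automaton A}

/-- Comparing the two identifications of the value at `+` gives a linear equivalence between free
modules on states, hence a bijection `e` of states. Equality of the values on generators, read in
coordinates, says that `e` respects the automata. -/
theorem Realization.nonempty_iso (r : Realization Q F) (r' : Realization R F) :
    Nonempty (Automaton.Iso Q R) := by
  obtain ⟨e, he⟩ := exists_equiv_of_linearEquiv (r.pos.symm ≪≫ₗ r'.pos)
  have hx (x) : r'.pos x = Finsupp.domLCongr (R := 𝔹) e (r.pos x) := by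
    rw [← he, LinearEquiv.trans_apply, LinearEquiv.symm_apply_apply]
  have hs (q) : r'.pos (r.pos.symm (Finsupp.single q 1)) = Finsupp.single (e q) 1 := by
    rw [hx, LinearEquiv.apply_symm_apply]
    simp
  have hsingle {S : Automaton A} {q q' : S.State} :
      (Finsupp.single q 1 : S.Vec) q' = 1 ↔ q = q' := by
    classical
    rw [Finsupp.single_apply]
    split_ifs with h <;> simp [h]
  refine ⟨e, fun q a q' => ?_, fun q => ?_, fun q => ?_⟩
  · have h : R.act a (Finsupp.single (e q) 1) (e q') = Q.act a (Finsupp.single q 1) q' := by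
      rw [← hs, ← r'.map_dotPlus, hx, r.map_dotPlus, LinearEquiv.apply_symm_apply,
        domLCongr_apply_apply]
    have h' := 𝔹.ext_iff.1 h
    rw [Automaton.act_eq_one, Automaton.act_eq_one] at h'
    simpa only [hsingle, exists_eq_left'] using h'
  · rw [← Automaton.initVec_eq_one, ← Automaton.initVec_eq_one, ← r'.map_halfTopPlus,
      ← r.map_halfTopPlus, hx, domLCongr_apply_apply]
  · have h : R.acceptFun (Finsupp.single (e q) 1) = Q.acceptFun (Finsupp.single q 1) := by
      rw [← hs, ← r'.map_halfBotPlus, r.map_halfBotPlus, LinearEquiv.apply_symm_apply]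
    have h' := 𝔹.ext_iff.1 h
    rw [Automaton.acceptFun_eq_one, Automaton.acceptFun_eq_one] at h'
    simpa only [hsingle, exists_eq_left'] using h'

theorem Realization.of_iso (r : Realization Q F) (e : Automaton.Iso Q R) :
    Nonempty (Realization R F) := by
  refine F.exists_realization (r.pos ≪≫ₗ Finsupp.domLCongr e.toEquiv) (fun a x => ?_) ?_ fun x => ?_
  · rw [LinearEquiv.trans_apply, LinearEquiv.trans_apply, r.map_dotPlus, e.act_domLCongr]
  · rw [LinearEquiv.trans_apply, r.map_halfTopPlus, e.initVec_eq]
  · rw [LinearEquiv.trans_apply, r.map_halfBotPlus, e.acceptFun_domLCongr]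

/-- The linear equivalence underlying an isomorphism of free modules. -/
def linOfIso {M N : FreeMod} (i : M ≅ N) : M.obj ≃ₗ[𝔹] N.obj :=
  LinearEquiv.ofLinearMap (lin i.hom) (lin i.inv)
    (LinearMap.ext fun x => congrArg (fun f => lin f x) i.inv_hom_id)
    (LinearMap.ext fun x => congrArg (fun f => lin f x) i.hom_inv_id)

/-- Only the component of `i` at `+` is transported; `exists_realization` rebuilds the
identification at `-`. -/
theorem Realization.of_natIso (r : Realization Q G) (i : F.toFunctor ≅ G.toFunctor)
    [NatTrans.IsMonoidal i.hom] : Nonempty (Realization Q F) := by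
  have hu : ε F.toFunctor ≫ i.hom.app (𝟙_ (Cob A)) = ε G.toFunctor := NatTrans.IsMonoidal.unit
  refine F.exists_realization (linOfIso (i.app Cob.plus) ≪≫ₗ r.pos) (fun a x => ?_) ?_ fun x => ?_
  · refine Eq.trans ?_ (r.map_dotPlus a _)
    exact congrArg (fun f => r.pos (lin f x)) (i.hom.naturality (Cob.dotPlus a))
  · refine Eq.trans ?_ r.map_halfTopPlus
    have h : (ε F.toFunctor ≫ F.toFunctor.map Cob.halfTopPlus) ≫ i.hom.app Cob.plus =
        ε G.toFunctor ≫ G.toFunctor.map Cob.halfTopPlus := by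
      rw [Category.assoc, i.hom.naturality, reassoc_of% hu]
    exact congrArg (fun f => r.pos (lin f (1 : 𝔹))) h
  · refine Eq.trans ?_ (r.map_halfBotPlus _)
    have h : F.toFunctor.map Cob.halfBotPlus ≫ η F.toFunctor =
        i.hom.app Cob.plus ≫ G.toFunctor.map Cob.halfBotPlus ≫ η G.toFunctor := by
      rw [← i.hom.naturality_assoc, ← cancel_mono (ε G.toFunctor)]
      simp only [Category.assoc, Functor.Monoidal.η_ε, Category.comp_id]
      rw [← hu, Functor.Monoidal.η_ε_assoc]
    exact congrArg (fun f => lin f x) h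

theorem unit_hom_ext {M : FreeMod} {f g : 𝟙_ FreeMod ⟶ M}
    (h : lin f (1 : 𝔹) = lin g (1 : 𝔹)) : f = g :=
  ObjectProperty.hom_ext _ (SemimoduleCat.hom_ext (LinearMap.ext_ring h))

/-- Two realizations of an automaton are isomorphic. -/
theorem Realization.exists_natIso (r : Realization Q F) (r' : Realization Q G) :
    ∃ i : F.toFunctor ≅ G.toFunctor, NatTrans.IsMonoidal i.hom := by
  let p : F.posObj.obj ≃ₗ[𝔹] G.posObj.obj := r.pos ≪≫ₗ r'.pos.symm
  let n : F.negObj.obj ≃ₗ[𝔹] G.negObj.obj := r.neg ≪≫ₗ r'.neg.symm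
  have hp (x) : r'.pos (p x) = r.pos x := r'.pos.apply_symm_apply _
  have hn (x) : r'.neg (n x) = r.neg x := r'.neg.apply_symm_apply _
  refine PointIso.exists_iso
    { iso := fun s => match s with
        | .plus => isoOfLin (M := F.posObj) (N := G.posObj) p
        | .minus => isoOfLin (M := F.negObj) (N := G.negObj) n
      dotPlus := fun a => hom_ext fun x => r'.pos.injective ?_
      cup := ?_
      cap := tensor_hom_ext fun y x => ?_
      halfTopPlus := unit_hom_ext (r'.pos.injective ?_)
      halfBotPlus := hom_ext fun x => ?_ }
  · refine (hp _).trans ((r.map_dotPlus a x).trans (Eq.trans ?_ (r'.map_dotPlus a (p x)).symm))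
    rw [hp]
  · refine unit_hom_ext (Eq.trans ?_ r'.map_cup.symm)
    have := Fintype.ofFinite Q.State
    -- `T` matches the two cup sums term by term, since both are indexed by the same states.
    let T : F.posObj.obj ⊗[𝔹] F.negObj.obj →ₗ[𝔹] G.posObj.obj ⊗[𝔹] G.negObj.obj :=
      TensorProduct.map p.toLinearMap n.toLinearMap
    refine (congrArg T r.map_cup).trans ?_
    rw [finsum_eq_sum_of_fintype, finsum_eq_sum_of_fintype, map_sum]
    refine Finset.sum_congr rfl fun q _ => ?_
    refine (TensorProduct.map_tmul _ _ _ _).trans ?_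
    exact congrArg₂ (fun x y => x ⊗ₜ[𝔹] y)
      (congrArg r'.pos.symm (r.pos.apply_symm_apply _))
      (congrArg r'.neg.symm (r.neg.apply_symm_apply _))
  · refine (r'.map_cap (n y) (p x)).trans (Eq.trans ?_ (r.map_cap y x).symm)
    rw [hp, hn]
  · exact (hp _).trans (r.map_halfTopPlus.trans r'.map_halfTopPlus.symm)
  · refine (r'.map_halfBotPlus (p x)).trans (Eq.trans ?_ (r.map_halfBotPlus x).symm)
    rw [hp]

end TQFT

end OneCob

/-! ### The classification. -/

theorem mainTheorem1 (A : Type*) :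
    (∀ Q : OneCob.Automaton A, ∃ F : OneCob.TQFT A, Nonempty (OneCob.TQFT.Realization Q F)) ∧
    ∃ Φ : Quotient (OneCob.Automaton.isoSetoid A) ≃ Quotient (OneCob.TQFT.isoSetoid A),
      ∀ (Q : OneCob.Automaton A) (F : OneCob.TQFT A),
        Φ (Quotient.mk _ Q) = Quotient.mk _ F ↔ Nonempty (OneCob.TQFT.Realization Q F) := by
  have hQ (Q : OneCob.Automaton A) := Q.exists_realization_tqft
  have hΦ (Q : OneCob.Automaton A) (F : OneCob.TQFT A) :
      (Quotient.mk (OneCob.TQFT.isoSetoid A) Q.tqft = Quotient.mk _ F) ↔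
        Nonempty (OneCob.TQFT.Realization Q F) := by
    obtain ⟨r⟩ := hQ Q
    rw [Quotient.eq]
    constructor
    · intro h
      obtain ⟨i, hi⟩ := (OneCob.TQFT.isoSetoid A).symm h
      exact r.of_natIso i
    · rintro ⟨r'⟩
      exact r.exists_natIso r'
  -- By `hΦ`, well-definedness only asks that `Q` be realized by the state sum of an isomorphic
  -- automaton `R`.
  let φ : Quotient (OneCob.Automaton.isoSetoid A) → Quotient (OneCob.TQFT.isoSetoid A) :=
    Quotient.lift (fun Q => Quotient.mk _ Q.tqft) (by
      rintro Q R ⟨e⟩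
      obtain ⟨r⟩ := hQ R
      exact (hΦ Q R.tqft).2 (r.of_iso
        ((OneCob.Automaton.isoSetoid A).symm ⟨e⟩).some))
  have hφ : Function.Bijective φ := by
    constructor
    -- Equal classes make the state sum of `R` a realization of both `Q` and `R`, which forces an
    -- isomorphism of automata.
    · rintro ⟨Q⟩ ⟨R⟩ h
      obtain ⟨r⟩ := (hΦ Q R.tqft).1 h
      obtain ⟨r'⟩ := hQ R
      exact Quotient.sound (r.nonempty_iso r')
    · rintro ⟨F⟩
      obtain ⟨Q, hF⟩ := F.exists_automaton
      exact ⟨Quotient.mk _ Q, (hΦ Q F).2 hF⟩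
  exact ⟨fun Q => ⟨Q.tqft, hQ Q⟩, Equiv.ofBijective φ hφ, hΦ⟩
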